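/- Let $v=e^{2\pi i/3}$, $w=v^2$, $t=v-w=\sqrt{-3}$. In $GL_3(\mathbb C)$ put $$G_{27}=\left\langle \mathrm{diag}(1,v,w),\ \begin{pmatrix}0&1&0\\0&0&1\\1&0&0\end{pmatrix}\right\rangle,\quad Q_8=\left\langle -\tfrac t3\begin{pmatrix}1&1&1\\1&v&w\\1&w&v\end{pmatrix},\ -\tfrac t3\begin{pmatrix}1&v&v\\w&v&w\\w&w&v\end{pmatrix}\right\rangle,\quad Z_3=\langle\mathrm{diag}(v,1,1)\rangle ,$$ and let $G$ be the group generated by these three subgroups. Let $\mathbb H$ be the real quaternions, with units $i,j,k$, and let $E_{128}\le GL_4(\mathbb H)$ be the group of quaternionic Dirac matrices, generated by the scalar matrices $i$, $j$ and $$\begin{pmatrix}0&0&1&0\\0&0&0&-1\\-1&0&0&0\\0&1&0&0\end{pmatrix},\ \begin{pmatrix}0&0&0&1\\0&0&1&0\\0&-1&0&0\\-1&0&0&0\end{pmatrix},\ \begin{pmatrix}0&0&-1&0\\0&0&0&-1\\1&0&0&0\\0&1&0&0\end{pmatrix},\ \begin{pmatrix}0&0&0&1\\0&0&-1&0\\0&1&0&0\\-1&0&0&0\end{pmatrix}.$$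 Let $$A=\frac12\begin{pmatrix}-1&1&1&1\\-1&1&-1&-1\\-1&-1&1&-1\\-1&-1&-1&1\end{pmatrix},\quad B=\mathrm{diag}(1,i,j,k),\quad C=\begin{pmatrix}1&0&0&0\\0&0&1&0\\0&0&0&1\\0&1&0&0\end{pmatrix},$$ and $K=\langle A,B,C\rangle\le GL_4(\mathbb H)$. A quaternionic reflection is a map $x\mapsto x-(x.r)(r.r)^{-1}(1-\lambda)r$ on row vectors $x\in\mathbb H^4$, where $x.r=\sum_m x_m\overline{r_m}$, $0\ne r\in\mathbb H^4$, $\lambda\in\mathbb H$, $|\lambda|=1$, $\lambda\neq1$; a quaternionic reflection group is a finite subgroup of $GL_4(\mathbb H)$ generated by quaternionic reflections. Let $W(E_6)$ be the Weyl group of type $E_6$, acting on the root lattice. Then: 1. $G=G_{27}\rtimes(Q_8\rtimes Z_3)$ is an internal iterated semidirect product, the factors having order $27$, $8$ (a quaternion group) and $3$, so $|G|=648$. 2. $E_{128}$ is an extraspecial $2$-group of order $128$. 3. There are a quaternionic reflection group $W\le GL_4(\mathbb H)$ containing $E_{128}$ and $K$, with $E_{128}$ normal in $W$ and $W/E_{128}$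 isomorphic to the rotation subgroup (elements of determinant $1$) of $W(E_6)$, and an injective homomorphism $\iota:G\to GL_4(\mathbb H)$ with image $K$ and $A\in\iota(G_{27})$, $B\in\iota(Q_8)$, $C\in\iota(Z_3)$, such that $\varphi(g)(e)=\iota(g)\,e\,\iota(g)^{-1}$ defines a faithful action $\varphi:G\to\mathrm{Aut}(E_{128})$. This is the unique faithful action of $G$ on $E_{128}$ up to automorphisms of $G$ and of $E_{128}$: for every injective homomorphism $\psi:G\to\mathrm{Aut}(E_{128})$ there are $\alpha\in\mathrm{Aut}(G)$ and $\beta\in\mathrm{Aut}(E_{128})$ with $\psi(g)=\beta\,\varphi(\alpha(g))\,\beta^{-1}$ for all $g\in G$. 4. The group of $4\times4$ quaternion matrices generated by $E_{128}$ and $K$ is the internal semidirect product $E_{128}\rtimes K$, and has order $82944$. 5. $\mathrm{Out}(E_{128})\cong W(E_6)$. 6. $E_{128}$ has exactly $120$ subgroups isomorphic to $Q_8$, and $\mathrm{Aut}(E_{128})$ permutes them transitively. 7. There are exactly $40$ unordered triples of subgroups of $E_{128}$ that are isomorphic to $Q_8$, commute elementwise with each other and together generate $E_{128}$ (that is, $40$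 factorisations of $E_{128}$ as a central product of three copies of $Q_8$), and $\mathrm{Aut}(E_{128})$ permutes these triples transitively. -/

import Mathlib

open scoped Quaternion Matrix

namespace QuatDirac

/-- The subgroup of the group of units of `M_n(R)` generated by the (invertible) matrices
in `S`. -/
def matrixGroup {n R : Type*} [Fintype n] [DecidableEq n] [Ring R] (S : Set (Matrix n n R)) :
    Subgroup (Matrix n n R)ˣ :=
  Subgroup.closure {u | (u : Matrix n n R) ∈ S}

/-- `G` is the internal semidirect product `N ⋊ H` of its subgroups `N` (normal) and `H`. -/
def IsSemidirect {Γ : Type*} [Group Γ] (N H G : Subgroup Γ) : Prop :=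
  (∀ h ∈ H, ∀ x ∈ N, h * x * h⁻¹ ∈ N) ∧ N ⊓ H = ⊥ ∧ N ⊔ H = G

/-! ### The complex reflection group of order 648 -/

/-- The cube root of unity `v = exp(2πi/3)`. -/
noncomputable def v : ℂ := Complex.exp (2 * Real.pi * Complex.I / 3)

/-- The cube root of unity `w = v²`. -/
noncomputable def w : ℂ := v ^ 2

/-- The square root `t = v - w` of `-3`. -/
noncomputable def t : ℂ := v - w

/-- The group `G₂₇`, generated by the modified Gell-Mann matrices. -/
noncomputable def G27 : Subgroup (Matrix (Fin 3) (Fin 3) ℂ)ˣ :=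
  matrixGroup
    {!![1, 0, 0; 0, v, 0; 0, 0, w],
     !![0, 1, 0; 0, 0, 1; 1, 0, 0]}

/-- The quaternion group `Q₈` (Pauli matrices) acting on `G₂₇`. -/
noncomputable def pauliQ8 : Subgroup (Matrix (Fin 3) (Fin 3) ℂ)ˣ :=
  matrixGroup
    {(-t / 3) • !![1, 1, 1; 1, v, w; 1, w, v],
     (-t / 3) • !![1, v, v; w, v, w; w, w, v]}

/-- The group `Z₃` generated by a complex reflection of order three. -/
noncomputable def reflZ3 : Subgroup (Matrix (Fin 3) (Fin 3) ℂ)ˣ :=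
  matrixGroup {!![v, 0, 0; 0, 1, 0; 0, 0, 1]}

/-- The group `G₂₇ ⋊ Q₈ ⋊ Z₃`, a three-dimensional complex reflection group. -/
noncomputable def G648 : Subgroup (Matrix (Fin 3) (Fin 3) ℂ)ˣ :=
  G27 ⊔ pauliQ8 ⊔ reflZ3

/-! ### Quaternionic matrices -/

/-- The quaternion unit `i`. -/
def qi : ℍ[ℝ] := ⟨0, 1, 0, 0⟩

/-- The quaternion unit `j`. -/
def qj : ℍ[ℝ] := ⟨0, 0, 1, 0⟩

/-- The quaternion unit `k`. -/
def qk : ℍ[ℝ] := ⟨0, 0, 0, 1⟩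

/-- The group `GL₄(ℍ)` of invertible `4 × 4` quaternion matrices. -/
abbrev GL4H : Type := (Matrix (Fin 4) (Fin 4) ℍ[ℝ])ˣ

/-- The group `E₁₂₈` generated by the quaternionic Dirac matrices. -/
noncomputable def E128 : Subgroup GL4H :=
  matrixGroup
    {!![qi, 0, 0, 0; 0, qi, 0, 0; 0, 0, qi, 0; 0, 0, 0, qi],
     !![qj, 0, 0, 0; 0, qj, 0, 0; 0, 0, qj, 0; 0, 0, 0, qj],
     !![0, 0, 1, 0; 0, 0, 0, -1; -1, 0, 0, 0; 0, 1, 0, 0],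
     !![0, 0, 0, 1; 0, 0, 1, 0; 0, -1, 0, 0; -1, 0, 0, 0],
     !![0, 0, -1, 0; 0, 0, 0, -1; 1, 0, 0, 0; 0, 1, 0, 0],
     !![0, 0, 0, 1; 0, 0, -1, 0; 0, 1, 0, 0; -1, 0, 0, 0]}

/-- A quaternionic Gell-Mann matrix (of order three). -/
noncomputable def gellMannMat : Matrix (Fin 4) (Fin 4) ℍ[ℝ] :=
  (1 / 2 : ℝ) • !![-1, 1, 1, 1; -1, 1, -1, -1; -1, -1, 1, -1; -1, -1, -1, 1]

/-- A quaternionic Pauli matrix (of order four). -/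
noncomputable def pauliMat : Matrix (Fin 4) (Fin 4) ℍ[ℝ] :=
  !![1, 0, 0, 0; 0, qi, 0, 0; 0, 0, qj, 0; 0, 0, 0, qk]

/-- The coordinate permutation (of order three) on the last three coordinates. -/
noncomputable def permMat : Matrix (Fin 4) (Fin 4) ℍ[ℝ] :=
  !![1, 0, 0, 0; 0, 0, 1, 0; 0, 0, 0, 1; 0, 1, 0, 0]

/-- The group of `4 × 4` quaternion matrices generated by the three matrices above. -/
noncomputable def K648 : Subgroup GL4H :=
  matrixGroup {gellMannMat, pauliMat, permMat}

/-- `g` is a quaternionic reflection: acting from the right on row vectors (a left `ℍ`-space)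
with `x.r = ∑ i, x i * star (r i)`, it is the map `x ↦ x - (x.r) (r.r)⁻¹ (1 - l) r` for some
vector `r ≠ 0` and some quaternion `l ≠ 1` of norm one. -/
def IsReflection (g : GL4H) : Prop :=
  ∃ r : Fin 4 → ℍ[ℝ], r ≠ 0 ∧ ∃ l : ℍ[ℝ], ‖l‖ = 1 ∧ l ≠ 1 ∧
    ∀ x : Fin 4 → ℍ[ℝ], ∀ m : Fin 4,
      (x ᵥ* (g : Matrix (Fin 4) (Fin 4) ℍ[ℝ])) m =
        x m - (∑ i, x i * star (r i)) * (∑ i, r i * star (r i))⁻¹ * (1 - l) * r m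

/-- A (finite) quaternionic reflection group: a finite group generated by the quaternionic
reflections that it contains. -/
def IsReflectionGroup (W : Subgroup GL4H) : Prop :=
  Finite W ∧ W = Subgroup.closure {g | g ∈ W ∧ IsReflection g}

/-! ### Group theory -/

/-- `G` is an extraspecial `p`-group: a `p`-group whose centre has order `p` and is equal to the
commutator subgroup, with elementary abelian central quotient. -/
def IsExtraspecial (p : ℕ) (G : Type*) [Group G] : Prop :=
  IsPGroup p G ∧ Nat.card (Subgroup.center G) = p ∧ commutator G = Subgroup.center G ∧
    ∀ g : G, g ^ p ∈ Subgroup.center G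

/-- The group of inner automorphisms of `G`. -/
abbrev Inner (G : Type*) [Group G] : Subgroup (MulAut G) :=
  (MulAut.conj : G →* MulAut G).range

instance inner_normal (G : Type*) [Group G] : (Inner G).Normal := by
  refine ⟨?_⟩
  rintro _ ⟨x, rfl⟩ f
  refine ⟨f x, ?_⟩
  ext y
  simp [MulAut.mul_apply]

/-- The outer automorphism group of `G`. -/
abbrev Outer (G : Type*) [Group G] : Type _ := MulAut G ⧸ Inner G

/-- The Weyl group of type `E₆`, acting on the root lattice in the basis of simple roots
`a 1, …, a 6`: it is generated by the simple reflections `a j ↦ a j - A i j • a i`, where `A` is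
the Cartan matrix. -/
def weylE6 : Subgroup (Matrix (Fin 6) (Fin 6) ℤ)ˣ :=
  matrixGroup {s | ∃ i : Fin 6, s = 1 - Matrix.vecMulVec (Pi.single i 1) (CartanMatrix.E₆ i)}

/-- The rotation subgroup (elements of determinant one) of the Weyl group of type `E₆`. -/
def weylE6Rotations : Subgroup (Matrix (Fin 6) (Fin 6) ℤ)ˣ :=
  weylE6 ⊓ (Matrix.GeneralLinearGroup.det : (Matrix (Fin 6) (Fin 6) ℤ)ˣ →* ℤˣ).ker

/-- The group `H` is isomorphic to the quaternion group of order eight. -/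
def IsQ8 {G : Type*} [Group G] (H : Subgroup G) : Prop :=
  Nonempty (H ≃* QuaternionGroup 2)

/-- The (unordered) triple `F` of subgroups is a factorisation of `G` as a central (commuting)
product of three copies of `Q₈`. -/
def IsQ8Factorisation {G : Type*} [Group G] (F : Set (Subgroup G)) : Prop :=
  F.ncard = 3 ∧ (∀ H ∈ F, IsQ8 H) ∧
    (∀ H ∈ F, ∀ K ∈ F, H ≠ K → ∀ x ∈ H, ∀ y ∈ K, x * y = y * x) ∧ sSup F = ⊤

end QuatDirac

open QuatDirac (GL4H E128 K648 G27 pauliQ8 reflZ3 G648 gellMannMat pauliMat permMat IsSemidirect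
  IsReflection IsReflectionGroup IsExtraspecial IsQ8 IsQ8Factorisation Outer Inner weylE6
  weylE6Rotations)

/-! In an extraspecial 2-group, squares and commutators make the central quotient a quadratic space
over the field with two elements. The six Dirac generators come in three pairs: the members of a
pair anticommute and square to -1, and different pairs commute. So the quotient `V` of `E128` is an
orthogonal sum of three anisotropic planes, a six-dimensional space of minus type. `M` is the
central extension of `V` by an explicit bilinear cocycle, and `repEquiv` identifies it with `E128`.

Automorphisms of `M` act on `V` by isometries (`M.bar`). The kernel consists of the inner
automorphisms because the polar form is nondegenerate (`M.ker_bar`). Every orthogonal transvection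
lifts to `M`, and transvections generate the orthogonal group `O` by a version of Witt's theorem
(`transvectionGroup_eq`); hence Out is `O`. The root lattice of type E₆ modulo two, with half its
norm, is the same quadratic space, and this identifies the Weyl group with `O` (`weylHom_injective`,
`range_weylHom`). The quaternion subgroups are the preimages of the anisotropic planes. The
complement of such a plane contains exactly two further ones, orthogonal to each other, so every Q₈
lies in a unique factorisation and there are 120/3 = 40 of these.

For uniqueness, let z generate the centre of the Heisenberg group of order 27; it is central in G.
In a faithful action z must satisfy 1 + Z + Z² = 0 on `V` (`isOmega_of_heisenberg`), which makes `V`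
a three-dimensional Hermitian space over the field with four elements. All such automorphisms of `M`
are conjugate (`M.exists_conj_of_isOmega`), and the centraliser of one has order at most |GU₃(2)| =
648 = |G| (`M.card_centralizer_le`). So G maps onto the whole centraliser, and two faithful actions,
once conjugated to the same centraliser, differ by an automorphism of G.

The reflections have the form 1 - 2P, where P = (1+s)(1+f)/4 for suitable commuting involutions s, f
of `E128`. Each one normalises `E128` and acts on `V` as a Siegel transformation, which is a product
of four transvections and hence comes from a rotation (`exists_rotation_siegel`). Thirteen of them
generate a group `W` that contains `E128` and induces all rotations. An element of `W` acting
trivially on `V` is an element of `E128` times a real scalar, and unitarity makes the scalar ±1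
(`ker_actV`).

The complex and the quaternionic generators satisfy one common list of relations, which bounds the
order of the generated group by 648. A graph argument (`IsRel.exists_hom`) then produces ι. A finite
check on `V` (`gNormal_eq`) shows that no nontrivial element of G acts trivially there, which gives
injectivity of ι and of φ and the trivial intersection of `E128` with K. -/

namespace DiracModel

/-! ### The six-dimensional quadratic space over the field with two elements -/

/-- The quadratic space of dimension six over `𝔽₂`; vectors are coded by the bits of a number
and added by exclusive or. -/
def V : Type := Fin 64

namespace V

instance : DecidableEq V := inferInstanceAs (DecidableEq (Fin 64))
instance : Fintype V := inferInstanceAs (Fintype (Fin 64))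

instance (p : V → Prop) [h : DecidablePred p] : Decidable (∀ x, p x) :=
  @Nat.decidableForallFin 64 p h

instance (p : V → Prop) [h : DecidablePred p] : Decidable (∃ x, p x) :=
  @Nat.decidableExistsFin 64 p h

/-- The vector with the given code (reduced modulo 64). -/
def ofNat (n : ℕ) : V := (⟨n % 64, Nat.mod_lt _ (by norm_num)⟩ : Fin 64)

/-- The code of a vector. -/
def code (x : V) : ℕ := Fin.val (n := 64) x

theorem ext {x y : V} (h : code x = code y) : x = y := Fin.ext h

theorem code_lt (x : V) : code x < 64 := Fin.isLt (n := 64) x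

instance : Add V := ⟨fun x y => (⟨code x ^^^ code y, Nat.xor_lt_two_pow (n := 6) (code_lt x) (code_lt y)⟩ : Fin 64)⟩
instance : Zero V := ⟨(⟨0, by norm_num⟩ : Fin 64)⟩
instance : Neg V := ⟨fun x => x⟩

theorem code_add (x y : V) : code (x + y) = code x ^^^ code y := rfl
instance : AddCommGroup V where
  add_assoc x y z := ext (Nat.xor_assoc _ _ _)
  zero_add x := ext (Nat.zero_xor _)
  add_zero x := ext (Nat.xor_zero _)
  add_comm x y := ext (Nat.xor_comm _ _)
  neg_add_cancel x := ext (Nat.xor_self _)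
  nsmul := nsmulRec
  zsmul := zsmulRec

theorem add_self (x : V) : x + x = 0 := ext (Nat.xor_self _)
theorem neg_eq (x : V) : -x = x := rfl
theorem add_add_cancel (x y : V) : x + (x + y) = y := by rw [← add_assoc, add_self, zero_add]
theorem sub_eq (x y : V) : x - y = x + y := by rw [sub_eq_add_neg, neg_eq]
theorem add_eq_zero {x y : V} : x + y = 0 ↔ x = y := by rw [← sub_eq, sub_eq_zero]

theorem card : Fintype.card V = 64 := Fintype.card_fin 64

end V

/-- The parity of the binary digit sum of a number below 64. -/
def parity (n : ℕ) : Bool := Nat.testBit 0x6996966996696996 n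

/-- The constant in `parity` is the Thue–Morse word of length 64: its bit number n is the parity of
the binary digits of n. -/
theorem parity_xor {m n : ℕ} (hm : m < 64) (hn : n < 64) :
    parity (m ^^^ n) = (parity m ^^ parity n) := by
  have h : ∀ m : Fin 64, ∀ n : Fin 64, parity (m.1 ^^^ n.1) = (parity m.1 ^^ parity n.1) := by
    decide +kernel
  exact h ⟨m, hm⟩ ⟨n, hn⟩

/-- The auxiliary linear map in the definition of the cocycle. -/
def twist (n : ℕ) : ℕ := n ^^^ ((n &&& 21) <<< 1)

/-- The bilinear cocycle of the extraspecial group. -/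
def cocycle (x y : V) : Bool := parity (x.code &&& twist y.code)

/-- The quadratic form. -/
def q (x : V) : Bool := cocycle x x

/-- The polar form of `q`. -/
def b (x y : V) : Bool := cocycle x y ^^ cocycle y x

theorem cocycle_add_left (x y z : V) : cocycle (x + y) z = (cocycle x z ^^ cocycle y z) := by
  unfold cocycle
  rw [V.code_add, Nat.and_xor_distrib_right, parity_xor]
  · exact Nat.lt_of_le_of_lt Nat.and_le_left x.code_lt
  · exact Nat.lt_of_le_of_lt Nat.and_le_left y.code_lt

theorem twist_xor (m n : ℕ) : twist (m ^^^ n) = twist m ^^^ twist n := by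
  unfold twist
  rw [Nat.and_xor_distrib_right, Nat.shiftLeft_xor_distrib]
  ac_rfl

theorem cocycle_add_right (x y z : V) : cocycle x (y + z) = (cocycle x y ^^ cocycle x z) := by
  unfold cocycle
  rw [V.code_add, twist_xor, Nat.and_xor_distrib_left, parity_xor]
  · exact Nat.lt_of_le_of_lt Nat.and_le_left x.code_lt
  · exact Nat.lt_of_le_of_lt Nat.and_le_left x.code_lt

theorem cocycle_zero_left (x : V) : cocycle 0 x = false := by
  have := cocycle_add_left 0 0 x
  rw [add_zero] at this
  revert this; cases cocycle 0 x <;> decide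

theorem cocycle_zero_right (x : V) : cocycle x 0 = false := by
  have := cocycle_add_right x 0 0
  rw [add_zero] at this
  revert this; cases cocycle x 0 <;> decide

theorem q_add (x y : V) : q (x + y) = (q x ^^ q y ^^ b x y) := by
  simp only [q, b, cocycle_add_left, cocycle_add_right]
  cases cocycle x x <;> cases cocycle x y <;> cases cocycle y x <;> cases cocycle y y <;> rfl

theorem b_comm (x y : V) : b x y = b y x := Bool.xor_comm _ _
theorem b_self (x : V) : b x x = false := Bool.xor_self _

theorem b_add_left (x y z : V) : b (x + y) z = (b x z ^^ b y z) := by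
  simp only [b, cocycle_add_left, cocycle_add_right]
  cases cocycle x z <;> cases cocycle y z <;> cases cocycle z x <;> cases cocycle z y <;> rfl

theorem b_add_right (x y z : V) : b x (y + z) = (b x y ^^ b x z) := by
  rw [b_comm, b_add_left, b_comm y, b_comm z]

theorem b_zero_left (x : V) : b 0 x = false := by
  simp [b, cocycle_zero_left, cocycle_zero_right]

theorem b_zero_right (x : V) : b x 0 = false := by rw [b_comm, b_zero_left]

theorem q_zero : q 0 = false := cocycle_zero_left 0

/-- The standard basis. -/
def e (i : Fin 6) : V := V.ofNat (2 ^ i.1)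

theorem b_nondegenerate {x : V} (h : ∀ i, b x (e i) = false) : x = 0 := by
  revert x; decide +kernel

/-- Every linear functional is represented by a vector. -/
theorem exists_b_eq (c : Fin 6 → Bool) : ∃ x, ∀ i, b x (e i) = c i := by
  -- The form pairs `e i` with `e (i xor 1)` only, so the value `c i` is produced by including the
  -- partner of `e i`.
  refine ⟨V.ofNat (cond (c 0) 2 0 ^^^ cond (c 1) 1 0 ^^^ cond (c 2) 8 0 ^^^ cond (c 3) 4 0 ^^^
    cond (c 4) 32 0 ^^^ cond (c 5) 16 0), fun i => ?_⟩
  generalize h0 : c 0 = c0, h1 : c 1 = c1, h2 : c 2 = c2, h3 : c 3 = c3, h4 : c 4 = c4, h5 : c 5 = c5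
  fin_cases i <;> simp only [Fin.mk_one, Fin.zero_eta, Fin.reduceFinMk, *] <;> clear * - <;>
    revert c0 c1 c2 c3 c4 c5 <;> decide +kernel

/-- Every vector is the sum of the basis vectors belonging to its digits. -/
theorem induction_basis {p : V → Prop} (h0 : p 0) (he : ∀ i, p (e i))
    (ha : ∀ x y, p x → p y → p (x + y)) (x : V) : p x := by
  have hs : ∀ (i : Fin 6) (c : Bool), p (if c then e i else 0) := by
    intro i c; cases c
    · exact h0
    · exact he i
  have key : ∀ x : V, x = (if x.code.testBit 0 then e 0 else 0) + ((if x.code.testBit 1 then e 1 else 0)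
      + ((if x.code.testBit 2 then e 2 else 0) + ((if x.code.testBit 3 then e 3 else 0)
      + ((if x.code.testBit 4 then e 4 else 0) + (if x.code.testBit 5 then e 5 else 0))))) := by
    decide +kernel
  rw [key x]
  exact ha _ _ (hs _ _) (ha _ _ (hs _ _) (ha _ _ (hs _ _) (ha _ _ (hs _ _)
    (ha _ _ (hs _ _) (hs _ _)))))

/-- Additive maps that agree on the basis are equal. -/
theorem ext_basis {f g : V → V} (hf : ∀ x y, f (x + y) = f x + f y)
    (hg : ∀ x y, g (x + y) = g x + g y) (h : ∀ i, f (e i) = g (e i)) (x : V) : f x = g x := by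
  refine induction_basis (p := fun x => f x = g x) ?_ h ?_ x
  · have h1 := hf 0 0; have h2 := hg 0 0
    simp only [add_zero, left_eq_add] at h1 h2
    rw [h1, h2]
  · intro x y hx hy; rw [hf, hg, hx, hy]

/-! ### The orthogonal group -/

theorem perm_apply_inv {α : Type*} (g : Equiv.Perm α) (x : α) : g (g⁻¹ x) = x :=
  g.apply_symm_apply x

theorem perm_inv_apply {α : Type*} (g : Equiv.Perm α) (x : α) : g⁻¹ (g x) = x :=
  g.symm_apply_apply x

/-- The orthogonal group of the quadratic space `V`. -/
def O : Subgroup (Equiv.Perm V) where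
  carrier := {g | (∀ x y, g (x + y) = g x + g y) ∧ ∀ x, q (g x) = q x}
  one_mem' := ⟨fun _ _ => rfl, fun _ => rfl⟩
  mul_mem' := by
    rintro g h ⟨hg, hg'⟩ ⟨hh, hh'⟩
    refine ⟨fun x y => ?_, fun x => ?_⟩
    · rw [Equiv.Perm.mul_apply, hh, hg]; rfl
    · rw [Equiv.Perm.mul_apply, hg', hh']
  inv_mem' := by
    rintro g ⟨hg, hg'⟩
    refine ⟨fun x y => ?_, fun x => ?_⟩
    · rw [Equiv.Perm.inv_eq_iff_eq, hg]; simp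
    · rw [← hg', perm_apply_inv]

theorem O.map_add {g : Equiv.Perm V} (hg : g ∈ O) (x y : V) : g (x + y) = g x + g y := hg.1 x y
theorem O.map_q {g : Equiv.Perm V} (hg : g ∈ O) (x : V) : q (g x) = q x := hg.2 x

theorem O.map_zero {g : Equiv.Perm V} (hg : g ∈ O) : g 0 = 0 := by
  have h := O.map_add hg 0 0
  simpa using h

theorem O.map_b {g : Equiv.Perm V} (hg : g ∈ O) (x y : V) : b (g x) (g y) = b x y := by
  have h1 := q_add x y
  have h2 := q_add (g x) (g y)
  rw [← O.map_add hg, O.map_q hg, O.map_q hg, O.map_q hg, h1] at h2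
  revert h2
  cases q x <;> cases q y <;> cases b x y <;> cases b (g x) (g y) <;> decide

theorem O.ext {g h : Equiv.Perm V} (hg : g ∈ O) (hh : h ∈ O) (H : ∀ i, g (e i) = h (e i)) :
    g = h :=
  Equiv.ext (ext_basis (O.map_add hg) (O.map_add hh) H)

/-- The transvection `x ↦ x + b(x,u) u`, as a function. -/
def transvect (u x : V) : V := if b x u then x + u else x

theorem transvect_transvect (u x : V) : transvect u (transvect u x) = x := by
  unfold transvect
  by_cases h : b x u
  · simp [h, b_add_left, b_self, add_assoc, V.add_self]
  · simp [h]

/-- The transvection `x ↦ x + b(x,u) u`. -/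
def transvection (u : V) : Equiv.Perm V :=
  ⟨transvect u, transvect u, transvect_transvect u, transvect_transvect u⟩

theorem transvection_apply (u x : V) : transvection u x = transvect u x := rfl

theorem transvection_inv (u : V) : (transvection u)⁻¹ = transvection u := rfl

theorem transvection_mul_self (u : V) : transvection u * transvection u = 1 :=
  Equiv.ext (transvect_transvect u)

theorem transvect_add (u x y : V) : transvect u (x + y) = transvect u x + transvect u y := by
  unfold transvect
  rw [b_add_left]
  cases b x u <;> cases b y u
  · simp
  · simp [add_assoc]
  · simp [add_right_comm]
  · simp only [Bool.xor_self, Bool.false_eq_true, if_false, if_true]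
    rw [add_add_add_comm, V.add_self, add_zero]

theorem transvection_mem {u : V} (hu : q u = true) : transvection u ∈ O := by
  refine ⟨transvect_add u, fun x => ?_⟩
  rw [transvection_apply]
  unfold transvect
  by_cases h : b x u
  · simp [h, q_add, hu]
  · simp [h]

theorem transvection_zero : transvection 0 = 1 := by
  ext x
  simp [transvection_apply, transvect, b_zero_right]

theorem conj_transvection {g : Equiv.Perm V} (hg : g ∈ O) (u : V) :
    g * transvection u * g⁻¹ = transvection (g u) := by
  ext x
  simp only [Equiv.Perm.mul_apply, transvection_apply, transvect]
  have hb : b (g⁻¹ x) u = b x (g u) := by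
    rw [← O.map_b hg, perm_apply_inv]
  rw [hb]
  by_cases h : b x (g u)
  · simp [h, O.map_add hg]
  · simp [h]

/-- The group generated by the orthogonal transvections. -/
def transvectionGroup : Subgroup (Equiv.Perm V) :=
  Subgroup.closure {g | ∃ u, q u = true ∧ g = transvection u}

theorem transvectionGroup_le : transvectionGroup ≤ O := by
  rw [transvectionGroup, Subgroup.closure_le]
  rintro _ ⟨u, hu, rfl⟩
  exact transvection_mem hu

theorem transvection_mem_transvectionGroup {u : V} (hu : q u = true) :
    transvection u ∈ transvectionGroup :=
  Subgroup.subset_closure ⟨u, hu, rfl⟩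

/-- The vectors whose transvections are used at stage `k` of Witt's theorem. -/
def Admissible (k : Fin 6) (u : V) : Prop :=
  (u = 0 ∨ q u = true) ∧ ∀ j, j < k → b (e j) u = false

instance (k : Fin 6) (u : V) : Decidable (Admissible k u) := by
  unfold Admissible; infer_instance

theorem Admissible.mem {k : Fin 6} {u : V} (h : Admissible k u) :
    transvection u ∈ transvectionGroup := by
  rcases h.1 with rfl | h
  · rw [transvection_zero]; exact one_mem _
  · exact transvection_mem_transvectionGroup h

theorem Admissible.fix {k : Fin 6} {u : V} (h : Admissible k u) {j : Fin 6} (hj : j < k) :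
    transvection u (e j) = e j := by
  simp [transvection_apply, transvect, h.2 j hj]

/-- An isometry interchanging the second and the third hyperplane pair of the basis. -/
def swapPairs (x : V) : V :=
  transvect (V.ofNat 61) (transvect (V.ofNat 41) (transvect (V.ofNat 21) (transvect (V.ofNat 1) x)))

/-- This is Witt extension with transvections that fix the earlier basis vectors; `u = 0` allows
fewer than two. The second alternative is needed because, once `e 0` and `e 1` are fixed, the
complement is the plus-type space of dimension four, the exception to generation by transvections:
its six nonsingular vectors lie in two orthogonal planes, and their transvections never exchange
these planes. `swapPairs` exchanges them by transvections that involve `e 0`; it is the Siegel map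
of `e 2 + e 4` and `e 3 + e 5`. -/
theorem exists_two_transvections : ∀ k : Fin 6, ∀ x : V, q x = q (e k) →
    (∀ j, j < k → b x (e j) = b (e k) (e j)) →
    (∃ u, Admissible k u ∧ Admissible k (transvect u x + e k) ∧
      transvect (transvect u x + e k) (transvect u x) = e k) ∨
    (∀ j, j < k → swapPairs (e j) = e j) ∧
    (∃ u, Admissible k u ∧ Admissible k (transvect u (swapPairs x) + e k) ∧
      transvect (transvect u (swapPairs x) + e k) (transvect u (swapPairs x)) = e k) := by
  decide +kernel

theorem witt_step (k : Fin 6) (x : V) (hq : q x = q (e k))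
    (hb : ∀ j, j < k → b x (e j) = b (e k) (e j)) :
    ∃ g ∈ transvectionGroup, g x = e k ∧ ∀ j, j < k → g (e j) = e j := by
  rcases exists_two_transvections k x hq hb with ⟨u, h1, h2, h3⟩ | ⟨hs, u, h1, h2, h3⟩
  · refine ⟨transvection (transvect u x + e k) * transvection u, mul_mem h2.mem h1.mem, h3, ?_⟩
    intro j hj
    rw [Equiv.Perm.mul_apply, h1.fix hj, h2.fix hj]
  · refine ⟨transvection (transvect u (swapPairs x) + e k) * transvection u *
      (transvection (V.ofNat 61) * transvection (V.ofNat 41) * transvection (V.ofNat 21) *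
        transvection (V.ofNat 1)), mul_mem (mul_mem h2.mem h1.mem) ?_, h3, ?_⟩
    · refine mul_mem (mul_mem (mul_mem ?_ ?_) ?_) ?_ <;>
        exact transvection_mem_transvectionGroup (by decide +kernel)
    · intro j hj
      have : (transvection (V.ofNat 61) * transvection (V.ofNat 41) * transvection (V.ofNat 21) *
        transvection (V.ofNat 1)) (e j) = e j := hs j hj
      rw [Equiv.Perm.mul_apply, this, Equiv.Perm.mul_apply, h1.fix hj, h2.fix hj]

/-- Witt's theorem for initial segments of the standard basis. -/
theorem witt (n : ℕ) (hn : n ≤ 6) (x : Fin 6 → V) (hq : ∀ i : Fin 6, i.1 < n → q (x i) = q (e i))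
    (hb : ∀ i j : Fin 6, i.1 < n → j.1 < n → b (x i) (x j) = b (e i) (e j)) :
    ∃ g ∈ transvectionGroup, ∀ i : Fin 6, i.1 < n → g (x i) = e i := by
  induction n with
  | zero => exact ⟨1, one_mem _, fun i hi => absurd hi (by omega)⟩
  | succ n ih =>
    obtain ⟨g, hg, hgx⟩ := ih (by omega) (fun i hi => hq i (by omega))
      (fun i j hi hj => hb i j (by omega) (by omega))
    have hO := transvectionGroup_le hg
    obtain ⟨h, hh, hh1, hh2⟩ := witt_step ⟨n, by omega⟩ (g (x ⟨n, by omega⟩))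
      (by rw [O.map_q hO]; exact hq _ (by simp))
      (fun j hj => by
        have hj' : j.1 < n := hj
        -- As `e j` is the image of `x j` under `g`, the required products are products of the
        -- original vectors.
        rw [← hgx j hj', O.map_b hO, hb _ _ (by simp) (by omega), hgx j hj'])
    refine ⟨h * g, mul_mem hh hg, fun i hi => ?_⟩
    rw [Equiv.Perm.mul_apply]
    rcases Nat.lt_succ_iff_lt_or_eq.1 hi with hlt | heq
    · rw [hgx i hlt, hh2 i hlt]
    · have : i = ⟨n, by omega⟩ := Fin.ext heq
      rw [this]
      exact hh1

/-- The orthogonal group is generated by transvections. -/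
theorem transvectionGroup_eq : transvectionGroup = O := by
  refine le_antisymm transvectionGroup_le fun g hg => ?_
  have hg' := inv_mem hg
  -- A product of transvections that carries `g⁻¹ (e i)` back to `e i` for all `i` must be `g`
  -- itself.
  obtain ⟨h, hh, hx⟩ := witt 6 le_rfl (fun i => g⁻¹ (e i)) (fun i _ => O.map_q hg' _)
    (fun i j _ _ => O.map_b hg' _ _)
  have : h * g⁻¹ = 1 := O.ext (mul_mem (transvectionGroup_le hh) hg') (one_mem _)
    (fun i => hx i i.2)
  rwa [← mul_inv_eq_one.1 this]

/-! ### The extraspecial group of order 128 -/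

/-- The extraspecial group `2^{1+6}` of minus type, as a central extension of `V`. -/
@[ext]
structure M where
  /-- The sign bit. -/
  sign : Bool
  /-- The image in the central quotient. -/
  vec : V

namespace M

instance : Mul M := ⟨fun x y => ⟨x.sign ^^ y.sign ^^ cocycle x.vec y.vec, x.vec + y.vec⟩⟩
instance : One M := ⟨⟨false, 0⟩⟩
instance : Inv M := ⟨fun x => ⟨x.sign ^^ q x.vec, x.vec⟩⟩

theorem mul_sign (x y : M) : (x * y).sign = (x.sign ^^ y.sign ^^ cocycle x.vec y.vec) := rfl
theorem mul_vec (x y : M) : (x * y).vec = x.vec + y.vec := rfl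
theorem one_sign : (1 : M).sign = false := rfl
theorem one_vec : (1 : M).vec = 0 := rfl
theorem inv_vec (x : M) : (x⁻¹).vec = x.vec := rfl
theorem inv_sign (x : M) : (x⁻¹).sign = (x.sign ^^ q x.vec) := rfl

instance : Group M :=
  Group.ofLeftAxioms
    (by
      intro x y z
      ext
      · simp only [mul_sign, mul_vec, cocycle_add_left, cocycle_add_right]
        cases x.sign <;> cases y.sign <;> cases z.sign <;> cases cocycle x.vec y.vec <;>
          cases cocycle x.vec z.vec <;> cases cocycle y.vec z.vec <;> rfl
      · exact add_assoc _ _ _)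
    (by
      intro x
      ext
      · simp [mul_sign, one_sign, one_vec, cocycle_zero_left]
      · exact zero_add _)
    (by
      intro x
      ext
      · simp only [mul_sign, one_sign, inv_sign, inv_vec, q]
        cases x.sign <;> cases cocycle x.vec x.vec <;> rfl
      · exact V.add_self _)

/-- The pairs of a sign and a vector. -/
def equivProd : M ≃ Bool × V where
  toFun x := (x.sign, x.vec)
  invFun x := ⟨x.1, x.2⟩

instance : Fintype M := Fintype.ofEquiv _ equivProd.symm

theorem card : Nat.card M = 128 := by
  rw [Nat.card_congr equivProd, Nat.card_prod, Nat.card_eq_fintype_card, Nat.card_eq_fintype_card,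
    V.card, Fintype.card_bool]

/-- The element of `M` with given sign and trivial vector. -/
def sgn (c : Bool) : M := ⟨c, 0⟩

theorem sgn_false : sgn false = 1 := rfl

theorem sgn_mul (c : Bool) (x : M) : sgn c * x = ⟨c ^^ x.sign, x.vec⟩ := by
  ext
  · simp [mul_sign, sgn, cocycle_zero_left]
  · exact zero_add _

theorem mul_sgn (c : Bool) (x : M) : x * sgn c = ⟨c ^^ x.sign, x.vec⟩ := by
  ext
  · simp [mul_sign, sgn, cocycle_zero_right, Bool.xor_comm]
  · exact add_zero _

theorem sgn_comm (c : Bool) (x : M) : x * sgn c = sgn c * x := by rw [sgn_mul, mul_sgn]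

theorem sgn_mul_sgn (c d : Bool) : sgn c * sgn d = sgn (c ^^ d) := by rw [sgn_mul]; rfl

theorem eq_sgn_mul_of_vec_eq {x y : M} (h : x.vec = y.vec) : x = sgn (x.sign ^^ y.sign) * y := by
  rw [sgn_mul]
  ext
  · simp
  · exact h

theorem vec_eq_zero_iff {x : M} : x.vec = 0 ↔ x = sgn x.sign :=
  ⟨fun h => M.ext rfl h, fun h => by rw [h]; rfl⟩

/-- Together with `mul_comm_sgn` this ties the group to the geometry: squares are given by `q` and
commutators by `b`. -/
theorem mul_self (x : M) : x * x = sgn (q x.vec) := by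
  ext
  · simp [mul_sign, sgn, q]
  · exact V.add_self _

theorem mul_comm_sgn (x y : M) : x * y = sgn (b x.vec y.vec) * (y * x) := by
  rw [sgn_mul]
  ext
  · simp only [mul_sign, b]
    cases x.sign <;> cases y.sign <;> cases cocycle x.vec y.vec <;> cases cocycle y.vec x.vec <;> rfl
  · exact add_comm _ _

theorem conj_eq (x y : M) : x * y * x⁻¹ = sgn (b x.vec y.vec) * y := by
  rw [mul_comm_sgn x y, mul_assoc, mul_assoc, mul_inv_cancel, mul_one]

theorem sgn_true_ne_one : sgn true ≠ 1 := fun h => Bool.noConfusion (congrArg sign h)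

theorem sgn_injective : Function.Injective sgn := fun _ _ h => congrArg sign h

theorem commute_iff {x y : M} : x * y = y * x ↔ b x.vec y.vec = false := by
  rw [mul_comm_sgn, mul_eq_right, ← sgn_false, sgn_injective.eq_iff]

/-- A lift of a vector. -/
def lift (x : V) : M := ⟨false, x⟩

theorem lift_vec (x : V) : (lift x).vec = x := rfl

theorem mem_center_iff {x : M} : x ∈ Subgroup.center M ↔ x.vec = 0 := by
  rw [Subgroup.mem_center_iff]
  constructor
  · intro h
    refine b_nondegenerate fun i => ?_
    have := commute_iff.1 (h (lift (e i))).symm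
    rwa [lift_vec] at this
  · intro h y
    rw [vec_eq_zero_iff.1 h, sgn_comm]

/-- The centre has only two elements and is preserved, so its nontrivial element is fixed. -/
theorem map_sgn_true (f : MulAut M) : f (sgn true) = sgn true := by
  have h : f (sgn true) ∈ Subgroup.center M := by
    rw [Subgroup.mem_center_iff]
    intro y
    have hy := congrArg f (sgn_comm true (f⁻¹ y))
    rwa [map_mul, map_mul, MulAut.apply_inv_self] at hy
  have h2 : f (sgn true) = sgn (f (sgn true)).sign := vec_eq_zero_iff.1 (mem_center_iff.1 h)
  rcases hs : (f (sgn true)).sign with _ | _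
  · rw [hs, sgn_false] at h2
    exact absurd (f.injective (h2.trans (map_one f).symm)) sgn_true_ne_one
  · rwa [hs] at h2

theorem map_sgn (f : MulAut M) (c : Bool) : f (sgn c) = sgn c := by
  cases c
  · exact map_one f
  · exact map_sgn_true f

theorem map_vec (f : MulAut M) (x : M) : (f x).vec = (f (lift x.vec)).vec := by
  have h : x = sgn (x.sign ^^ (lift x.vec).sign) * lift x.vec := eq_sgn_mul_of_vec_eq rfl
  conv_lhs => rw [h, map_mul, map_sgn, mul_vec]
  exact zero_add _

/-- The action of the automorphism group of `M` on `V`. -/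
def bar : MulAut M →* Equiv.Perm V where
  toFun f :=
    { toFun := fun x => (f (lift x)).vec
      invFun := fun x => (f⁻¹ (lift x)).vec
      left_inv := fun x => by
        change (f⁻¹ (lift (f (lift x)).vec)).vec = x
        rw [← map_vec, ← MulAut.mul_apply, inv_mul_cancel]; rfl
      right_inv := fun x => by
        change (f (lift (f⁻¹ (lift x)).vec)).vec = x
        rw [← map_vec, ← MulAut.mul_apply, mul_inv_cancel]; rfl }
  map_one' := rfl
  map_mul' f g := by
    ext x
    change ((f * g) (lift x)).vec = (f (lift ((g (lift x)).vec))).vec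
    rw [← map_vec]; rfl

theorem bar_apply (f : MulAut M) (x : M) : bar f x.vec = (f x).vec := (map_vec f x).symm

theorem bar_mem (f : MulAut M) : bar f ∈ O := by
  refine ⟨fun x y => ?_, fun x => ?_⟩
  · have := bar_apply f (lift x * lift y)
    rw [map_mul, mul_vec, mul_vec, ← bar_apply, ← bar_apply] at this
    exact this
  · have := congrArg f (mul_self (lift x))
    rw [map_mul, map_sgn, mul_self] at this
    exact sgn_injective this

theorem bar_conj (x : M) : bar (MulAut.conj x) = 1 := by
  ext y
  change (x * lift y * x⁻¹).vec = y
  rw [conj_eq, sgn_mul]; rfl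

theorem conj_lift_vec (x : M) : MulAut.conj (lift x.vec) = MulAut.conj x := by
  ext1 y
  rw [MulAut.conj_apply, MulAut.conj_apply, conj_eq, conj_eq]; rfl

/-- An automorphism acting trivially on `V` is inner. -/
theorem exists_conj_of_bar_eq_one {f : MulAut M} (hf : bar f = 1) :
    ∃ x : V, f = MulAut.conj (lift x) := by
  have hv : ∀ y, (f y).vec = y.vec := fun y => by rw [← bar_apply, hf]; rfl
  -- Such an automorphism changes lifts only by signs, and these signs form a linear functional on
  -- `V`. It is represented by a vector `x` through `b`, and conjugation by the lift of `x`
  -- introduces exactly the same signs.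
  obtain ⟨x, hx⟩ := exists_b_eq (fun i => (f (lift (e i))).sign)
  refine ⟨x, ?_⟩
  have key : ∀ y, f (lift y) = sgn (b x y) * lift y := by
    refine induction_basis ?_ ?_ ?_
    · rw [b_zero_right, sgn_false, one_mul]; exact map_one f
    · intro i
      rw [hx, sgn_mul]
      ext
      · simp [lift]
      · exact hv _
    · intro y z hy hz
      have h : lift (y + z) = sgn (cocycle y z) * (lift y * lift z) := by
        rw [sgn_mul]; ext
        · simp [lift, mul_sign]
        · rfl
      rw [h, map_mul, map_mul, map_sgn, hy, hz, b_add_right, ← sgn_mul_sgn]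
      simp only [mul_assoc]
      rw [← mul_assoc (lift y) (sgn (b x z)), sgn_comm (b x z) (lift y)]
      simp only [← mul_assoc]
      simp only [sgn_mul_sgn]
      congr 3
      cases cocycle y z <;> cases b x y <;> cases b x z <;> rfl
  ext1 y
  have h : y = sgn (y.sign ^^ (lift y.vec).sign) * lift y.vec := eq_sgn_mul_of_vec_eq rfl
  have hv' : b (lift x).vec y.vec = b x y.vec := rfl
  rw [MulAut.conj_apply, conj_eq, hv']
  conv_lhs => rw [h, map_mul, map_sgn, key]
  conv_rhs => rw [congrArg (sgn (b x y.vec) * ·) h]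
  simp only [← mul_assoc, sgn_mul_sgn]
  rw [Bool.xor_comm]

/-- The automorphism of `M` induced by conjugation with `1 + u`, where `u² = -1`. -/
def transvectionAut (u : M) (hu : q u.vec = true) : MulAut M where
  toFun x := if b x.vec u.vec then u * x else x
  invFun x := if b x.vec u.vec then u⁻¹ * x else x
  left_inv x := by
    by_cases h : b x.vec u.vec <;> simp [h, mul_vec, b_add_left, b_self]
  right_inv x := by
    by_cases h : b x.vec u.vec <;> simp [h, mul_vec, inv_vec, b_add_left, b_self]
  map_mul' x y := by
    rw [mul_vec, b_add_left]
    by_cases hx : b x.vec u.vec <;> by_cases hy : b y.vec u.vec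
    · simp only [hx, hy, Bool.xor_self, Bool.false_eq_true, if_false, if_true]
      have h1 : u * x = sgn true * (x * u) := by rw [mul_comm_sgn, b_comm, hx]
      rw [h1, mul_assoc, mul_assoc x, ← mul_assoc u, mul_self, hu, ← mul_assoc x, sgn_comm,
        mul_assoc, ← mul_assoc, sgn_mul_sgn, Bool.xor_self, sgn_false, one_mul]
    · simp [hx, hy, mul_assoc]
    · have h1 : x * u = u * x := commute_iff.2 (by simpa using hx)
      simp [hx, hy, ← mul_assoc, h1]
    · simp [hx, hy]

theorem bar_transvectionAut (u : M) (hu : q u.vec = true) :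
    bar (transvectionAut u hu) = transvection u.vec := by
  ext x
  change ((if b x u.vec then u * lift x else lift x) : M).vec = transvect u.vec x
  unfold transvect
  by_cases h : b x u.vec
  · simp [h, mul_vec, lift, add_comm]
  · simp [h, lift]

/-- Only transvections have to be lifted to `M`, since they generate `O`. -/
theorem range_bar : bar.range = O := by
  refine le_antisymm ?_ ?_
  · rintro _ ⟨f, rfl⟩; exact bar_mem f
  · rw [← transvectionGroup_eq, transvectionGroup, Subgroup.closure_le]
    rintro _ ⟨u, hu, rfl⟩
    exact ⟨transvectionAut (lift u) hu, bar_transvectionAut _ _⟩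

theorem ker_bar : bar.ker = QuatDirac.Inner M := by
  ext f
  rw [MonoidHom.mem_ker]
  constructor
  · intro h
    obtain ⟨x, rfl⟩ := exists_conj_of_bar_eq_one h
    exact ⟨_, rfl⟩
  · rintro ⟨x, rfl⟩
    exact bar_conj x

theorem exists_bar_eq {g : Equiv.Perm V} (hg : g ∈ O) : ∃ f, bar f = g := by
  rwa [← range_bar] at hg

end M

/-! ### Fixed-point-free automorphisms of order three -/

/-- An additive map `Z` on `V` such that `1 + Z + Z² = 0`. -/
def IsOmega (Z : V → V) : Prop := ∀ x, x + Z x + Z (Z x) = 0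

/-- On the image of `1 + Z` the map `Z` is multiplication by a primitive cube root of unity, so that
image is a vector space over the field with four elements. There `A` is diagonalisable with
eigenvalues 1, `Z`, `Z²`, and `AB = ZBA` says that `B` permutes the eigenspaces cyclically. All
three therefore have the same size, at least 4, and together they have at least 64 elements, which
is all of `V`. -/
theorem isOmega_of_heisenberg (A B Z : V →+ V) (hA : ∀ x, A (A (A x)) = x)
    (hZ : ∀ x, Z (Z (Z x)) = x) (hB : Function.Injective B) (hAB : ∀ x, A (B x) = Z (B (A x)))
    (hZA : ∀ x, Z (A x) = A (Z x)) (hZB : ∀ x, Z (B x) = B (Z x)) (hne : ∃ y, Z y ≠ y) :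
    IsOmega Z := by
  obtain ⟨y, hy⟩ := hne
  -- a nonzero vector in the image of `1 + Z`
  obtain ⟨y, hy0, hyZ⟩ : ∃ y, y ≠ 0 ∧ y + Z y + Z (Z y) = 0 := by
    refine ⟨y + Z y, fun h => hy (V.add_eq_zero.1 h).symm, ?_⟩
    simp only [map_add, hZ]
    simp [add_comm, add_left_comm, V.add_self, V.add_add_cancel]
  have hyZ' : Z (Z y) = y + Z y := (V.add_eq_zero.1 hyZ).symm
  -- The eigenspace of `A` with eigenvalue 1 inside the part where `1 + Z + Z²` vanishes.
  let U : AddSubgroup V :=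
    { carrier := {u | A u = u ∧ u + Z u + Z (Z u) = 0}
      zero_mem' := by simp
      add_mem' := by
        rintro u v ⟨hu, hu'⟩ ⟨hv, hv'⟩
        refine ⟨by rw [map_add, hu, hv], ?_⟩
        simp only [map_add]
        rw [← V.add_eq_zero.1 hu', ← V.add_eq_zero.1 hv']
        simp [add_comm, add_left_comm, V.add_self]
      neg_mem' := fun {u} hu => hu }
  obtain ⟨x, hxU, hx0⟩ : ∃ x ∈ U, x ≠ 0 := by
    -- These are the three eigenprojections of `y`, with eigenvalues 1, `Z²` and `Z`. Their sum is
    -- `y`, so one is nonzero; applying `B` zero, one or two times moves it into `U`.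
    have hsum : (y + A y + A (A y)) + (y + Z (A y) + Z (Z (A (A y)))) +
        (y + Z (Z (A y)) + Z (A (A y))) = y := by
      simp only [hZA, hyZ', map_add]
      simp [add_comm, add_left_comm, V.add_self, V.add_add_cancel]
    have hcase : (y + A y + A (A y)) ≠ 0 ∨ (y + Z (A y) + Z (Z (A (A y)))) ≠ 0 ∨
        (y + Z (Z (A y)) + Z (A (A y))) ≠ 0 := by
      by_contra! h
      rw [h.1, h.2.1, h.2.2] at hsum
      exact hy0 (by simpa using hsum.symm)
    have hB0 : ∀ x, x ≠ 0 → B x ≠ 0 := fun x hx h => hx (hB (h.trans (map_zero B).symm))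
    rcases hcase with h | h | h
    · refine ⟨_, ⟨?_, ?_⟩, h⟩
      · simp only [map_add, hA]
        simp [add_comm, add_left_comm]
      · simp only [map_add, hZA, hyZ']
        simp [add_comm, add_left_comm, V.add_self]
    · refine ⟨_, ⟨?_, ?_⟩, hB0 _ h⟩
      · simp only [map_add, hAB, hZA, hZB, hyZ', hA]
        simp [add_comm, add_left_comm, V.add_self]
      · simp only [map_add, hZA, hZB, hyZ']
        simp [add_comm, add_left_comm, V.add_self, V.add_add_cancel]
    · refine ⟨_, ⟨?_, ?_⟩, hB0 _ (hB0 _ h)⟩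
      · simp only [map_add, hAB, hZA, hZB, hyZ', hA]
        simp [add_comm, add_left_comm, V.add_self, V.add_add_cancel]
      · simp only [map_add, hZA, hZB, hyZ']
        simp [add_comm, add_left_comm, V.add_self, V.add_add_cancel]
  have hZZ : ∀ u ∈ U, Z (Z u) = u + Z u := fun u hu => (V.add_eq_zero.1 hu.2).symm
  have hZU : Z x ∈ U := ⟨by rw [← hZA, hxU.1], by
    rw [hZ, hZZ x hxU]; simp [add_left_comm, V.add_self]⟩
  have hZx : Z x ≠ x := by
    intro h
    have := hxU.2
    rw [h, h, V.add_self, zero_add] at this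
    exact hx0 this
  have hZx0 : Z x ≠ 0 := by
    intro h
    have := hxU.2
    rw [h, map_zero, add_zero, add_zero] at this
    exact hx0 this
  have hU4 : 4 ≤ Nat.card U := by
    have hsub : (({0, x, Z x, x + Z x} : Finset V) : Set V) ⊆ (U : Set V) := by
      intro u hu
      simp only [Finset.coe_insert, Finset.coe_singleton, Set.mem_insert_iff,
        Set.mem_singleton_iff] at hu
      rcases hu with rfl | rfl | rfl | rfl
      · exact U.zero_mem
      · exact hxU
      · exact hZU
      · exact U.add_mem hxU hZU
    have h1 := Set.ncard_le_ncard hsub (Set.toFinite _)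
    rw [Set.ncard_coe_finset] at h1
    have h2 : ({0, x, Z x, x + Z x} : Finset V).card = 4 := by
      rw [Finset.card_insert_of_notMem, Finset.card_insert_of_notMem, Finset.card_insert_of_notMem,
        Finset.card_singleton]
      · simpa using hx0
      · simpa [hZx0] using hZx.symm
      · have : x + Z x ≠ 0 := fun h => hZx (V.add_eq_zero.1 h).symm
        simp [hx0.symm, hZx0.symm, this.symm]
    rw [h2] at h1
    rwa [← Nat.card_coe_set_eq] at h1
  -- the projection to `U` along its translates
  have hproj : ∀ u ∈ U, ∀ v ∈ U, ∀ w ∈ U, u + B v + B (B w) = 0 → u = 0 ∧ v + B w = 0 := by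
    intro u hu v hv w hw h
    have h0 : u = 0 := by
      -- Applying `1 + A + A²` keeps the eigenvector `u` (as 3 = 1) and kills `B v` and `B (B w)`,
      -- whose eigenvalues are `Z` and `Z²`.
      have h1 : (u + B v + B (B w)) + A (u + B v + B (B w)) + A (A (u + B v + B (B w))) = u := by
        have hAv : A (Z v) = Z v := by rw [← hZA, hv.1]
        have hAw : A (Z w) = Z w := by rw [← hZA, hw.1]
        simp only [map_add, hAB, hu.1, hv.1, hw.1, hZB, hAv, hAw, hZZ v hv, hZZ w hw]
        simp [add_comm, add_left_comm, V.add_self, V.add_add_cancel]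
      rw [h] at h1
      simpa using h1.symm
    refine ⟨h0, hB ?_⟩
    rw [map_zero, map_add, ← h, h0, zero_add]
  let F : U × U × U → V := fun p => p.1 + B p.2.1 + B (B p.2.2)
  have hF : Function.Injective F := by
    rintro ⟨u, v, w⟩ ⟨u', v', w'⟩ h
    have h1 : ((u : V) + u') + B (v + v') + B (B (w + w')) = 0 := by
      have h' : (u : V) + B v + B (B w) = u' + B v' + B (B w') := h
      rw [← V.add_eq_zero.2 h', map_add, map_add, map_add]
      abel
    obtain ⟨h2, h3⟩ := hproj _ (U.add_mem u.2 u'.2) _ (U.add_mem v.2 v'.2) _ (U.add_mem w.2 w'.2) h1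
    obtain ⟨h4, h5⟩ := hproj _ (U.add_mem v.2 v'.2) _ (U.add_mem w.2 w'.2) 0 U.zero_mem
      (by simpa using h3)
    have h6 : (w : V) + w' = 0 := by simpa using h5
    simp only [Prod.mk.injEq]
    exact ⟨Subtype.ext (V.add_eq_zero.1 h2), Subtype.ext (V.add_eq_zero.1 h4),
      Subtype.ext (V.add_eq_zero.1 h6)⟩
  have hV : Nat.card V = 64 := by rw [Nat.card_eq_fintype_card, V.card]
  -- An injection from a set of at least 4³ elements into the 64 elements of `V` is onto.
  have hsurj : Function.Surjective F := by
    refine (Function.Injective.bijective_of_nat_card_le hF ?_).2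
    rw [hV, Nat.card_prod, Nat.card_prod]
    nlinarith
  intro z
  obtain ⟨⟨u, v, w⟩, rfl⟩ := hsurj z
  change ((u : V) + B v + B (B w)) + Z (u + B v + B (B w)) + Z (Z (u + B v + B (B w))) = 0
  simp only [map_add, hZB, hZZ _ u.2, hZZ _ v.2, hZZ _ w.2]
  simp [add_comm, add_left_comm, V.add_self]

theorem IsOmega.apply_apply {Z : V → V} (hω : IsOmega Z) (x : V) : Z (Z x) = x + Z x :=
  (V.add_eq_zero.1 (hω x)).symm

/-- Expand `q (Z (Z x)) = q (x + Z x)` and use that `Z` preserves `q`. Thus `x` and `Z x` span an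
anisotropic plane whenever `q x = true`. -/
theorem IsOmega.b_apply {Z : Equiv.Perm V} (hω : IsOmega Z) (hZ : Z ∈ O) (x : V) :
    b x (Z x) = q x := by
  have h := q_add x (Z x)
  rw [← hω.apply_apply, O.map_q hZ, O.map_q hZ] at h
  revert h
  cases q x <;> cases b x (Z x) <;> decide

theorem IsOmega.b_apply_right {Z : Equiv.Perm V} (hω : IsOmega Z) (hZ : Z ∈ O) {x y : V}
    (h : b x y = false) (h' : b (Z x) y = false) : b x (Z y) = false := by
  rw [← O.map_b hZ, hω.apply_apply, b_add_right, O.map_b hZ, h, h']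
  rfl

/-- The bilinear form on the standard basis. -/
theorem b_e (i j : Fin 6) : b (e i) (e j) = (i.1 ^^^ 1 == j.1) := by
  revert i j; decide +kernel

theorem q_e (i : Fin 6) : q (e i) = true := by
  revert i; decide +kernel

/-- Every isometry satisfying `1 + Z + Z² = 0` has a standard form. -/
theorem IsOmega.exists_frame {Z : Equiv.Perm V} (hω : IsOmega Z) (hZ : Z ∈ O) :
    ∃ g ∈ O, g (Z (g⁻¹ (e 0))) = e 1 ∧ g (Z (g⁻¹ (e 2))) = e 3 ∧ g (Z (g⁻¹ (e 4))) = e 5 := by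
  have hq : ∀ x, q (Z x) = q x := O.map_q hZ
  have hbZ : ∀ x y, b (Z x) (Z y) = b x y := O.map_b hZ
  -- One statement covers the three uses of Witt's theorem, for the first 2, 4 and 6 vectors; slots
  -- beyond `n` are filled with arbitrary nonsingular vectors.
  have main : ∀ x y z : V, q x = true → q y = true → q z = true → ∀ n ≤ 6,
      (2 < n → b x y = false ∧ b (Z x) y = false) →
      (4 < n → b x z = false ∧ b (Z x) z = false ∧ b y z = false ∧ b (Z y) z = false) →
      ∃ g ∈ O, ∀ i : Fin 6, i.1 < n → g (![x, Z x, y, Z y, z, Z z] i) = e i := by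
    intro x y z hx hy hz n hn h2 h4
    have h2' : 2 < n → b x (Z y) = false := fun h => hω.b_apply_right hZ (h2 h).1 (h2 h).2
    have h4' : 4 < n → b x (Z z) = false := fun h => hω.b_apply_right hZ (h4 h).1 (h4 h).2.1
    have h4'' : 4 < n → b y (Z z) = false := fun h => hω.b_apply_right hZ (h4 h).2.2.1 (h4 h).2.2.2
    have hxx := hω.b_apply hZ x
    have hyy := hω.b_apply hZ y
    have hzz := hω.b_apply hZ z
    obtain ⟨g, hg, H⟩ := witt n hn ![x, Z x, y, Z y, z, Z z]
      (by intro i _; rw [q_e]; fin_cases i <;> simp [hq, hx, hy, hz])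
      (by
        intro i j hi hj
        wlog hij : i ≤ j generalizing i j
        · rw [b_comm, this j i hj hi (le_of_not_ge hij), b_comm]
        rw [b_e]
        fin_cases i <;> fin_cases j <;> simp at hi hj hij ⊢ <;>
          (try simp [b_self, hxx, hyy, hzz, hx, hy, hz, hbZ]) <;>
          first
            | exact (h2 (by omega)).1
            | exact (h2 (by omega)).2
            | exact h2' (by omega)
            | exact h4' (by omega)
            | exact h4'' (by omega)
            | exact (h4 (by omega)).1
            | exact (h4 (by omega)).2.1
            | exact (h4 (by omega)).2.2.1
            | exact (h4 (by omega)).2.2.2)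
    exact ⟨g, transvectionGroup_le hg, H⟩
  obtain ⟨g, hg, H⟩ := main (e 0) (e 0) (e 0) (q_e 0) (q_e 0) (q_e 0) 2 (by norm_num)
    (fun h => absurd h (by norm_num)) (fun h => absurd h (by norm_num))
  have hg0 : g (e 0) = e 0 := H 0 (by norm_num)
  have hg1 : g (Z (e 0)) = e 1 := H 1 (by norm_num)
  -- Pulling back the next basis vector gives a nonsingular vector orthogonal to the `Z`-stable
  -- plane already chosen. Its own plane with `Z y` is then orthogonal as well, by
  -- `IsOmega.b_apply_right`.
  obtain ⟨y, hy⟩ := g.surjective (e 2)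
  have hqy : q y = true := by rw [← O.map_q hg, hy, q_e]
  have hy1 : b (e 0) y = false := by rw [← O.map_b hg, hg0, hy, b_e]; rfl
  have hy2 : b (Z (e 0)) y = false := by rw [← O.map_b hg, hg1, hy, b_e]; rfl
  obtain ⟨h, hh, K⟩ := main (e 0) y (e 0) (q_e 0) hqy (q_e 0) 4 (by norm_num)
    (fun _ => ⟨hy1, hy2⟩) (fun h => absurd h (by norm_num))
  have hh0 : h (e 0) = e 0 := K 0 (by norm_num)
  have hh1 : h (Z (e 0)) = e 1 := K 1 (by norm_num)
  have hh2 : h y = e 2 := K 2 (by norm_num)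
  have hh3 : h (Z y) = e 3 := K 3 (by norm_num)
  obtain ⟨z, hz⟩ := h.surjective (e 4)
  have hqz : q z = true := by rw [← O.map_q hh, hz, q_e]
  have hz1 : b (e 0) z = false := by rw [← O.map_b hh, hh0, hz, b_e]; rfl
  have hz2 : b (Z (e 0)) z = false := by rw [← O.map_b hh, hh1, hz, b_e]; rfl
  have hz3 : b y z = false := by rw [← O.map_b hh, hh2, hz, b_e]; rfl
  have hz4 : b (Z y) z = false := by rw [← O.map_b hh, hh3, hz, b_e]; rfl
  obtain ⟨k, hk, L⟩ := main (e 0) y z (q_e 0) hqy hqz 6 le_rfl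
    (fun _ => ⟨hy1, hy2⟩) (fun _ => ⟨hz1, hz2, hz3, hz4⟩)
  have h0 : k (e 0) = e 0 := L 0 (by norm_num)
  have h1 : k (Z (e 0)) = e 1 := L 1 (by norm_num)
  have h2 : k y = e 2 := L 2 (by norm_num)
  have h3 : k (Z y) = e 3 := L 3 (by norm_num)
  have h4 : k z = e 4 := L 4 (by norm_num)
  have h5 : k (Z z) = e 5 := L 5 (by norm_num)
  refine ⟨k, hk, ?_, ?_, ?_⟩
  · rw [← h0, perm_inv_apply, h1]
  · rw [← h2, perm_inv_apply, h3]
  · rw [← h4, perm_inv_apply, h5]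

/-- The standard isometry of order three without nonzero fixed vectors. -/
def omegaFun (x : V) : V :=
  V.ofNat (((x.code >>> 1) &&& 21) ^^^ (((x.code &&& 21) ^^^ ((x.code >>> 1) &&& 21)) <<< 1))

/-- The standard isometry of order three without nonzero fixed vectors. -/
def omega : Equiv.Perm V where
  toFun := omegaFun
  invFun x := omegaFun (omegaFun x)
  left_inv := by
    have h : ∀ x, omegaFun (omegaFun (omegaFun x)) = x := by decide +kernel
    exact h
  right_inv := by
    have h : ∀ x, omegaFun (omegaFun (omegaFun x)) = x := by decide +kernel
    exact h

theorem omega_mem : omega ∈ O := by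
  have h1 : ∀ x y, omegaFun (x + y) = omegaFun x + omegaFun y := by decide +kernel
  have h2 : ∀ x, q (omegaFun x) = q x := by decide +kernel
  exact ⟨h1, h2⟩

theorem isOmega_omega : IsOmega omega := by
  have h : ∀ x, x + omegaFun x + omegaFun (omegaFun x) = 0 := by decide +kernel
  exact h

theorem omega_e : omega (e 0) = e 1 ∧ omega (e 2) = e 3 ∧ omega (e 4) = e 5 := by
  have h : omegaFun (e 0) = e 1 ∧ omegaFun (e 2) = e 3 ∧ omegaFun (e 4) = e 5 := by decide +kernel
  exact h

theorem IsOmega.conj {Z g : Equiv.Perm V} (hω : IsOmega Z) (hg : g ∈ O) :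
    IsOmega (g * Z * g⁻¹) := by
  intro x
  have h := congrArg g (hω (g⁻¹ x))
  rw [O.map_add hg, O.map_add hg, perm_apply_inv, O.map_zero hg] at h
  have h2 : (g * Z * g⁻¹) ((g * Z * g⁻¹) x) = g (Z (Z (g⁻¹ x))) := by
    simp only [Equiv.Perm.mul_apply, perm_inv_apply]
  rw [h2]; exact h

theorem IsOmega.ext {Z Z' : Equiv.Perm V} (hω : IsOmega Z) (hω' : IsOmega Z') (hZ : Z ∈ O)
    (hZ' : Z' ∈ O) (h0 : Z (e 0) = e 1) (h2 : Z (e 2) = e 3) (h4 : Z (e 4) = e 5)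
    (h0' : Z' (e 0) = e 1) (h2' : Z' (e 2) = e 3) (h4' : Z' (e 4) = e 5) : Z = Z' := by
  refine O.ext hZ hZ' fun i => ?_
  have h1 : ∀ {Y : Equiv.Perm V} (_ : IsOmega Y) {x y : V} (_ : Y x = y), Y y = x + y :=
    fun hY x y h => by rw [← h, hY.apply_apply]
  fin_cases i
  · exact h0.trans h0'.symm
  · exact (h1 hω h0).trans (h1 hω' h0').symm
  · exact h2.trans h2'.symm
  · exact (h1 hω h2).trans (h1 hω' h2').symm
  · exact h4.trans h4'.symm
  · exact (h1 hω h4).trans (h1 hω' h4').symm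

/-- All isometries with `1 + Z + Z² = 0` are conjugate. -/
theorem IsOmega.isConj_omega {Z : Equiv.Perm V} (hω : IsOmega Z) (hZ : Z ∈ O) :
    ∃ g ∈ O, g * Z * g⁻¹ = omega := by
  obtain ⟨g, hg, h0, h2, h4⟩ := hω.exists_frame hZ
  refine ⟨g, hg, ?_⟩
  exact (hω.conj hg).ext isOmega_omega (mul_mem (mul_mem hg hZ) (inv_mem hg)) omega_mem
    h0 h2 h4 omega_e.1 omega_e.2.1 omega_e.2.2

/-- The triples of vectors that can be the images of `e 0`, `e 2`, `e 4` under an isometry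
commuting with `omega`. -/
def omegaTriples : List (V × V × V) :=
  let l : List V := (List.finRange 64).filter fun x => q x
  l.flatMap fun x =>
    (l.filter fun y => !b x y && !b (omegaFun x) y).flatMap fun y =>
      (l.filter fun z => !b x z && !b (omegaFun x) z && !b y z && !b (omegaFun y) z).map fun z =>
        (x, y, z)

/-- With `omega` as scalar, `V` is a Hermitian space of dimension three over the field with four
elements, and the triples are its orthonormal bases: 36 · 6 · 3 = 648, the order of GU₃(2). -/
theorem length_omegaTriples : omegaTriples.length = 648 := by decide +kernel

theorem V.mem_finRange (x : V) : (show Fin 64 from x) ∈ List.finRange 64 := List.mem_finRange _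

theorem mem_omegaTriples {g : Equiv.Perm V} (hg : g ∈ O) (h : g * omega = omega * g) :
    (g (e 0), g (e 2), g (e 4)) ∈ omegaTriples := by
  have hc : ∀ x, omegaFun (g x) = g (omega x) := fun x => (Equiv.ext_iff.1 h x).symm
  have hl : ∀ x : V, q x = true → x ∈ (show List V from List.finRange 64).filter fun x => q x :=
    fun x hx => List.mem_filter.2 ⟨V.mem_finRange x, hx⟩
  refine List.mem_flatMap.2 ⟨g (e 0), hl _ ?_, List.mem_flatMap.2 ⟨g (e 2),
    List.mem_filter.2 ⟨hl _ ?_, ?_⟩, List.mem_map.2 ⟨g (e 4), List.mem_filter.2 ⟨hl _ ?_, ?_⟩, rfl⟩⟩⟩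
  · rw [O.map_q hg]; rfl
  · rw [O.map_q hg]; rfl
  · rw [hc, O.map_b hg, O.map_b hg, omega_e.1]; rfl
  · rw [O.map_q hg]; rfl
  · rw [hc, hc, O.map_b hg, O.map_b hg, O.map_b hg, O.map_b hg, omega_e.1, omega_e.2.1]; rfl

theorem eq_of_commute_omega {g h : Equiv.Perm V} (hg : g ∈ O) (hh : h ∈ O)
    (hgc : g * omega = omega * g) (hhc : h * omega = omega * h) (h0 : g (e 0) = h (e 0))
    (h2 : g (e 2) = h (e 2)) (h4 : g (e 4) = h (e 4)) : g = h := by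
  have key : ∀ x y, omega x = y → g x = h x → g y = h y := by
    rintro x _ rfl hx
    have h1 := Equiv.ext_iff.1 hgc x
    have h2 := Equiv.ext_iff.1 hhc x
    simp only [Equiv.Perm.mul_apply] at h1 h2
    rw [h1, h2, hx]
  refine O.ext hg hh fun i => ?_
  fin_cases i
  · exact h0
  · exact key _ _ omega_e.1 h0
  · exact h2
  · exact key _ _ omega_e.2.1 h2
  · exact h4
  · exact key _ _ omega_e.2.2 h4

/-! ### Uniqueness of the action of a group of order 648 -/

namespace M

/-- Automorphisms of `M` acting in the same way on `V`, with `1 + Z + Z² = 0`, are conjugate. -/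
theorem conj_of_bar_eq {f f' : MulAut M} (hω : IsOmega (bar f)) (h : bar f = bar f') :
    ∃ β : MulAut M, f' = β * f * β⁻¹ := by
  obtain ⟨u, hu⟩ := exists_conj_of_bar_eq_one (f := f⁻¹ * f')
    (by rw [map_mul, map_inv, h, inv_mul_cancel])
  have hO := bar_mem f
  -- Conjugating `f` by the inner automorphism of `m` multiplies it by the inner automorphism of
  -- `f⁻¹ m * m⁻¹`, whose vector is `(1 + Z⁻¹) m` with `Z = bar f`. For `m = Z² u` this equals `Z u
  -- + Z² u = u`, as required.
  refine ⟨MulAut.conj (lift (bar f (bar f u))), ?_⟩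
  have h1 : ∀ m : M, MulAut.conj m * f * (MulAut.conj m)⁻¹ = f * MulAut.conj (f⁻¹ m * m⁻¹) := by
    intro m
    rw [map_mul, map_inv, ← mul_assoc]
    congr 1
    ext1 y
    simp [MulAut.mul_apply, MulAut.conj_apply]
  rw [h1, ← inv_mul_eq_iff_eq_mul, hu, ← conj_lift_vec (_ * _), mul_vec, inv_vec, ← bar_apply,
    map_inv, lift_vec]
  have h2 : (bar f)⁻¹ (bar f (bar f u)) = bar f u := perm_inv_apply _ _
  rw [h2, hω.apply_apply, add_comm u, V.add_add_cancel]

/-- Both actions on `V` are conjugate to `omega`; lifting the conjugating isometries to `M` leaves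
only an inner discrepancy, which `conj_of_bar_eq` removes. -/
theorem exists_conj_of_isOmega {f f' : MulAut M} (hf : IsOmega (bar f)) (hf' : IsOmega (bar f')) :
    ∃ β : MulAut M, f' = β * f * β⁻¹ := by
  obtain ⟨g, hg, h⟩ := hf.isConj_omega (bar_mem f)
  obtain ⟨g', hg', h'⟩ := hf'.isConj_omega (bar_mem f')
  obtain ⟨γ, rfl⟩ := exists_bar_eq hg
  obtain ⟨γ', rfl⟩ := exists_bar_eq hg'
  have hc : bar (γ * f * γ⁻¹) = bar (γ' * f' * γ'⁻¹) := by
    simp only [map_mul, map_inv, h, h']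
  have ho : IsOmega (bar (γ * f * γ⁻¹)) := by
    simp only [map_mul, map_inv, h]; exact isOmega_omega
  obtain ⟨β, hβ⟩ := conj_of_bar_eq ho hc
  refine ⟨γ'⁻¹ * β * γ, ?_⟩
  have h3 : f' = γ'⁻¹ * (γ' * f' * γ'⁻¹) * γ' := by group
  rw [h3, hβ]
  group

/-- The centraliser of `f` acts on `V` by isometries commuting with `omega`, which are determined by
a triple in `omegaTriples`. Passing to `V` loses nothing: an inner automorphism that commutes with
`f` belongs to a fixed vector of `omega`, and that vector is zero. -/
theorem card_centralizer_le {f : MulAut M} (hf : bar f = omega) :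
    Nat.card (Subgroup.centralizer {f}) ≤ 648 := by
  have hc : ∀ g : Subgroup.centralizer {f}, bar g * omega = omega * bar g := by
    intro g
    have := Subgroup.mem_centralizer_singleton_iff.1 g.2
    rw [← hf, ← map_mul, ← map_mul, this]
  let F : Subgroup.centralizer {f} → {p : V × V × V // p ∈ omegaTriples.toFinset} :=
    fun g => ⟨(bar g (e 0), bar g (e 2), bar g (e 4)),
      List.mem_toFinset.2 (mem_omegaTriples (bar_mem _) (hc g))⟩
  have hF : Function.Injective F := by
    intro g h hgh
    have hp := congrArg Subtype.val hgh
    simp only [F, Prod.mk.injEq] at hp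
    have hb := eq_of_commute_omega (bar_mem _) (bar_mem _) (hc g) (hc h) hp.1 hp.2.1 hp.2.2
    obtain ⟨u, hu⟩ := exists_conj_of_bar_eq_one (f := (h : MulAut M)⁻¹ * g)
      (by rw [map_mul, map_inv, hb, inv_mul_cancel])
    have hcu : (h : MulAut M)⁻¹ * g ∈ Subgroup.centralizer {f} := mul_mem (inv_mem h.2) g.2
    rw [hu] at hcu
    have h1 := Subgroup.mem_centralizer_singleton_iff.1 hcu
    -- the inner automorphism commutes with `f`
    have h2 : f * MulAut.conj (lift u) * f⁻¹ = MulAut.conj (f (lift u)) := by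
      ext1 y
      simp [MulAut.mul_apply, MulAut.conj_apply]
    rw [← h1, mul_inv_cancel_right, ← conj_lift_vec (f (lift u)), ← bar_apply, hf, lift_vec] at h2
    have h3 : u = omega u := by
      have h4 : ∀ i, b (u + omega u) (e i) = false := by
        intro i
        have h5 := MulEquiv.congr_fun h2 (lift (e i))
        rw [MulAut.conj_apply, MulAut.conj_apply, conj_eq, conj_eq, mul_left_inj,
          sgn_injective.eq_iff, lift_vec, lift_vec, lift_vec] at h5
        rw [b_add_left, h5, Bool.xor_self]
      exact V.add_eq_zero.1 (b_nondegenerate h4)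
    have h6 : u = 0 := by
      have := isOmega_omega u
      rw [← h3, ← h3, V.add_self, zero_add] at this
      exact this
    have h7 : MulAut.conj (lift 0) = 1 := map_one MulAut.conj
    rw [h6, h7] at hu
    exact Subtype.ext (inv_mul_eq_one.1 hu).symm
  have h1 := Nat.card_le_card_of_injective F hF
  refine h1.trans ?_
  rw [Nat.card_eq_fintype_card, Fintype.card_coe]
  exact (List.toFinset_card_le _).trans length_omegaTriples.le

/-- The additive map underlying an isometry. -/
def O.toAddMonoidHom {g : Equiv.Perm V} (hg : g ∈ O) : V →+ V where
  toFun := g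
  map_zero' := O.map_zero hg
  map_add' := O.map_add hg

/-- In a faithful action of a Heisenberg group of order 27, the centre acts without nonzero fixed
vectors. -/
theorem isOmega_of_injective {G : Type*} [Group G] {x y z : G} (hx : x ^ 3 = 1) (hz : z ^ 3 = 1)
    (hz1 : z ≠ 1) (hxy : x * y = z * (y * x)) (hzx : z * x = x * z) (hzy : z * y = y * z)
    {ψ : G →* MulAut M} (hψ : Function.Injective ψ) : IsOmega (bar (ψ z)) := by
  have hm : ∀ {g h k l : G}, g * h = k * l → ∀ v, bar (ψ g) (bar (ψ h) v) = bar (ψ k) (bar (ψ l) v) := by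
    intro g h k l hg v
    have := congrArg (fun t => bar (ψ t) v) hg
    simp only [map_mul] at this
    exact this
  have h3 : ∀ {g : G}, g ^ 3 = 1 → ∀ v, bar (ψ g) (bar (ψ g) (bar (ψ g) v)) = v := by
    intro g hg v
    have := congrArg (fun t => bar (ψ t) v) hg
    simp only [pow_succ, pow_zero, one_mul, map_mul, map_one] at this
    exact this
  refine isOmega_of_heisenberg (O.toAddMonoidHom (bar_mem (ψ x))) (O.toAddMonoidHom (bar_mem (ψ y)))
    (O.toAddMonoidHom (bar_mem (ψ z))) (h3 hx) (h3 hz) (bar (ψ y)).injective ?_ (hm hzx) (hm hzy) ?_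
  · intro v
    have := hm hxy v
    rw [map_mul, map_mul] at this
    exact this
  -- If `z` acted trivially on `V`, it would act on `M` by an inner automorphism, whose square is
  -- trivial because squares in `M` are central. Faithfulness and `z ^ 3 = 1` then give `z = 1`.
  · by_contra! hall
    have hb : bar (ψ z) = 1 := Equiv.ext hall
    obtain ⟨u, hu⟩ := exists_conj_of_bar_eq_one hb
    have h2 : ψ (z ^ 2) = 1 := by
      rw [map_pow, hu, ← map_pow, pow_two, mul_self, ← conj_lift_vec]
      exact map_one MulAut.conj
    have h4 : z ^ 2 = 1 := hψ (h2.trans (map_one ψ).symm)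
    rw [pow_succ, h4, one_mul] at hz
    exact hz1 hz

/-- Centrality of `z` puts the image inside the centraliser, and the order 648 leaves no room for
more. -/
theorem range_eq_centralizer {G : Type*} [Group G] (hG : Nat.card G = 648) {z : G}
    (hz : z ∈ Subgroup.center G) {ψ : G →* MulAut M} (hψ : Function.Injective ψ) {f β : MulAut M}
    (hf : bar f = omega) (hβ : f = β * ψ z * β⁻¹) :
    ((MulAut.conj β).toMonoidHom.comp ψ).range = Subgroup.centralizer {f} := by
  refine Subgroup.eq_of_le_of_card_ge ?_ ?_
  · rintro _ ⟨g, rfl⟩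
    rw [Subgroup.mem_centralizer_singleton_iff, hβ]
    have h := congrArg ψ (Subgroup.mem_center_iff.1 hz g)
    rw [map_mul, map_mul] at h
    change β * ψ g * β⁻¹ * (β * ψ z * β⁻¹) = β * ψ z * β⁻¹ * (β * ψ g * β⁻¹)
    calc β * ψ g * β⁻¹ * (β * ψ z * β⁻¹) = β * (ψ g * ψ z) * β⁻¹ := by group
      _ = _ := by rw [h]; group
  · refine (card_centralizer_le hf).trans ?_
    have hinj : Function.Injective ((MulAut.conj β).toMonoidHom.comp ψ) :=
      (MulAut.conj β).injective.comp hψ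
    rw [← hG, Nat.card_congr (MonoidHom.ofInjective hinj).toEquiv]

/-- After conjugation both actions send `z` to the same automorphism over `omega`, so both identify
`G` with its centraliser. Composing one identification with the inverse of the other gives `α`. -/
theorem unique_action {G : Type*} [Group G] (hG : Nat.card G = 648) {x y z : G} (hx : x ^ 3 = 1)
    (hz : z ^ 3 = 1) (hz1 : z ≠ 1) (hxy : x * y = z * (y * x)) (hzc : z ∈ Subgroup.center G)
    {φ ψ : G →* MulAut M} (hφ : Function.Injective φ) (hψ : Function.Injective ψ) :
    ∃ (α : MulAut G) (β : MulAut M), ∀ g, ψ g = β * φ (α g) * β⁻¹ := by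
  have hzg := Subgroup.mem_center_iff.1 hzc
  obtain ⟨f, hf⟩ := exists_bar_eq omega_mem
  have hfo : IsOmega (bar f) := by rw [hf]; exact isOmega_omega
  obtain ⟨β, hβ⟩ := exists_conj_of_isOmega
    (isOmega_of_injective hx hz hz1 hxy (hzg x).symm (hzg y).symm hφ) hfo
  obtain ⟨γ, hγ⟩ := exists_conj_of_isOmega
    (isOmega_of_injective hx hz hz1 hxy (hzg x).symm (hzg y).symm hψ) hfo
  have hr := (range_eq_centralizer hG hzc hψ hf hγ).trans (range_eq_centralizer hG hzc hφ hf hβ).symm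
  have hinjφ : Function.Injective ((MulAut.conj β).toMonoidHom.comp φ) :=
    (MulAut.conj β).injective.comp hφ
  have hinjψ : Function.Injective ((MulAut.conj γ).toMonoidHom.comp ψ) :=
    (MulAut.conj γ).injective.comp hψ
  let α : G ≃* G := ((MonoidHom.ofInjective hinjψ).trans (MulEquiv.subgroupCongr hr)).trans
    (MonoidHom.ofInjective hinjφ).symm
  refine ⟨α, γ⁻¹ * β, fun g => ?_⟩
  have h : ((MulAut.conj β).toMonoidHom.comp φ) (α g) = ((MulAut.conj γ).toMonoidHom.comp ψ) g := by
    have := MonoidHom.apply_ofInjective_symm hinjφ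
      ((MulEquiv.subgroupCongr hr) (MonoidHom.ofInjective hinjψ g))
    exact this
  change β * φ (α g) * β⁻¹ = γ * ψ g * γ⁻¹ at h
  calc ψ g = γ⁻¹ * (γ * ψ g * γ⁻¹) * γ := by group
    _ = _ := by rw [← h]; group

end M

end DiracModel

open scoped commutatorElement

/-! ### Quaternion subgroups -/

namespace QuaternionGroup

variable {Γ : Type*} [Group Γ]

/-- The homomorphism from the quaternion group given by two elements satisfying its relations. -/
def liftTwo (x y : Γ) (hx : x ^ 4 = 1) (hy : y ^ 2 = x ^ 2) (hxy : y * x * y⁻¹ = x⁻¹) :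
    QuaternionGroup 2 →* Γ :=
  have hmod : ∀ {m n : ℕ}, m ≡ n [MOD 4] → x ^ m = x ^ n := fun h => pow_eq_pow_of_modEq h hx
  have h3 : x * y = y * x ^ 3 := by
    have h : x ^ 3 = x⁻¹ := eq_inv_of_mul_eq_one_left (by rw [← pow_succ, hx])
    have h' : y * x = x⁻¹ * y := by rw [← hxy, inv_mul_cancel_right]
    rw [h, eq_mul_inv_iff_mul_eq, mul_assoc, h', mul_inv_cancel_left]
  have hcomm : ∀ i : ℕ, x ^ i * y = y * x ^ (3 * i) := by
    intro i
    induction i with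
    | zero => simp
    | succ i ih => rw [pow_succ, mul_assoc, h3, ← mul_assoc, ih, mul_assoc, ← pow_add, mul_add_one]
  { toFun := fun g => match g with
      | a i => x ^ (ZMod.val i)
      | xa i => y * x ^ (ZMod.val i)
    map_one' := by
      change x ^ (ZMod.val (0 : ZMod (2 * 2))) = 1
      rw [ZMod.val_zero, pow_zero]
    map_mul' := by
      rintro (i | i) (j | j)
      · change x ^ (ZMod.val (i + j)) = x ^ (ZMod.val i) * x ^ (ZMod.val j)
        rw [← pow_add]
        exact hmod (by revert i j; decide)
      · change y * x ^ (ZMod.val (j - i)) = x ^ (ZMod.val i) * (y * x ^ (ZMod.val j))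
        rw [← mul_assoc, hcomm, mul_assoc, ← pow_add]
        congr 1
        exact hmod (by revert i j; decide)
      · change y * x ^ (ZMod.val (i + j)) = y * x ^ (ZMod.val i) * x ^ (ZMod.val j)
        rw [mul_assoc, ← pow_add]
        congr 1
        exact hmod (by revert i j; decide)
      · change x ^ (ZMod.val (((2 : ℕ) : ZMod (2 * 2)) + j - i)) =
          y * x ^ (ZMod.val i) * (y * x ^ (ZMod.val j))
        have h2 : y * y = x ^ 2 := by rw [← pow_two, hy]
        rw [mul_assoc y, ← mul_assoc (x ^ _), hcomm, mul_assoc, ← mul_assoc y, h2, ← pow_add,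
          ← pow_add]
        exact hmod (by revert i j; decide) }

theorem isQ8_closure {x y : Γ} (hx : x ^ 4 = 1) (hy : y ^ 2 = x ^ 2) (hxy : y * x * y⁻¹ = x⁻¹)
    (hne : x * y ≠ y * x) : IsQ8 (Subgroup.closure {x, y}) := by
  set f := liftTwo x y hx hy hxy with hf
  have fa : ∀ i, f (a i) = x ^ (ZMod.val i) := fun i => rfl
  have fxa : ∀ i, f (xa i) = y * x ^ (ZMod.val i) := fun i => rfl
  have hx2 : x ^ 2 ≠ 1 := by
    intro h
    have h1 : x⁻¹ = x := inv_eq_of_mul_eq_one_left (by rw [← pow_two, h])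
    rw [h1, mul_inv_eq_iff_eq_mul] at hxy
    exact hne hxy.symm
  have hinj : Function.Injective f := by
    rw [injective_iff_map_eq_one]
    rintro (i | i) hi
    · rw [fa] at hi
      have h2 : i = 0 := by
        -- A nonzero exponent modulo 4 is either 2 or odd; in the odd case squaring `x ^ i = 1`
        -- gives `x ^ 2 = 1`.
        have h4 : i = 0 ∨ (2 * ZMod.val i) % 4 = 2 ∨ ZMod.val i = 2 := by
          clear hi; revert i; decide
        rcases h4 with h | h | h
        · exact h
        · have h5 : x ^ (2 * ZMod.val i) = 1 := by rw [mul_comm, pow_mul, hi, one_pow]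
          rw [pow_eq_pow_of_modEq (n := 4) (show 2 * ZMod.val i ≡ 2 [MOD 4] from h) hx] at h5
          exact absurd h5 hx2
        · rw [h] at hi; exact absurd hi hx2
      rw [h2]; rfl
    · rw [fxa] at hi
      have h1 : y = (x ^ (ZMod.val i))⁻¹ := eq_inv_of_mul_eq_one_left hi
      refine absurd ?_ hne
      rw [h1]
      exact ((Commute.refl x).pow_right _).inv_right.eq
  have hr : f.range = Subgroup.closure {x, y} := by
    refine le_antisymm ?_ ?_
    · have hxm : x ∈ Subgroup.closure {x, y} := Subgroup.subset_closure (by simp)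
      have hym : y ∈ Subgroup.closure {x, y} := Subgroup.subset_closure (by simp)
      rintro _ ⟨i | i, rfl⟩
      · exact pow_mem hxm _
      · exact mul_mem hym (pow_mem hxm _)
    · rw [Subgroup.closure_le]
      rintro z (rfl | rfl)
      · exact ⟨a 1, (fa 1).trans (pow_one _)⟩
      · exact ⟨xa 0, (fxa 0).trans (by simp)⟩
  exact ⟨((MonoidHom.ofInjective hinj).trans (MulEquiv.subgroupCongr hr)).symm⟩

end QuaternionGroup

namespace DiracModel

theorem IsQ8.card {Γ : Type*} [Group Γ] {H : Subgroup Γ} (h : IsQ8 H) : Nat.card H = 8 := by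
  obtain ⟨f⟩ := h
  rw [Nat.card_congr f.toEquiv, Nat.card_eq_fintype_card, QuaternionGroup.card]

theorem IsQ8.map {Γ Γ' : Type*} [Group Γ] [Group Γ'] (θ : Γ ≃* Γ') {H : Subgroup Γ} (h : IsQ8 H) :
    IsQ8 (H.map θ.toMonoidHom) := by
  obtain ⟨f⟩ := h
  exact ⟨(θ.subgroupMap H).symm.trans f⟩

theorem map_injective {Γ Γ' : Type*} [Group Γ] [Group Γ'] (θ : Γ ≃* Γ') :
    Function.Injective (fun H : Subgroup Γ => H.map θ.toMonoidHom) :=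
  Subgroup.map_injective θ.injective

theorem map_symm_map {Γ Γ' : Type*} [Group Γ] [Group Γ'] (θ : Γ ≃* Γ') (H : Subgroup Γ) :
    (H.map θ.toMonoidHom).map θ.symm.toMonoidHom = H := by
  rw [Subgroup.map_map]
  convert Subgroup.map_id H
  ext x; simp

theorem map_map_symm {Γ Γ' : Type*} [Group Γ] [Group Γ'] (θ : Γ ≃* Γ') (H : Subgroup Γ') :
    (H.map θ.symm.toMonoidHom).map θ.toMonoidHom = H :=
  map_symm_map θ.symm H

theorem IsQ8Factorisation.map {Γ Γ' : Type*} [Group Γ] [Group Γ'] (θ : Γ ≃* Γ')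
    {F : Set (Subgroup Γ)} (h : IsQ8Factorisation F) :
    IsQ8Factorisation ((fun H => H.map θ.toMonoidHom) '' F) := by
  obtain ⟨h1, h2, h3, h4⟩ := h
  refine ⟨?_, ?_, ?_, ?_⟩
  · rw [Set.ncard_image_of_injective _ (map_injective θ), h1]
  · rintro _ ⟨H, hH, rfl⟩
    exact IsQ8.map θ (h2 H hH)
  · rintro _ ⟨H, hH, rfl⟩ _ ⟨K, hK, rfl⟩ hne _ ⟨x, hx, rfl⟩ _ ⟨y, hy, rfl⟩
    have := h3 H hH K hK (fun h => hne (by rw [h])) x hx y hy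
    rw [← map_mul, this, map_mul]
  · have h5 : sSup ((fun H : Subgroup Γ => H.map θ.toMonoidHom) '' F) =
        (sSup F).map θ.toMonoidHom := by
      rw [sSup_image, sSup_eq_iSup, Subgroup.map_iSup]
      simp only [Subgroup.map_iSup]
    rw [h5, h4]
    exact Subgroup.map_top_of_surjective _ θ.surjective

/-! ### Quaternion subgroups of `M` as preimages of anisotropic planes -/

namespace M

/-- The preimage in `M` of the subspace spanned by `u` and `v`. -/
def plane (u v : V) : Subgroup M where
  carrier := {x | x.vec = 0 ∨ x.vec = u ∨ x.vec = v ∨ x.vec = u + v}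
  one_mem' := Or.inl rfl
  mul_mem' := by
    intro x y hx hy
    simp only [Set.mem_ofPred_eq, mul_vec] at hx hy ⊢
    rcases hx with hx | hx | hx | hx <;> rcases hy with hy | hy | hy | hy <;> rw [hx, hy] <;>
      simp [add_comm, add_left_comm, V.add_self, V.add_add_cancel]
  inv_mem' := fun {x} hx => hx

theorem mem_plane {u v : V} {x : M} :
    x ∈ plane u v ↔ x.vec = 0 ∨ x.vec = u ∨ x.vec = v ∨ x.vec = u + v := Iff.rfl

theorem lift_mem_left (u v : V) : lift u ∈ plane u v := Or.inr (Or.inl rfl)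

theorem lift_mem_right (u v : V) : lift v ∈ plane u v := Or.inr (Or.inr (Or.inl rfl))

/-- The pairs of distinct nonzero vectors in a plane. -/
def SamePlane (u v u' v' : V) : Prop :=
  (u = u' ∨ u = v' ∨ u = u' + v') ∧ (v = u' ∨ v = v' ∨ v = u' + v') ∧ u ≠ v

instance (u v u' v' : V) : Decidable (SamePlane u v u' v') := by
  unfold SamePlane; infer_instance

theorem SamePlane.eq {u v u' v' : V} (h : SamePlane u v u' v') : plane u v = plane u' v' := by
  obtain ⟨h1, h2, h3⟩ := h
  ext x
  rw [mem_plane, mem_plane]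
  rcases h1 with rfl | rfl | rfl <;> rcases h2 with rfl | rfl | rfl <;>
    first
      | exact absurd rfl h3
      | (simp only [add_comm, V.add_add_cancel]
         try tauto)

/-- The vectors `u`, `v` span an anisotropic plane. -/
def Anisotropic (u v : V) : Prop := q u = true ∧ q v = true ∧ b u v = true

instance (u v : V) : Decidable (Anisotropic u v) := by
  unfold Anisotropic; infer_instance

theorem plane_eq_closure {u v : V} (hu : q u = true) :
    plane u v = Subgroup.closure {lift u, lift v} := by
  refine le_antisymm ?_ ?_
  · have hum : lift u ∈ Subgroup.closure {lift u, lift v} := Subgroup.subset_closure (by simp)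
    have hvm : lift v ∈ Subgroup.closure {lift u, lift v} := Subgroup.subset_closure (by simp)
    have hs : ∀ c, sgn c ∈ Subgroup.closure {lift u, lift v} := by
      intro c
      cases c
      · exact one_mem _
      · rw [← hu, ← lift_vec u, ← mul_self]; exact mul_mem hum hum
    intro x hx
    rcases hx with h | h | h | h
    · rw [vec_eq_zero_iff.1 h]; exact hs _
    · rw [eq_sgn_mul_of_vec_eq (y := lift u) h]; exact mul_mem (hs _) hum
    · rw [eq_sgn_mul_of_vec_eq (y := lift v) h]; exact mul_mem (hs _) hvm
    · rw [eq_sgn_mul_of_vec_eq (y := lift u * lift v) h]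
      exact mul_mem (hs _) (mul_mem hum hvm)
  · rw [Subgroup.closure_le]
    rintro x (rfl | rfl)
    · exact Or.inr (Or.inl rfl)
    · exact Or.inr (Or.inr (Or.inl rfl))

theorem Anisotropic.isQ8 {u v : V} (h : Anisotropic u v) : IsQ8 (plane u v) := by
  obtain ⟨hu, hv, huv⟩ := h
  rw [plane_eq_closure hu]
  have hu2 : lift u ^ 2 = sgn true := by rw [pow_two, mul_self, lift_vec, hu]
  have hv2 : lift v ^ 2 = sgn true := by rw [pow_two, mul_self, lift_vec, hv]
  refine QuaternionGroup.isQ8_closure ?_ (hv2.trans hu2.symm) ?_ ?_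
  · rw [show 4 = 2 * 2 from rfl, pow_mul, hu2, pow_two, sgn_mul_sgn]; rfl
  · rw [conj_eq, lift_vec, lift_vec, b_comm, huv]
    refine eq_inv_of_mul_eq_one_left ?_
    rw [mul_assoc, mul_self, lift_vec, hu, sgn_mul_sgn]; rfl
  · rw [Ne, commute_iff, lift_vec, lift_vec, huv]; decide

/-- Two standard generators of Q₈ have nontrivial squares and do not commute, so their vectors span
an anisotropic plane. Its preimage lies in `H` and also has order 8. -/
theorem exists_plane_of_isQ8 {H : Subgroup M} (hH : IsQ8 H) :
    ∃ u v, Anisotropic u v ∧ H = plane u v := by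
  obtain ⟨f⟩ := id hH
  set x := f.symm (QuaternionGroup.a 1) with hx
  set y := f.symm (QuaternionGroup.xa 0) with hy
  have hx2 : (x : M) * x ≠ 1 := by
    intro h
    have h1 : x * x = 1 := Subtype.ext h
    rw [hx, ← map_mul] at h1
    have h2 := f.symm.injective (h1.trans (map_one f.symm).symm)
    exact absurd h2 (by decide)
  have hy2 : (y : M) * y ≠ 1 := by
    intro h
    have h1 : y * y = 1 := Subtype.ext h
    rw [hy, ← map_mul] at h1
    have h2 := f.symm.injective (h1.trans (map_one f.symm).symm)
    exact absurd h2 (by decide)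
  have hxy : (x : M) * y ≠ y * x := by
    intro h
    have h1 : x * y = y * x := Subtype.ext h
    rw [hx, hy, ← map_mul, ← map_mul] at h1
    exact absurd (f.symm.injective h1) (by decide)
  have hqx : q (x : M).vec = true := by
    rw [mul_self] at hx2
    cases h : q (x : M).vec
    · rw [h] at hx2; exact absurd rfl hx2
    · rfl
  have hqy : q (y : M).vec = true := by
    rw [mul_self] at hy2
    cases h : q (y : M).vec
    · rw [h] at hy2; exact absurd rfl hy2
    · rfl
  have hb : b (x : M).vec (y : M).vec = true := by
    rw [Ne, commute_iff] at hxy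
    simpa using hxy
  have ha : Anisotropic (x : M).vec (y : M).vec := ⟨hqx, hqy, hb⟩
  refine ⟨_, _, ha, (Subgroup.eq_of_le_of_card_ge ?_ ?_).symm⟩
  · have hs : ∀ c, sgn c ∈ H := by
      intro c
      cases c
      · exact one_mem _
      · rw [← hqx, ← mul_self]; exact mul_mem x.2 x.2
    rw [plane_eq_closure hqx, Subgroup.closure_le]
    rintro z (rfl | rfl)
    · rw [eq_sgn_mul_of_vec_eq (x := lift (x : M).vec) (y := (x : M)) rfl]
      exact mul_mem (hs _) x.2
    · rw [eq_sgn_mul_of_vec_eq (x := lift (y : M).vec) (y := (y : M)) rfl]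
      exact mul_mem (hs _) y.2
  · rw [IsQ8.card hH, IsQ8.card ha.isQ8]

/-- The anisotropic pairs whose vectors are in increasing order. -/
def Canonical (u v : V) : Prop := Anisotropic u v ∧ u.code < v.code ∧ v.code < (u + v).code

instance (u v : V) : Decidable (Canonical u v) := by
  unfold Canonical; infer_instance

/-- The canonical anisotropic pairs. -/
def canonicalPairs : Finset (V × V) := Finset.univ.filter fun p => Canonical p.1 p.2

theorem card_canonicalPairs : canonicalPairs.card = 120 := by decide +kernel

/-- Sorting the three nonzero vectors of a plane by code selects one of its six ordered bases, so
canonical pairs correspond to anisotropic planes. -/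
theorem exists_canonical : ∀ u v, Anisotropic u v →
    (Canonical u v ∧ SamePlane u v u v) ∨ (Canonical v u ∧ SamePlane u v v u) ∨
    (Canonical u (u + v) ∧ SamePlane u v u (u + v)) ∨
    (Canonical (u + v) u ∧ SamePlane u v (u + v) u) ∨
    (Canonical v (u + v) ∧ SamePlane u v v (u + v)) ∨
    (Canonical (u + v) v ∧ SamePlane u v (u + v) v) := by
  decide +kernel

theorem setOf_isQ8_eq :
    {H : Subgroup M | IsQ8 H} = (fun p : V × V => plane p.1 p.2) '' canonicalPairs := by
  ext H
  simp only [Set.mem_ofPred_eq, Set.mem_image, canonicalPairs, Finset.coe_filter, Finset.mem_univ,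
    true_and, Prod.exists]
  constructor
  · intro hH
    obtain ⟨u, v, ha, rfl⟩ := exists_plane_of_isQ8 hH
    rcases exists_canonical u v ha with h | h | h | h | h | h <;>
      exact ⟨_, _, h.1, h.2.eq.symm⟩
  · rintro ⟨u, v, h, rfl⟩
    exact h.1.isQ8

set_option linter.constructorNameAsVariable false in
theorem plane_injOn : Set.InjOn (fun p : V × V => plane p.1 p.2) canonicalPairs := by
  rintro ⟨u, v⟩ h ⟨u', v'⟩ h' heq
  simp only [canonicalPairs, Finset.coe_filter, Finset.mem_univ, true_and, Set.mem_ofPred_eq] at h h'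
  obtain ⟨⟨_, _, hb⟩, h1, h2⟩ := h
  obtain ⟨⟨hq1, hq2, hb'⟩, h1', h2'⟩ := h'
  have heq' : plane u v = plane u' v' := heq
  have hu : u' = 0 ∨ u' = u ∨ u' = v ∨ u' = u + v :=
    mem_plane.1 (heq' ▸ lift_mem_left u' v')
  have hv : v' = 0 ∨ v' = u ∨ v' = v ∨ v' = u + v :=
    mem_plane.1 (heq' ▸ lift_mem_right u' v')
  have hc : ∀ {x y : V}, x = y → x.code = y.code := fun h => congrArg V.code h
  rcases hu with rfl | rfl | rfl | rfl
  · rw [q_zero] at hq1; exact absurd hq1 (by decide)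
  all_goals
    rcases hv with rfl | rfl | rfl | rfl
    · rw [q_zero] at hq2; exact absurd hq2 (by decide)
    all_goals
      first
        | rfl
        | (exfalso
           simp only [add_comm, add_left_comm, add_zero, V.add_self]
             at h1 h2 h1' h2'
           omega)

theorem ncard_isQ8 : {H : Subgroup M | IsQ8 H}.ncard = 120 := by
  rw [setOf_isQ8_eq, plane_injOn.ncard_image, Set.ncard_coe_finset,
    card_canonicalPairs]

theorem map_plane_le (f : MulAut M) (u v : V) :
    (plane u v).map f.toMonoidHom ≤ plane (bar f u) (bar f v) := by
  rintro _ ⟨x, hx, rfl⟩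
  have h : (f x).vec = bar f x.vec := (bar_apply f x).symm
  have h0 : bar f 0 = 0 := O.map_zero (bar_mem f)
  change (f x).vec = 0 ∨ (f x).vec = _ ∨ (f x).vec = _ ∨ (f x).vec = _
  rw [h, ← O.map_add (bar_mem f)]
  rcases hx with hx | hx | hx | hx <;> rw [hx]
  · exact Or.inl h0
  · exact Or.inr (Or.inl rfl)
  · exact Or.inr (Or.inr (Or.inl rfl))
  · exact Or.inr (Or.inr (Or.inr rfl))

theorem anisotropic_e : Anisotropic (e 0) (e 1) ∧ Anisotropic (e 2) (e 3) ∧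
    Anisotropic (e 4) (e 5) := by
  decide +kernel

theorem exists_map_eq_plane_e {H : Subgroup M} (hH : IsQ8 H) :
    ∃ f : MulAut M, H.map f.toMonoidHom = plane (e 0) (e 1) := by
  obtain ⟨u, v, ha, rfl⟩ := exists_plane_of_isQ8 hH
  -- Only the first two entries are constrained; the zeros are padding.
  obtain ⟨g, hg, h⟩ := witt 2 (by norm_num) ![u, v, 0, 0, 0, 0]
    (by
      intro i hi
      rw [q_e]
      fin_cases i <;> first | exact ha.1 | exact ha.2.1 | (exfalso; simp at hi))
    (by
      intro i j hi hj
      rw [b_e]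
      fin_cases i <;> fin_cases j <;>
        first
          | exact b_self _
          | exact ha.2.2
          | exact (b_comm _ _).trans ha.2.2
          | exact absurd hi (by decide)
          | exact absurd hj (by decide))
  obtain ⟨f, rfl⟩ := exists_bar_eq (transvectionGroup_le hg)
  have h0 : bar f u = e 0 := h 0 (by norm_num)
  have h1 : bar f v = e 1 := h 1 (by norm_num)
  refine ⟨f, Subgroup.eq_of_le_of_card_ge ?_ ?_⟩
  · rw [← h0, ← h1]; exact map_plane_le f u v
  · rw [IsQ8.card (IsQ8.map f hH), IsQ8.card anisotropic_e.1.isQ8]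

theorem exists_map_eq {H K : Subgroup M} (hH : IsQ8 H) (hK : IsQ8 K) :
    ∃ f : MulAut M, H.map f.toMonoidHom = K := by
  obtain ⟨f, hf⟩ := exists_map_eq_plane_e hH
  obtain ⟨g, hg⟩ := exists_map_eq_plane_e hK
  refine ⟨g⁻¹ * f, ?_⟩
  rw [← map_symm_map g K, hg, ← hf, Subgroup.map_map]
  rfl

/-! ### Factorisations of `M` into three commuting quaternion groups -/

/-- The standard factorisation of `M`. -/
def standardFactorisation : Set (Subgroup M) :=
  {plane (e 0) (e 1), plane (e 2) (e 3), plane (e 4) (e 5)}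

theorem plane_commute {u v u' v' : V} (h1 : b u u' = false) (h2 : b u v' = false)
    (h3 : b v u' = false) (h4 : b v v' = false) {x y : M} (hx : x ∈ plane u v)
    (hy : y ∈ plane u' v') : x * y = y * x := by
  rw [commute_iff]
  rcases hx with hx | hx | hx | hx <;> rcases hy with hy | hy | hy | hy <;> rw [hx, hy] <;>
    simp [b_zero_left, b_zero_right, b_add_left, b_add_right, h1, h2, h3, h4]

theorem plane_ne {u v u' v' : V} (h : Anisotropic u v) (h1 : b v u' = false) (h2 : b v v' = false) :
    plane u v ≠ plane u' v' := by
  intro heq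
  have hu : u = 0 ∨ u = u' ∨ u = v' ∨ u = u' + v' :=
    mem_plane.1 (heq ▸ lift_mem_left u v)
  have hb := h.2.2
  rw [b_comm] at hb
  rcases hu with hu | hu | hu | hu <;> rw [hu] at hb
  · rw [b_zero_right] at hb; exact absurd hb (by decide)
  · rw [h1] at hb; exact absurd hb (by decide)
  · rw [h2] at hb; exact absurd hb (by decide)
  · rw [b_add_right, h1, h2] at hb; exact absurd hb (by decide)

theorem isQ8Factorisation_standard : IsQ8Factorisation standardFactorisation := by
  obtain ⟨a1, a2, a3⟩ := anisotropic_e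
  have hb : ∀ i j : Fin 6, (i.1 ^^^ 1 == j.1) = false → b (e i) (e j) = false := fun i j h => by
    rw [b_e, h]
  have hne1 : plane (e 0) (e 1) ≠ plane (e 2) (e 3) := plane_ne a1 (hb _ _ rfl) (hb _ _ rfl)
  have hne2 : plane (e 0) (e 1) ≠ plane (e 4) (e 5) := plane_ne a1 (hb _ _ rfl) (hb _ _ rfl)
  have hne3 : plane (e 2) (e 3) ≠ plane (e 4) (e 5) := plane_ne a2 (hb _ _ rfl) (hb _ _ rfl)
  refine ⟨?_, ?_, ?_, ?_⟩
  · exact Set.ncard_eq_three.2 ⟨_, _, _, hne1, hne2, hne3, rfl⟩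
  · rintro H (rfl | rfl | rfl)
    · exact a1.isQ8
    · exact a2.isQ8
    · exact a3.isQ8
  · rintro H (rfl | rfl | rfl) K (rfl | rfl | rfl) hne x hx y hy
    all_goals
      first
        | exact absurd rfl hne
        | exact plane_commute (hb _ _ rfl) (hb _ _ rfl) (hb _ _ rfl) (hb _ _ rfl) hx hy
  · rw [eq_top_iff]
    have hle : ∀ H ∈ standardFactorisation, H ≤ sSup standardFactorisation := fun H hH => le_sSup hH
    have h1 := hle (plane (e 0) (e 1)) (Or.inl rfl)
    have h2 := hle (plane (e 2) (e 3)) (Or.inr (Or.inl rfl))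
    have h3 := hle (plane (e 4) (e 5)) (Or.inr (Or.inr rfl))
    have hs : ∀ c, sgn c ∈ sSup standardFactorisation := fun c => h1 (Or.inl rfl)
    have hl : ∀ x, lift x ∈ sSup standardFactorisation := by
      refine induction_basis (hs false) ?_ ?_
      · intro i
        fin_cases i
        · exact h1 (Or.inr (Or.inl rfl))
        · exact h1 (Or.inr (Or.inr (Or.inl rfl)))
        · exact h2 (Or.inr (Or.inl rfl))
        · exact h2 (Or.inr (Or.inr (Or.inl rfl)))
        · exact h3 (Or.inr (Or.inl rfl))
        · exact h3 (Or.inr (Or.inr (Or.inl rfl)))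
      · intro x y hx hy
        rw [eq_sgn_mul_of_vec_eq (x := lift (x + y)) (y := lift x * lift y) rfl]
        exact mul_mem (hs _) (mul_mem hx hy)
    intro x _
    rw [eq_sgn_mul_of_vec_eq (x := x) (y := lift x.vec) rfl]
    exact mul_mem (hs _) (hl _)

/-- The complement of the first plane is a sum of two anisotropic planes. A vector with nonzero
components in both is singular, so no further anisotropic plane exists there. -/
theorem samePlane_of_orthogonal : ∀ u, q u = true → b u (e 0) = false → b u (e 1) = false →
    ∀ v, q v = true → b u v = true → b v (e 0) = false → b v (e 1) = false →
    SamePlane u v (e 2) (e 3) ∨ SamePlane u v (e 4) (e 5) := by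
  decide +kernel

theorem eq_standardFactorisation {F : Set (Subgroup M)} (hF : IsQ8Factorisation F)
    (h : plane (e 0) (e 1) ∈ F) : F = standardFactorisation := by
  refine Set.eq_of_subset_of_ncard_le ?_ ?_ (Set.toFinite _)
  · intro K hK
    by_cases hKH : K = plane (e 0) (e 1)
    · exact Or.inl hKH
    · right
      obtain ⟨u, v, ha, rfl⟩ := exists_plane_of_isQ8 (hF.2.1 K hK)
      have hc : ∀ x y, lift x ∈ plane u v → lift y ∈ plane (e 0) (e 1) → b x y = false := by
        intro x y hx hy
        exact commute_iff.1 (hF.2.2.1 _ hK _ h hKH _ hx _ hy)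
      have hu : lift u ∈ plane u v := Or.inr (Or.inl rfl)
      have hv : lift v ∈ plane u v := Or.inr (Or.inr (Or.inl rfl))
      have h0 : lift (e 0) ∈ plane (e 0) (e 1) := Or.inr (Or.inl rfl)
      have h1 : lift (e 1) ∈ plane (e 0) (e 1) := Or.inr (Or.inr (Or.inl rfl))
      rcases samePlane_of_orthogonal u ha.1 (hc _ _ hu h0) (hc _ _ hu h1) v ha.2.1 ha.2.2
        (hc _ _ hv h0) (hc _ _ hv h1) with h | h
      · exact Or.inl h.eq
      · exact Or.inr h.eq
  · rw [hF.1, isQ8Factorisation_standard.1]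

theorem image_image_symm (f : MulAut M) (F : Set (Subgroup M)) :
    (fun H => H.map f⁻¹.toMonoidHom) '' ((fun H => H.map f.toMonoidHom) '' F) = F := by
  rw [Set.image_image]
  have h : (fun H : Subgroup M => (H.map f.toMonoidHom).map f⁻¹.toMonoidHom) = id :=
    funext fun H => map_symm_map f H
  rw [h, Set.image_id]

theorem exists_image_eq {F F' : Set (Subgroup M)} (hF : IsQ8Factorisation F)
    (hF' : IsQ8Factorisation F') : ∃ f : MulAut M, (fun H => H.map f.toMonoidHom) '' F = F' := by
  have key : ∀ {F : Set (Subgroup M)}, IsQ8Factorisation F →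
      ∃ f : MulAut M, (fun H => H.map f.toMonoidHom) '' F = standardFactorisation := by
    intro F hF
    obtain ⟨H, hH⟩ := Set.nonempty_of_ncard_ne_zero (by rw [hF.1]; norm_num : F.ncard ≠ 0)
    obtain ⟨f, hf⟩ := exists_map_eq_plane_e (hF.2.1 H hH)
    exact ⟨f, eq_standardFactorisation (IsQ8Factorisation.map f hF) ⟨H, hH, hf⟩⟩
  obtain ⟨f, hf⟩ := key hF
  obtain ⟨g, hg⟩ := key hF'
  refine ⟨g⁻¹ * f, ?_⟩
  rw [← image_image_symm g F', hg, ← hf, Set.image_image]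
  congr 1
  ext1 H
  rw [Subgroup.map_map]; rfl

/-- Count pairs of a factorisation and a member of it. Every Q₈ occurs in exactly one pair: by
transitivity it may be moved to the first standard plane, where the factorisation is forced. Hence
three times the number of factorisations is 120. -/
theorem ncard_isQ8Factorisation : {F : Set (Subgroup M) | IsQ8Factorisation F}.ncard = 40 := by
  let S := {F : Set (Subgroup M) // IsQ8Factorisation F}
  have hfin : Finite (Subgroup M) := inferInstance
  have : Fintype S := Fintype.ofFinite _
  have hQ : Nat.card {H : Subgroup M // IsQ8 H} = 120 := by
    rw [← ncard_isQ8, ← Nat.card_coe_set_eq]; rfl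
  let φ : (Σ F : S, F.1) → {H : Subgroup M // IsQ8 H} := fun p => ⟨p.2.1, p.1.2.2.1 _ p.2.2⟩
  have huniq : ∀ {F F' : Set (Subgroup M)} {H}, IsQ8Factorisation F → IsQ8Factorisation F' →
      H ∈ F → H ∈ F' → F = F' := by
    intro F F' H hF hF' hH hH'
    obtain ⟨f, hf⟩ := exists_map_eq_plane_e (hF.2.1 H hH)
    rw [← image_image_symm f F, ← image_image_symm f F',
      eq_standardFactorisation (IsQ8Factorisation.map f hF) ⟨H, hH, hf⟩,
      eq_standardFactorisation (IsQ8Factorisation.map f hF') ⟨H, hH', hf⟩]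
  have hbij : Function.Bijective φ := by
    constructor
    · rintro ⟨⟨F, hF⟩, ⟨H, hH⟩⟩ ⟨⟨F', hF'⟩, ⟨H', hH'⟩⟩ h
      obtain rfl : H = H' := congrArg Subtype.val h
      obtain rfl := huniq hF hF' hH hH'
      rfl
    · rintro ⟨H, hH⟩
      obtain ⟨f, hf⟩ := exists_map_eq anisotropic_e.1.isQ8 hH
      exact ⟨⟨⟨_, IsQ8Factorisation.map f isQ8Factorisation_standard⟩, ⟨H, ⟨_, Or.inl rfl, hf⟩⟩⟩, rfl⟩
  have hcard := Nat.card_eq_of_bijective φ hbij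
  rw [hQ, Nat.card_sigma] at hcard
  have h3 : ∀ F : S, Nat.card F.1 = 3 := fun F => by rw [Nat.card_coe_set_eq, F.2.1]
  simp only [h3, Finset.sum_const, Finset.card_univ, smul_eq_mul] at hcard
  rw [← Nat.card_coe_set_eq]
  change Nat.card S = 40
  rw [Nat.card_eq_fintype_card]
  omega

/-! ### `M` is extraspecial -/

theorem card_center : Nat.card (Subgroup.center M) = 2 := by
  have h : Function.Bijective
      (fun c : Bool => (⟨sgn c, mem_center_iff.2 rfl⟩ : Subgroup.center M)) := by
    constructor
    · intro c d h
      exact sgn_injective (congrArg Subtype.val h)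
    · rintro ⟨x, hx⟩
      exact ⟨x.sign, Subtype.ext (vec_eq_zero_iff.1 (mem_center_iff.1 hx)).symm⟩
  rw [← Nat.card_eq_of_bijective _ h, Nat.card_eq_fintype_card, Fintype.card_bool]

theorem isExtraspecial : IsExtraspecial 2 M := by
  refine ⟨IsPGroup.of_card (n := 7) card, card_center, le_antisymm ?_ ?_, ?_⟩
  · rw [commutator_def, Subgroup.commutator_le]
    intro x _ y _
    rw [mem_center_iff, commutatorElement_def]
    simp only [mul_vec, inv_vec]
    simp [add_comm, V.add_self, V.add_add_cancel]
  · intro x hx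
    rw [vec_eq_zero_iff.1 (mem_center_iff.1 hx)]
    cases x.sign
    · exact one_mem _
    · have h : sgn true = ⁅lift (e 0), lift (e 1)⁆ := by
        rw [commutatorElement_def, conj_eq, mul_inv_cancel_right, lift_vec, lift_vec,
          anisotropic_e.1.2.2]
      rw [h]
      exact Subgroup.commutator_mem_commutator (Subgroup.mem_top _) (Subgroup.mem_top _)
  · intro x
    rw [mem_center_iff, pow_two, mul_vec, V.add_self]

end M

/-! ### The Weyl group of type `E₆` -/

/-- The images of the simple roots in the root lattice modulo two, identified with `V`. -/
def simpleRoot (i : Fin 6) : V := V.ofNat (![1, 4, 2, 25, 32, 16] i)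

/-- The dual basis of the simple roots with respect to `b`. -/
def dualRoot (i : Fin 6) : V := V.ofNat (![6, 8, 1, 4, 16, 36] i)

/-- Pairing with `dualRoot j` recovers the `j`-th coordinate modulo two, so the simple roots are a
basis of `V` and `reduce` has kernel twice the lattice. -/
theorem b_dualRoot : ∀ i j, b (simpleRoot i) (dualRoot j) = (i == j) := by decide +kernel

/-- Reduction modulo two of the root lattice. -/
def reduce : (Fin 6 → ℤ) →ₗ[ℤ] V := Fintype.linearCombination ℤ simpleRoot

theorem reduce_single (i : Fin 6) : reduce (Pi.single i 1) = simpleRoot i := by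
  rw [reduce, Fintype.linearCombination_apply_single, one_smul]

/-- The functional on `V` represented by a vector. -/
def functional (c : V) : V →+ ZMod 2 where
  toFun x := if b x c then 1 else 0
  map_zero' := by simp [b_zero_left]
  map_add' x y := by
    rw [b_add_left]
    cases b x c <;> cases b y c <;> decide

theorem functional_reduce (y : Fin 6 → ℤ) (j : Fin 6) :
    functional (dualRoot j) (reduce y) = (y j : ZMod 2) := by
  rw [reduce, Fintype.linearCombination_apply, map_sum, Finset.sum_eq_single j]
  · have h : functional (dualRoot j) (simpleRoot j) = 1 := by
      change (if b (simpleRoot j) (dualRoot j) then (1 : ZMod 2) else 0) = 1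
      rw [b_dualRoot]; simp
    rw [map_zsmul, h, zsmul_one]
  · intro i _ hij
    have h : functional (dualRoot j) (simpleRoot i) = 0 := by
      change (if b (simpleRoot i) (dualRoot j) then (1 : ZMod 2) else 0) = 0
      rw [b_dualRoot]; simp [hij]
    rw [map_zsmul, h, smul_zero]
  · simp

theorem two_dvd_of_reduce_eq_zero {y : Fin 6 → ℤ} (h : reduce y = 0) (j : Fin 6) : 2 ∣ y j := by
  have h1 := functional_reduce y j
  rw [h, map_zero] at h1
  exact (ZMod.intCast_zmod_eq_zero_iff_dvd _ 2).1 h1.symm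

theorem reduce_surjective : Function.Surjective reduce := by
  have he : ∀ i, ∃ y, reduce y = e i := by
    have h : ∀ i, ∃ s : Finset (Fin 6), ∑ j ∈ s, simpleRoot j = e i := by decide +kernel
    intro i
    obtain ⟨s, hs⟩ := h i
    refine ⟨∑ j ∈ s, Pi.single j 1, ?_⟩
    rw [map_sum, ← hs]
    exact Finset.sum_congr rfl fun j _ => reduce_single j
  refine induction_basis ⟨0, map_zero _⟩ he ?_
  rintro x y ⟨u, rfl⟩ ⟨v, rfl⟩
  exact ⟨u + v, map_add _ _ _⟩

/-- The matrix of a simple reflection. -/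
def reflMat (i : Fin 6) : Matrix (Fin 6) (Fin 6) ℤ :=
  1 - Matrix.vecMulVec (Pi.single i 1) (CartanMatrix.E₆ i)

theorem reflMat_mul_self : ∀ i, reflMat i * reflMat i = 1 := by decide +kernel

/-- By the matrix determinant lemma the determinant is one minus the diagonal Cartan entry 2. -/
theorem det_reflMat (i : Fin 6) : (reflMat i).det = -1 := by
  have h : CartanMatrix.E₆ i ⬝ᵥ Pi.single i 1 = 2 := by
    rw [dotProduct_single_one]; revert i; decide
  rw [reflMat, sub_eq_add_neg, ← Matrix.neg_vecMulVec, Matrix.vecMulVec_eq Unit,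
    Matrix.det_one_add_replicateCol_mul_replicateRow, dotProduct_neg, h]
  norm_num

theorem reflMat_transpose_mul :
    ∀ i, (reflMat i)ᵀ * CartanMatrix.E₆ * reflMat i = CartanMatrix.E₆ := by
  decide +kernel

theorem reduce_reflMat_single : ∀ i j, reduce (reflMat i *ᵥ Pi.single j 1) =
    transvect (simpleRoot i) (simpleRoot j) := by
  have h : ∀ i j, ∑ k, (reflMat i *ᵥ Pi.single j 1) k • simpleRoot k =
    transvect (simpleRoot i) (simpleRoot j) := by decide +kernel
  intro i j
  rw [← h, reduce, Fintype.linearCombination_apply]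

/-- The simple reflections. -/
def simpleRefl (i : Fin 6) : (Matrix (Fin 6) (Fin 6) ℤ)ˣ :=
  ⟨reflMat i, reflMat i, reflMat_mul_self i, reflMat_mul_self i⟩

theorem weylE6_eq : weylE6 = Subgroup.closure (Set.range simpleRefl) := by
  unfold weylE6 QuatDirac.matrixGroup
  congr 1
  ext u
  constructor
  · rintro ⟨i, hi⟩
    exact ⟨i, Units.ext hi.symm⟩
  · rintro ⟨i, rfl⟩
    exact ⟨i, rfl⟩

theorem simpleRefl_mem (i : Fin 6) : simpleRefl i ∈ weylE6 := by
  rw [weylE6_eq]; exact Subgroup.subset_closure ⟨i, rfl⟩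

theorem simpleRoot_q : ∀ i, q (simpleRoot i) = true := by decide +kernel

theorem reduce_simpleRefl (i : Fin 6) (x : Fin 6 → ℤ) :
    reduce ((simpleRefl i : Matrix (Fin 6) (Fin 6) ℤ) *ᵥ x) =
      transvection (simpleRoot i) (reduce x) := by
  let τ : V →+ V := ⟨⟨transvect (simpleRoot i), O.map_zero (transvection_mem (simpleRoot_q i))⟩,
    transvect_add _⟩
  have h : reduce ∘ₗ (reflMat i).mulVecLin = τ.toIntLinearMap ∘ₗ reduce := by
    refine LinearMap.pi_ext' fun j => LinearMap.ext_ring ?_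
    change reduce (reflMat i *ᵥ Pi.single j 1) = transvect _ (reduce (Pi.single j 1))
    rw [reduce_reflMat_single, reduce_single]
  exact LinearMap.congr_fun h x

theorem exists_perm {g : (Matrix (Fin 6) (Fin 6) ℤ)ˣ} (hg : g ∈ weylE6) :
    ∃ p ∈ O, ∀ x, reduce ((g : Matrix (Fin 6) (Fin 6) ℤ) *ᵥ x) = p (reduce x) := by
  rw [weylE6_eq] at hg
  induction hg using Subgroup.closure_induction with
  | mem g hg =>
    obtain ⟨i, rfl⟩ := hg
    exact ⟨_, transvection_mem (simpleRoot_q i), reduce_simpleRefl i⟩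
  | one => exact ⟨1, one_mem _, fun x => by rw [Units.val_one, Matrix.one_mulVec]; rfl⟩
  | mul g h _ _ ihg ihh =>
    obtain ⟨p, hp, hp'⟩ := ihg
    obtain ⟨r, hr, hr'⟩ := ihh
    refine ⟨p * r, mul_mem hp hr, fun x => ?_⟩
    rw [Units.val_mul, ← Matrix.mulVec_mulVec, hp', hr']; rfl
  | inv g _ ih =>
    obtain ⟨p, hp, hp'⟩ := ih
    refine ⟨p⁻¹, inv_mem hp, fun x => ?_⟩
    refine p.injective ?_
    rw [perm_apply_inv, ← hp', Matrix.mulVec_mulVec, Units.mul_inv, Matrix.one_mulVec]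

/-- The action of the Weyl group on the root lattice modulo two. -/
noncomputable def weylPerm (g : weylE6) : Equiv.Perm V := (exists_perm g.2).choose

theorem weylPerm_mem (g : weylE6) : weylPerm g ∈ O := (exists_perm g.2).choose_spec.1

theorem weylPerm_reduce (g : weylE6) (x : Fin 6 → ℤ) :
    weylPerm g (reduce x) = reduce (((g : (Matrix (Fin 6) (Fin 6) ℤ)ˣ) : Matrix (Fin 6) (Fin 6) ℤ) *ᵥ x) :=
  ((exists_perm g.2).choose_spec.2 x).symm

theorem weylPerm_eq {g : weylE6} {p : Equiv.Perm V}
    (h : ∀ x, reduce (((g : (Matrix (Fin 6) (Fin 6) ℤ)ˣ) : Matrix (Fin 6) (Fin 6) ℤ) *ᵥ x) = p (reduce x)) :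
    weylPerm g = p := by
  ext y
  obtain ⟨x, rfl⟩ := reduce_surjective y
  rw [weylPerm_reduce, h]

/-- The action of the Weyl group on the root lattice modulo two. -/
noncomputable def weylHom : weylE6 →* Equiv.Perm V where
  toFun := weylPerm
  map_one' := weylPerm_eq fun x => by
    rw [OneMemClass.coe_one, Units.val_one, Matrix.one_mulVec]; rfl
  map_mul' g h := weylPerm_eq fun x => by
    rw [Subgroup.coe_mul, Units.val_mul, ← Matrix.mulVec_mulVec, ← weylPerm_reduce, ← weylPerm_reduce]
    rfl

theorem weylHom_simpleRefl (i : Fin 6) :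
    weylHom ⟨simpleRefl i, simpleRefl_mem i⟩ = transvection (simpleRoot i) :=
  weylPerm_eq (reduce_simpleRefl i)

/-! #### Faithfulness -/

theorem transpose_mul_cartan {g : (Matrix (Fin 6) (Fin 6) ℤ)ˣ} (hg : g ∈ weylE6) :
    (g : Matrix (Fin 6) (Fin 6) ℤ)ᵀ * CartanMatrix.E₆ * g = CartanMatrix.E₆ := by
  rw [weylE6_eq] at hg
  induction hg using Subgroup.closure_induction with
  | mem g hg =>
    obtain ⟨i, rfl⟩ := hg
    exact reflMat_transpose_mul i
  | one => simp
  | mul g h _ _ ihg ihh =>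
    rw [Units.val_mul, Matrix.transpose_mul]
    calc _ = (h : Matrix (Fin 6) (Fin 6) ℤ)ᵀ *
          ((g : Matrix (Fin 6) (Fin 6) ℤ)ᵀ * CartanMatrix.E₆ * g) * h := by
            simp only [Matrix.mul_assoc]
      _ = _ := by rw [ihg, ihh]
  | inv g _ ih =>
    have h1 : ((g : Matrix (Fin 6) (Fin 6) ℤ) * (g⁻¹ : (Matrix (Fin 6) (Fin 6) ℤ)ˣ)) = 1 := g.mul_inv
    have h2 : ((g⁻¹ : (Matrix (Fin 6) (Fin 6) ℤ)ˣ) : Matrix (Fin 6) (Fin 6) ℤ)ᵀ *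
        (g : Matrix (Fin 6) (Fin 6) ℤ)ᵀ = 1 := by
      rw [← Matrix.transpose_mul, h1, Matrix.transpose_one]
    conv_lhs => rw [← ih]
    calc _ = (((g⁻¹ : (Matrix (Fin 6) (Fin 6) ℤ)ˣ) : Matrix (Fin 6) (Fin 6) ℤ)ᵀ *
        (g : Matrix (Fin 6) (Fin 6) ℤ)ᵀ) * CartanMatrix.E₆ *
        ((g : Matrix (Fin 6) (Fin 6) ℤ) * (g⁻¹ : (Matrix (Fin 6) (Fin 6) ℤ)ˣ)) := by
          simp only [Matrix.mul_assoc]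
      _ = _ := by rw [h1, h2, Matrix.one_mul, Matrix.mul_one]

/-- The quadratic form of the root lattice. -/
def norm (y : Fin 6 → ℤ) : ℤ :=
  2 * (y 0 ^ 2 + y 1 ^ 2 + y 2 ^ 2 + y 3 ^ 2 + y 4 ^ 2 + y 5 ^ 2 - y 0 * y 2 - y 1 * y 3 - y 2 * y 3
    - y 3 * y 4 - y 4 * y 5)

theorem norm_eq (y : Fin 6 → ℤ) : y ⬝ᵥ (CartanMatrix.E₆ *ᵥ y) = norm y := by
  simp [norm, dotProduct, Matrix.mulVec, Fin.sum_univ_succ, CartanMatrix.E₆]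
  ring

theorem norm_mulVec {g : (Matrix (Fin 6) (Fin 6) ℤ)ˣ} (hg : g ∈ weylE6) (y : Fin 6 → ℤ) :
    norm ((g : Matrix (Fin 6) (Fin 6) ℤ) *ᵥ y) = norm y := by
  rw [← norm_eq, ← norm_eq, Matrix.mulVec_mulVec, ← Matrix.vecMul_transpose,
    ← Matrix.dotProduct_mulVec, Matrix.mulVec_mulVec, ← Matrix.mul_assoc, transpose_mul_cartan hg]

/-- Completing squares along the branches of the Dynkin diagram exhibits positive definiteness. -/
theorem six_mul_norm (y : Fin 6 → ℤ) : 6 * norm y = 3 * (2 * y 0 - y 2) ^ 2 +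
    (3 * y 2 - 2 * y 3) ^ 2 + 3 * (2 * y 1 - y 3) ^ 2 + 3 * (2 * y 5 - y 4) ^ 2 +
    (3 * y 4 - 2 * y 3) ^ 2 + y 3 ^ 2 := by
  unfold norm; ring

theorem norm_nonneg (y : Fin 6 → ℤ) : 0 ≤ norm y := by
  have h := six_mul_norm y
  have : 0 ≤ 3 * (2 * y 0 - y 2) ^ 2 +
    (3 * y 2 - 2 * y 3) ^ 2 + 3 * (2 * y 1 - y 3) ^ 2 + 3 * (2 * y 5 - y 4) ^ 2 +
    (3 * y 4 - 2 * y 3) ^ 2 + y 3 ^ 2 := by positivity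
  omega

theorem eq_zero_of_norm_eq_zero {y : Fin 6 → ℤ} (hy : norm y = 0) : y = 0 := by
  have h := six_mul_norm y
  rw [hy] at h
  have p1 := sq_nonneg (2 * y 0 - y 2)
  have p2 := sq_nonneg (3 * y 2 - 2 * y 3)
  have p3 := sq_nonneg (2 * y 1 - y 3)
  have p4 := sq_nonneg (2 * y 5 - y 4)
  have p5 := sq_nonneg (3 * y 4 - 2 * y 3)
  have p6 := sq_nonneg (y 3)
  have q1 : 2 * y 0 - y 2 = 0 := pow_eq_zero_iff (two_ne_zero) |>.1 (by linarith)
  have q2 : 3 * y 2 - 2 * y 3 = 0 := pow_eq_zero_iff (two_ne_zero) |>.1 (by linarith)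
  have q3 : 2 * y 1 - y 3 = 0 := pow_eq_zero_iff (two_ne_zero) |>.1 (by linarith)
  have q4 : 2 * y 5 - y 4 = 0 := pow_eq_zero_iff (two_ne_zero) |>.1 (by linarith)
  have q5 : 3 * y 4 - 2 * y 3 = 0 := pow_eq_zero_iff (two_ne_zero) |>.1 (by linarith)
  have q6 : y 3 = 0 := pow_eq_zero_iff (two_ne_zero) |>.1 (by linarith)
  ext i
  fin_cases i <;> simp <;> omega

/-- The parallelogram law for `y` and `y + α`, whose sum is `α + 2y` and whose difference is the
root `α` of norm 2. -/
theorem norm_single_add (y : Fin 6 → ℤ) (j : Fin 6) :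
    norm (Pi.single j 1 + (2 : ℤ) • y) = 2 * (norm y + norm (y + Pi.single j 1)) - 2 := by
  fin_cases j <;> simp [norm] <;> ring

theorem norm_single (j : Fin 6) : norm (Pi.single j 1) = 2 := by
  fin_cases j <;> simp [norm]

/-- An isometry of the root lattice that is trivial modulo two is diagonal. -/
theorem mulVec_single_eq {g : weylE6} (hg : weylHom g = 1) (j : Fin 6) :
    ∃ s : ℤ, (s = 1 ∨ s = -1) ∧
      ((g : (Matrix (Fin 6) (Fin 6) ℤ)ˣ) : Matrix (Fin 6) (Fin 6) ℤ) *ᵥ Pi.single j 1 =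
        s • Pi.single j 1 := by
  have h1 : reduce (((g : (Matrix (Fin 6) (Fin 6) ℤ)ˣ) : Matrix (Fin 6) (Fin 6) ℤ) *ᵥ
      Pi.single j 1 - Pi.single j 1) = 0 := by
    rw [map_sub, ← weylPerm_reduce]
    have h : weylPerm g = 1 := hg
    rw [h, Equiv.Perm.one_apply, sub_self]
  choose y hy using two_dvd_of_reduce_eq_zero h1
  have h2 : ((g : (Matrix (Fin 6) (Fin 6) ℤ)ˣ) : Matrix (Fin 6) (Fin 6) ℤ) *ᵥ Pi.single j 1 =
      Pi.single j 1 + (2 : ℤ) • y := by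
    ext i
    have := hy i
    simp only [Pi.sub_apply] at this
    simp only [Pi.add_apply, Pi.smul_apply, smul_eq_mul]
    omega
  have h3 := norm_mulVec g.2 (Pi.single j 1)
  rw [h2, norm_single_add, norm_single] at h3
  have hev : ∀ z, 2 ∣ norm z := fun z => Dvd.intro _ rfl
  have h4 := norm_nonneg y
  have h5 := norm_nonneg (y + Pi.single j 1)
  have h6 := hev y
  -- The two norms are nonnegative with sum 2, and norms are even, so one vanishes: `y` is either
  -- zero or minus the root.
  have h7 : norm y = 0 ∨ norm (y + Pi.single j 1) = 0 := by omega
  rcases h7 with h | h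
  · refine ⟨1, Or.inl rfl, ?_⟩
    rw [h2, eq_zero_of_norm_eq_zero h, smul_zero, add_zero, one_smul]
  · refine ⟨-1, Or.inr rfl, ?_⟩
    have := eq_neg_of_add_eq_zero_left (eq_zero_of_norm_eq_zero h)
    rw [h2, this]
    module

/-- A vector whose class modulo three is fixed by the Weyl group. -/
def fixedVector : Fin 6 → ZMod 3 := ![1, 0, 2, 0, 1, 2]

/-- `fixedVector` spans the kernel of the Cartan matrix modulo 3, whose determinant is 3, so every
simple reflection fixes it. It is not equal to its negative and so excludes -1 from the Weyl group.
-/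
theorem map_mulVec_fixedVector {g : (Matrix (Fin 6) (Fin 6) ℤ)ˣ} (hg : g ∈ weylE6) :
    (Int.castRingHom (ZMod 3)).mapMatrix (g : Matrix (Fin 6) (Fin 6) ℤ) *ᵥ fixedVector =
      fixedVector := by
  rw [weylE6_eq] at hg
  induction hg using Subgroup.closure_induction with
  | mem g hg =>
    obtain ⟨i, rfl⟩ := hg
    have h : ∀ i, (reflMat i).map (fun n : ℤ => (n : ZMod 3)) *ᵥ fixedVector = fixedVector := by
      decide +kernel
    exact h i
  | one => rw [Units.val_one, map_one, Matrix.one_mulVec]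
  | mul g h _ _ ihg ihh => rw [Units.val_mul, map_mul, ← Matrix.mulVec_mulVec, ihh, ihg]
  | inv g _ ih =>
    conv_lhs => rw [← ih]
    rw [Matrix.mulVec_mulVec, ← map_mul, Units.inv_mul, map_one, Matrix.one_mulVec]

/-- An element trivial modulo two changes each simple root by a sign. Preserving the Cartan matrix
makes the signs equal along the connected Dynkin diagram, so the element is 1 or -1, and -1 is
impossible by `fixedVector`. -/
theorem weylHom_injective : Function.Injective weylHom := by
  rw [injective_iff_map_eq_one]
  intro g hg
  choose s hs hgs using mulVec_single_eq hg
  set m := ((g : (Matrix (Fin 6) (Fin 6) ℤ)ˣ) : Matrix (Fin 6) (Fin 6) ℤ) with hm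
  have hcol : m = Matrix.diagonal s := by
    ext i j
    have h1 := congrFun (hgs j) i
    rw [Matrix.mulVec_single_one] at h1
    rw [Matrix.diagonal_apply]
    change m i j = s j * (Pi.single j 1 : Fin 6 → ℤ) i at h1
    rw [h1, Pi.single_apply]
    split_ifs with h
    · rw [h, mul_one]
    · rw [mul_zero]
  have hA := transpose_mul_cartan g.2
  rw [← hm, hcol, Matrix.diagonal_transpose] at hA
  have hent : ∀ i j, s i * CartanMatrix.E₆ i j * s j = CartanMatrix.E₆ i j := by
    intro i j
    have := congrFun (congrFun hA i) j
    rwa [Matrix.mul_diagonal, Matrix.diagonal_mul] at this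
  have hadj : ∀ i j, CartanMatrix.E₆ i j = -1 → s i = s j := by
    intro i j hij
    have := hent i j
    rw [hij] at this
    rcases hs i with h | h <;> rcases hs j with h' | h' <;> rw [h, h'] at this ⊢ <;>
      exact absurd this (by norm_num)
  have h02 := hadj 0 2 rfl
  have h23 := hadj 2 3 rfl
  have h13 := hadj 1 3 rfl
  have h34 := hadj 3 4 rfl
  have h45 := hadj 4 5 rfl
  have hall : ∀ i, s i = s 3 := by
    intro i
    fin_cases i
    · exact h02.trans h23
    · exact h13
    · exact h23
    · rfl
    · exact h34.symm
    · exact (h34.trans h45).symm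
  have hone : s 3 = 1 := by
    rcases hs 3 with h | h
    · exact h
    · exfalso
      have hf := map_mulVec_fixedVector g.2
      have h2 : m = -1 := by
        rw [hcol, ← Matrix.diagonal_one, Matrix.diagonal_neg]
        congr 1
        ext i
        rw [hall i, h]
      rw [← hm, h2, map_neg, map_one, Matrix.neg_mulVec, Matrix.one_mulVec] at hf
      exact absurd hf (by decide)
  refine Subtype.ext (Units.ext ?_)
  rw [← hm, hcol]
  change _ = (1 : Matrix (Fin 6) (Fin 6) ℤ)
  rw [← Matrix.diagonal_one]
  congr 1
  ext i
  rw [hall i, hone]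

/-! #### The image -/

/-- The nonsingular vectors, ordered such that each one arises from an earlier one by a simple
reflection. -/
def rootList (k : Fin 36) : V :=
  V.ofNat (![1, 4, 2, 25, 32, 16, 3, 29, 27, 57, 48, 26, 31, 61, 59, 41, 30, 58, 63, 45, 43, 62, 42,
    38, 47, 39, 46, 54, 37, 55, 22, 53, 23, 21, 12, 8] k)

theorem rootList_spec : ∀ k, (∃ i, rootList k = simpleRoot i) ∨
    ∃ j, j < k ∧ ∃ i, rootList k = transvect (simpleRoot i) (rootList j) := by
  decide +kernel

theorem exists_rootList : ∀ u, q u = true → ∃ k, rootList k = u := by decide +kernel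

theorem exists_weyl_rootList (k : Fin 36) :
    ∃ g : weylE6, weylHom g = transvection (rootList k) ∧
      ((g : (Matrix (Fin 6) (Fin 6) ℤ)ˣ) : Matrix (Fin 6) (Fin 6) ℤ).det = -1 := by
  induction k using WellFoundedLT.induction with
  | _ k ih =>
    rcases rootList_spec k with ⟨i, hi⟩ | ⟨j, hjk, i, hi⟩
    · exact ⟨⟨simpleRefl i, simpleRefl_mem i⟩, by rw [weylHom_simpleRefl, hi], det_reflMat i⟩
    · obtain ⟨g, hg, hd⟩ := ih j hjk
      -- Conjugating by a simple reflection moves the vector of the transvection and leaves the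
      -- determinant unchanged.
      refine ⟨⟨simpleRefl i, simpleRefl_mem i⟩ * g * ⟨simpleRefl i, simpleRefl_mem i⟩⁻¹, ?_, ?_⟩
      · rw [map_mul, map_mul, map_inv, hg, weylHom_simpleRefl,
          conj_transvection (transvection_mem (simpleRoot_q i)), hi]
        rfl
      · change (reflMat i * ((g : (Matrix (Fin 6) (Fin 6) ℤ)ˣ) : Matrix (Fin 6) (Fin 6) ℤ) *
          reflMat i).det = -1
        rw [Matrix.det_mul, Matrix.det_mul, det_reflMat, hd]
        norm_num

theorem exists_weyl_transvection {u : V} (hu : q u = true) :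
    ∃ g : weylE6, weylHom g = transvection u ∧
      ((g : (Matrix (Fin 6) (Fin 6) ℤ)ˣ) : Matrix (Fin 6) (Fin 6) ℤ).det = -1 := by
  obtain ⟨k, rfl⟩ := exists_rootList u hu
  exact exists_weyl_rootList k

theorem range_weylHom : weylHom.range = O := by
  refine le_antisymm ?_ ?_
  · rintro _ ⟨g, rfl⟩
    exact weylPerm_mem g
  · rw [← transvectionGroup_eq, transvectionGroup, Subgroup.closure_le]
    rintro _ ⟨u, hu, rfl⟩
    obtain ⟨g, hg, _⟩ := exists_weyl_transvection hu
    exact ⟨g, hg⟩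

/-- The outer automorphism group of `M` is the Weyl group of type `E₆`. -/
noncomputable def outerEquiv : QuatDirac.Outer M ≃* weylE6 :=
  (QuotientGroup.quotientMulEquivOfEq M.ker_bar.symm).trans
    ((QuotientGroup.quotientKerEquivRange M.bar).trans
      ((MulEquiv.subgroupCongr (M.range_bar.trans range_weylHom.symm)).trans
        (MonoidHom.ofInjective weylHom_injective).symm))

/-- The product of transvections in the images of the rotations. -/
theorem mem_rotations_iff {g : (Matrix (Fin 6) (Fin 6) ℤ)ˣ} :
    g ∈ weylE6Rotations ↔ g ∈ weylE6 ∧ (g : Matrix (Fin 6) (Fin 6) ℤ).det = 1 := by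
  unfold weylE6Rotations
  rw [Subgroup.mem_inf, MonoidHom.mem_ker, Units.ext_iff, Matrix.GeneralLinearGroup.val_det_apply,
    Units.val_one]

/-- The action of the rotation subgroup on the root lattice modulo two. -/
noncomputable def rotationHom : weylE6Rotations →* Equiv.Perm V :=
  weylHom.comp (Subgroup.inclusion inf_le_left)

theorem rotationHom_injective : Function.Injective rotationHom :=
  weylHom_injective.comp (Subgroup.inclusion_injective _)

/-- The Siegel transformation `x ↦ x + b(x,u) v + b(x,v) u`. -/
def siegel (u v x : V) : V := x + ((if b x u then v else 0) + (if b x v then u else 0))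

/-- The number of factors is even, which is what makes every Siegel transformation come from
determinant one. -/
theorem transvect_four {u v w : V} (hwu : b w u = false) (hwv : b w v = false)
    (huv : b u v = false) (x : V) :
    transvect w (transvect (w + u) (transvect (w + v) (transvect (w + u + v) x))) =
      siegel u v x := by
  have hvu : b v u = false := by rw [b_comm, huv]
  have huw : b u w = false := by rw [b_comm, hwu]
  have hvw : b v w = false := by rw [b_comm, hwv]
  simp only [transvect, siegel]
  cases h1 : b x w <;> cases h2 : b x u <;> cases h3 : b x v <;>
    simp [h1, h2, h3, b_add_left, b_add_right, b_self, hwu, hwv, huv, hvu, huw, hvw, add_comm,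
      add_left_comm, V.add_add_cancel]

theorem exists_nonsingular : ∀ u v, q u = false → q v = false → b u v = false →
    ∃ w, q w = true ∧ b w u = false ∧ b w v = false := by
  decide +kernel

/-- Siegel transformations come from rotations. -/
theorem exists_rotation_siegel {u v : V} (hu : q u = false) (hv : q v = false)
    (huv : b u v = false) : ∃ g, ∀ x, rotationHom g x = siegel u v x := by
  obtain ⟨w, hw, hwu, hwv⟩ := exists_nonsingular u v hu hv huv
  obtain ⟨g1, h1, d1⟩ := exists_weyl_transvection hw
  obtain ⟨g2, h2, d2⟩ := exists_weyl_transvection (u := w + u) (by rw [q_add, hw, hu, hwu]; rfl)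
  obtain ⟨g3, h3, d3⟩ := exists_weyl_transvection (u := w + v) (by rw [q_add, hw, hv, hwv]; rfl)
  obtain ⟨g4, h4, d4⟩ := exists_weyl_transvection (u := w + u + v)
    (by rw [q_add, q_add, b_add_left, hw, hu, hv, hwu, hwv, huv]; rfl)
  refine ⟨⟨(g1 * g2 * g3 * g4 : weylE6), mem_rotations_iff.2 ⟨(g1 * g2 * g3 * g4).2, ?_⟩⟩, ?_⟩
  · simp only [Subgroup.coe_mul, Units.val_mul, Matrix.det_mul, d1, d2, d3, d4]
    norm_num
  · intro x
    rw [← transvect_four hwu hwv huv]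
    change weylHom (g1 * g2 * g3 * g4) x = _
    rw [map_mul, map_mul, map_mul, h1, h2, h3, h4]
    rfl

/-- A group of permutations containing the products of the first simple reflection with all others
contains the image of the rotation subgroup. -/
theorem range_rotationHom_le {H : Subgroup (Equiv.Perm V)}
    (h : ∀ i, transvection (simpleRoot i) * transvection (simpleRoot 0) ∈ H) :
    rotationHom.range ≤ H := by
  -- The claim is kept in a form that survives one more simple reflection: elements of determinant 1
  -- map into `H`, and those of determinant -1 do so after multiplication by the first simple
  -- reflection.
  have key : ∀ g : (Matrix (Fin 6) (Fin 6) ℤ)ˣ, ∀ hg : g ∈ Subgroup.closure (Set.range simpleRefl),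
      ((g : Matrix (Fin 6) (Fin 6) ℤ).det = 1 ∧ weylHom ⟨g, weylE6_eq ▸ hg⟩ ∈ H) ∨
      ((g : Matrix (Fin 6) (Fin 6) ℤ).det = -1 ∧
        weylHom ⟨g, weylE6_eq ▸ hg⟩ * transvection (simpleRoot 0) ∈ H) := by
    intro g hg
    have hstep : ∀ (x y : (Matrix (Fin 6) (Fin 6) ℤ)ˣ) (hx : x ∈ weylE6) (i : Fin 6)
        (hy : y ∈ weylE6) (_ : y = x * simpleRefl i),
        (((x : Matrix (Fin 6) (Fin 6) ℤ).det = 1 ∧ weylHom ⟨x, hx⟩ ∈ H) ∨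
        ((x : Matrix (Fin 6) (Fin 6) ℤ).det = -1 ∧
          weylHom ⟨x, hx⟩ * transvection (simpleRoot 0) ∈ H)) →
        (((y : Matrix (Fin 6) (Fin 6) ℤ).det = 1 ∧ weylHom ⟨y, hy⟩ ∈ H) ∨
        ((y : Matrix (Fin 6) (Fin 6) ℤ).det = -1 ∧
          weylHom ⟨y, hy⟩ * transvection (simpleRoot 0) ∈ H)) := by
      rintro x y hx i hy rfl hor
      have hm : weylHom ⟨x * simpleRefl i, hy⟩ = weylHom ⟨x, hx⟩ * transvection (simpleRoot i) := by
        rw [← weylHom_simpleRefl, ← map_mul]; rfl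
      have hd : ((x * simpleRefl i : (Matrix (Fin 6) (Fin 6) ℤ)ˣ) : Matrix (Fin 6) (Fin 6) ℤ).det =
          -(x : Matrix (Fin 6) (Fin 6) ℤ).det := by
        rw [Units.val_mul, Matrix.det_mul]
        change _ * (reflMat i).det = _
        rw [det_reflMat]; ring
      rw [hm, hd]
      rcases hor with ⟨h1, h2⟩ | ⟨h1, h2⟩
      · right
        refine ⟨by rw [h1], ?_⟩
        rw [mul_assoc]
        exact mul_mem h2 (h i)
      · left
        refine ⟨by rw [h1]; norm_num, ?_⟩
        have h3 : transvection (simpleRoot 0) * transvection (simpleRoot i) ∈ H := by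
          have := inv_mem (h i)
          rwa [mul_inv_rev, transvection_inv, transvection_inv] at this
        have h4 := mul_mem h2 h3
        rwa [mul_assoc, ← mul_assoc (transvection (simpleRoot 0)), transvection_mul_self,
          one_mul] at h4
    induction hg using Subgroup.closure_induction_right with
    | one =>
      left
      refine ⟨by simp, ?_⟩
      have : weylHom ⟨1, one_mem _⟩ = 1 := map_one weylHom
      rw [this]; exact one_mem _
    | mul_right x hx y hy ih =>
      obtain ⟨i, rfl⟩ := hy
      exact hstep x _ (weylE6_eq ▸ hx) i _ rfl ih
    | mul_inv_cancel x hx y hy ih =>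
      obtain ⟨i, rfl⟩ := hy
      exact hstep x _ (weylE6_eq ▸ hx) i _ rfl ih
  rintro _ ⟨⟨g, hg⟩, rfl⟩
  obtain ⟨hg1, hg2⟩ := mem_rotations_iff.1 hg
  rcases key g (weylE6_eq ▸ hg1) with h1 | h1
  · exact h1.2
  · rw [hg2] at h1; exact absurd h1.1 (by norm_num)

/-! ### Integral quaternion matrices -/

/-- The real quaternion with the coordinates of a integral quaternion. -/
noncomputable def quatCast (x : ℍ[ℤ]) : ℍ[ℝ] := ⟨x.re, x.imI, x.imJ, x.imK⟩

theorem re_quatCast (x : ℍ[ℤ]) : (quatCast x).re = x.re := rfl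
theorem imI_quatCast (x : ℍ[ℤ]) : (quatCast x).imI = x.imI := rfl
theorem imJ_quatCast (x : ℍ[ℤ]) : (quatCast x).imJ = x.imJ := rfl
theorem imK_quatCast (x : ℍ[ℤ]) : (quatCast x).imK = x.imK := rfl

/-- The inclusion of the integral quaternions into the real quaternions. -/
noncomputable def quatMap : ℍ[ℤ] →+* ℍ[ℝ] where
  toFun := quatCast
  map_one' := by ext <;> simp [re_quatCast, imI_quatCast, imJ_quatCast, imK_quatCast]
  map_zero' := by ext <;> simp [re_quatCast, imI_quatCast, imJ_quatCast, imK_quatCast]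
  map_add' x y := by ext <;> simp [re_quatCast, imI_quatCast, imJ_quatCast, imK_quatCast]
  map_mul' x y := by ext <;> simp [re_quatCast, imI_quatCast, imJ_quatCast, imK_quatCast]

theorem quatMap_star (x : ℍ[ℤ]) : quatMap (star x) = star (quatMap x) := by
  change (⟨_, _, _, _⟩ : ℍ[ℝ]) = star ⟨_, _, _, _⟩
  ext <;> simp

instance : DecidableEq ℍ[ℤ] := fun x y =>
  decidable_of_iff (x.re = y.re ∧ x.imI = y.imI ∧ x.imJ = y.imJ ∧ x.imK = y.imK)
    QuaternionAlgebra.ext_iff.symm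

/-- Integral quaternion matrices. -/
abbrev IntMat : Type := Matrix (Fin 4) (Fin 4) ℍ[ℤ]

/-- The inclusion of the integral into the real quaternion matrices. -/
noncomputable def matMap : IntMat →+* Matrix (Fin 4) (Fin 4) ℍ[ℝ] := quatMap.mapMatrix

theorem matMap_apply (A : IntMat) (i j : Fin 4) : matMap A i j = quatMap (A i j) := rfl

/-- The inclusion of the integral into the real quaternion matrices, on units. -/
noncomputable def unitMap : IntMatˣ →* QuatDirac.GL4H := Units.map (matMap : IntMat →* _)

/-- The quaternion unit `i`. -/
def ri : ℍ[ℤ] := ⟨0, 1, 0, 0⟩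
/-- The quaternion unit `j`. -/
def rj : ℍ[ℤ] := ⟨0, 0, 1, 0⟩
/-- The quaternion unit `k`. -/
def rk : ℍ[ℤ] := ⟨0, 0, 0, 1⟩

theorem quatMap_ri : quatMap ri = QuatDirac.qi := by
  change (⟨_, _, _, _⟩ : ℍ[ℝ]) = ⟨_, _, _, _⟩
  simp [ri]
theorem quatMap_rj : quatMap rj = QuatDirac.qj := by
  change (⟨_, _, _, _⟩ : ℍ[ℝ]) = ⟨_, _, _, _⟩
  simp [rj]
theorem quatMap_rk : quatMap rk = QuatDirac.qk := by
  change (⟨_, _, _, _⟩ : ℍ[ℝ]) = ⟨_, _, _, _⟩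
  simp [rk]

/-! ### The extraspecial group as a matrix group -/

section pairs

variable {R : Type*} [Ring R]

/-- The sign `±1`. -/
def signOf (R : Type*) [Ring R] (c : Bool) : R := if c then -1 else 1

theorem signOf_mul (c d : Bool) : signOf R c * signOf R d = signOf R (c ^^ d) := by
  cases c <;> cases d <;> simp [signOf]

theorem signOf_comm (c : Bool) (x : R) : x * signOf R c = signOf R c * x := by
  cases c <;> simp [signOf]

/-- The monomials in a pair of elements. -/
def pairMon (α β : R) (x y : Bool) : R := (if x then α else 1) * (if y then β else 1)

theorem pairMon_mul {α β : R} (hα : α * α = -1) (hβ : β * β = -1) (hβα : β * α = -(α * β))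
    (x y x' y' : Bool) : pairMon α β x y * pairMon α β x' y' =
      signOf R ((x && x') ^^ (y && y') ^^ (y && x')) * pairMon α β (x ^^ x') (y ^^ y') := by
  have h1 : ∀ z, α * (α * z) = -z := fun z => by rw [← mul_assoc, hα, neg_one_mul]
  have h3 : ∀ z, β * (α * z) = -(α * (β * z)) := fun z => by
    rw [← mul_assoc, hβα, neg_mul, mul_assoc]
  cases x <;> cases y <;> cases x' <;> cases y' <;>
    simp [pairMon, signOf, mul_assoc, hα, hβ, hβα, h1, h3]

theorem pairMon_comm {α β γ δ : R} (h1 : Commute α γ) (h2 : Commute α δ) (h3 : Commute β γ)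
    (h4 : Commute β δ) (x y x' y' : Bool) :
    Commute (pairMon α β x y) (pairMon γ δ x' y') := by
  unfold pairMon
  refine Commute.mul_left ?_ ?_ <;> refine Commute.mul_right ?_ ?_ <;> split_ifs <;>
    first | assumption | exact Commute.one_left _ | exact Commute.one_right _

theorem sign_mul_triple {s t A B C A' B' C' A'' B'' C'' : R} {u v w : Bool}
    (ht : ∀ z, z * t = t * z) (h1 : Commute A' B) (h2 : Commute A' C) (h3 : Commute B' C)
    (e1 : A * A' = signOf R u * A'') (e2 : B * B' = signOf R v * B'')
    (e3 : C * C' = signOf R w * C'') :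
    s * (A * B * C) * (t * (A' * B' * C')) =
      s * t * signOf R (u ^^ v ^^ w) * (A'' * B'' * C'') := by
  calc s * (A * B * C) * (t * (A' * B' * C')) = s * ((A * B * C) * t) * (A' * B' * C') := by
        simp only [mul_assoc]
    _ = s * t * (A * B * C * (A' * B' * C')) := by rw [ht]; simp only [mul_assoc]
    _ = s * t * ((A * A') * (B * B') * (C * C')) := by
        congr 1
        calc A * B * C * (A' * B' * C') = A * B * (C * A') * B' * C' := by simp only [mul_assoc]
          _ = A * (B * A') * (C * B') * C' := by rw [← h2.eq]; simp only [mul_assoc]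
          _ = _ := by rw [← h1.eq, ← h3.eq]; simp only [mul_assoc]
    _ = _ := by
        rw [e1, e2, e3, ← signOf_mul, ← signOf_mul]
        simp only [mul_assoc]
        congr 3
        rw [← mul_assoc A'', signOf_comm, mul_assoc, ← mul_assoc B'', signOf_comm, mul_assoc,
          ← mul_assoc A'', signOf_comm, mul_assoc]

end pairs

/-- The digits of the code of a vector. -/
def V.bit (x : V) (i : ℕ) : Bool := x.code.testBit i

theorem V.bit_zero (i : ℕ) : (0 : V).bit i = false := Nat.zero_testBit i

theorem V.bit_add (x y : V) (i : ℕ) : (x + y).bit i = (x.bit i ^^ y.bit i) :=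
  Nat.testBit_xor _ _ _

/-- `twist` adds each digit in an even position to the next digit, so the cocycle splits into three
blocks. Each block is the sign exponent in `pairMon_mul`, which is why `intRep` is multiplicative.
-/
theorem cocycle_eq : ∀ x y : V, cocycle x y =
    (((x.bit 0 && y.bit 0) ^^ (x.bit 1 && y.bit 1) ^^ (x.bit 1 && y.bit 0)) ^^
    ((x.bit 2 && y.bit 2) ^^ (x.bit 3 && y.bit 3) ^^ (x.bit 3 && y.bit 2)) ^^
    ((x.bit 4 && y.bit 4) ^^ (x.bit 5 && y.bit 5) ^^ (x.bit 5 && y.bit 4))) := by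
  decide +kernel

/-- The Dirac matrices. -/
def gen : Fin 6 → IntMat :=
  ![!![ri, 0, 0, 0; 0, ri, 0, 0; 0, 0, ri, 0; 0, 0, 0, ri],
    !![rj, 0, 0, 0; 0, rj, 0, 0; 0, 0, rj, 0; 0, 0, 0, rj],
    !![0, 0, 1, 0; 0, 0, 0, -1; -1, 0, 0, 0; 0, 1, 0, 0],
    !![0, 0, 0, 1; 0, 0, 1, 0; 0, -1, 0, 0; -1, 0, 0, 0],
    !![0, 0, -1, 0; 0, 0, 0, -1; 1, 0, 0, 0; 0, 1, 0, 0],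
    !![0, 0, 0, 1; 0, 0, -1, 0; 0, 1, 0, 0; -1, 0, 0, 0]]

theorem gen_mul_self : ∀ i, gen i * gen i = -1 := by decide +kernel

theorem gen_mul_gen : ∀ i j, i < j →
    gen j * gen i = if i.1 ^^^ 1 = j.1 then -(gen i * gen j) else gen i * gen j := by
  decide +kernel

/-- The matrix representing an element of `M`. -/
def intRepFun (x : M) : IntMat :=
  signOf IntMat x.sign * (pairMon (gen 0) (gen 1) (x.vec.bit 0) (x.vec.bit 1) *
    pairMon (gen 2) (gen 3) (x.vec.bit 2) (x.vec.bit 3) *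
    pairMon (gen 4) (gen 5) (x.vec.bit 4) (x.vec.bit 5))

theorem intRepFun_mul (x y : M) : intRepFun (x * y) = intRepFun x * intRepFun y := by
  have hc : ∀ i j : Fin 6, i < j → i.1 ^^^ 1 ≠ j.1 → Commute (gen i) (gen j) := by
    intro i j hij h
    have := gen_mul_gen i j hij
    rw [if_neg h] at this
    exact this.symm
  have ha : ∀ i j : Fin 6, i < j → i.1 ^^^ 1 = j.1 → gen j * gen i = -(gen i * gen j) := by
    intro i j hij h
    rw [gen_mul_gen i j hij, if_pos h]
  have c1 := pairMon_comm (hc 0 2 (by decide) (by decide)) (hc 0 3 (by decide) (by decide))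
    (hc 1 2 (by decide) (by decide)) (hc 1 3 (by decide) (by decide))
    (y.vec.bit 0) (y.vec.bit 1) (x.vec.bit 2) (x.vec.bit 3)
  have c2 := pairMon_comm (hc 0 4 (by decide) (by decide)) (hc 0 5 (by decide) (by decide))
    (hc 1 4 (by decide) (by decide)) (hc 1 5 (by decide) (by decide))
    (y.vec.bit 0) (y.vec.bit 1) (x.vec.bit 4) (x.vec.bit 5)
  have c3 := pairMon_comm (hc 2 4 (by decide) (by decide)) (hc 2 5 (by decide) (by decide))
    (hc 3 4 (by decide) (by decide)) (hc 3 5 (by decide) (by decide))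
    (y.vec.bit 2) (y.vec.bit 3) (x.vec.bit 4) (x.vec.bit 5)
  have p1 := pairMon_mul (gen_mul_self 0) (gen_mul_self 1) (ha 0 1 (by decide) (by decide))
    (x.vec.bit 0) (x.vec.bit 1) (y.vec.bit 0) (y.vec.bit 1)
  have p2 := pairMon_mul (gen_mul_self 2) (gen_mul_self 3) (ha 2 3 (by decide) (by decide))
    (x.vec.bit 2) (x.vec.bit 3) (y.vec.bit 2) (y.vec.bit 3)
  have p3 := pairMon_mul (gen_mul_self 4) (gen_mul_self 5) (ha 4 5 (by decide) (by decide))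
    (x.vec.bit 4) (x.vec.bit 5) (y.vec.bit 4) (y.vec.bit 5)
  unfold intRepFun
  rw [sign_mul_triple (fun z => signOf_comm y.sign z) c1 c2 c3 p1 p2 p3,
    M.mul_sign, M.mul_vec, cocycle_eq, signOf_mul, signOf_mul]
  simp only [V.bit_add]

/-- The faithful representation of `M` by integral quaternion matrices. -/
def intRep : M →* IntMat where
  toFun := intRepFun
  map_one' := by
    change signOf IntMat false * (pairMon _ _ (V.bit 0 0) (V.bit 0 1) *
      pairMon _ _ (V.bit 0 2) (V.bit 0 3) * pairMon _ _ (V.bit 0 4) (V.bit 0 5)) = 1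
    simp [signOf, pairMon, V.bit_zero]
  map_mul' := intRepFun_mul

theorem intRep_sgn (c : Bool) : intRep (M.sgn c) = signOf IntMat c := by
  change intRepFun (M.sgn c) = _
  simp [intRepFun, M.sgn, V.bit_zero, pairMon]

theorem intRep_lift_e : ∀ i, intRep (M.lift (e i)) = gen i := by decide +kernel

/-- The faithful representation of `M` by real quaternion matrices. -/
noncomputable def rep : M →* QuatDirac.GL4H := unitMap.comp intRep.toHomUnits

theorem coe_rep (x : M) : (rep x : Matrix (Fin 4) (Fin 4) ℍ[ℝ]) = matMap (intRep x) := rfl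

theorem coe_rep_sgn (c : Bool) :
    (rep (M.sgn c) : Matrix (Fin 4) (Fin 4) ℍ[ℝ]) = signOf _ c := by
  rw [coe_rep, intRep_sgn]
  cases c
  · exact map_one matMap
  · change matMap (-1) = -1
    rw [map_neg, map_one]

/-- An element acting as the identity commutes with every lift up to a sign that must be trivial;
nondegeneracy makes it central, and -1 is not the identity matrix. -/
theorem rep_injective : Function.Injective rep := by
  have hs : ∀ c, rep (M.sgn c) = 1 → c = false := by
    intro c h
    cases c
    · rfl
    · exfalso
      have h1 := congrArg (fun u : QuatDirac.GL4H => (u : Matrix (Fin 4) (Fin 4) ℍ[ℝ])) h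
      simp only [coe_rep_sgn, Units.val_one] at h1
      have h2 := congrArg QuaternionAlgebra.re (congrFun (congrFun h1 0) 0)
      simp [signOf] at h2
      norm_num at h2
  rw [injective_iff_map_eq_one]
  intro x hx
  have hv : x.vec = 0 := by
    refine b_nondegenerate fun i => hs _ ?_
    have h := M.mul_comm_sgn x (M.lift (e i))
    have h1 := congrArg rep h
    rw [map_mul, map_mul, map_mul, hx, one_mul, mul_one, M.lift_vec] at h1
    exact mul_eq_right.1 h1.symm
  rw [M.vec_eq_zero_iff.1 hv] at hx ⊢
  rw [hs _ hx]; rfl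

/-- A subgroup of `M` containing the lifts of the basis is the whole group. -/
theorem M.eq_top_of_lift_mem {H : Subgroup M} (h : ∀ i, lift (e i) ∈ H) : H = ⊤ := by
  have hs : ∀ c, sgn c ∈ H := by
    intro c
    cases c
    · exact one_mem _
    · rw [← q_e 0, ← lift_vec (e 0), ← mul_self]; exact mul_mem (h 0) (h 0)
  have hl : ∀ x, lift x ∈ H := by
    refine induction_basis (hs false) h ?_
    intro x y hx hy
    rw [eq_sgn_mul_of_vec_eq (x := lift (x + y)) (y := lift x * lift y) rfl]
    exact mul_mem (hs _) (mul_mem hx hy)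
  rw [eq_top_iff]
  intro x _
  rw [eq_sgn_mul_of_vec_eq (x := x) (y := lift x.vec) rfl]
  exact mul_mem (hs _) (hl _)

theorem matMap_fin (A : Fin 4 → Fin 4 → ℍ[ℤ]) : matMap (Matrix.of A) =
    !![quatMap (A 0 0), quatMap (A 0 1), quatMap (A 0 2), quatMap (A 0 3);
       quatMap (A 1 0), quatMap (A 1 1), quatMap (A 1 2), quatMap (A 1 3);
       quatMap (A 2 0), quatMap (A 2 1), quatMap (A 2 2), quatMap (A 2 3);
       quatMap (A 3 0), quatMap (A 3 1), quatMap (A 3 2), quatMap (A 3 3)] := by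
  ext1 i j
  rw [matMap_apply]
  fin_cases i <;> fin_cases j <;> rfl

theorem E128_eq_closure :
    QuatDirac.E128 = Subgroup.closure (Set.range fun i => rep (M.lift (e i))) := by
  unfold QuatDirac.E128 QuatDirac.matrixGroup
  congr 1
  ext u
  have h : ∀ i, u = rep (M.lift (e i)) ↔ (u : Matrix (Fin 4) (Fin 4) ℍ[ℝ]) = matMap (gen i) := by
    intro i
    rw [Units.ext_iff, coe_rep, intRep_lift_e]
  simp only [Set.mem_range, eq_comm (b := u), h, Set.mem_ofPred_eq, Set.mem_insert_iff,
    Set.mem_singleton_iff, Fin.exists_fin_succ]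
  simp [gen, matMap_fin, quatMap_ri, quatMap_rj]

theorem range_rep : rep.range = QuatDirac.E128 := by
  refine le_antisymm ?_ ?_
  · have h : QuatDirac.E128.comap rep = ⊤ := M.eq_top_of_lift_mem fun i => by
      rw [Subgroup.mem_comap, E128_eq_closure]
      exact Subgroup.subset_closure ⟨i, rfl⟩
    rintro _ ⟨x, rfl⟩
    exact Subgroup.mem_comap.1 (h ▸ Subgroup.mem_top x)
  · rw [E128_eq_closure, Subgroup.closure_le]
    rintro _ ⟨i, rfl⟩
    exact ⟨_, rfl⟩

theorem rep_mem (x : M) : rep x ∈ QuatDirac.E128 := range_rep ▸ ⟨x, rfl⟩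

/-- The group of Dirac matrices is the extraspecial group `M`. -/
noncomputable def repEquiv : M ≃* QuatDirac.E128 :=
  (MonoidHom.ofInjective rep_injective).trans (MulEquiv.subgroupCongr range_rep)

theorem coe_repEquiv (x : M) : (repEquiv x : QuatDirac.GL4H) = rep x := rfl

/-! ### The normalizer of the group of Dirac matrices -/

/-- The normalizer of the group of Dirac matrices. -/
noncomputable def normalizerE : Subgroup GL4H := Subgroup.normalizer (E128 : Set GL4H)

/-- The action by conjugation of the normalizer on the group of Dirac matrices. -/
noncomputable def conjE : normalizerE →* MulAut E128 := Subgroup.normalizerMonoidHom E128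

theorem coe_conjE (g : normalizerE) (x : E128) :
    (conjE g x : GL4H) = (g : GL4H) * x * (g : GL4H)⁻¹ := rfl

/-- The action by conjugation of the normalizer, transported to `M`. -/
noncomputable def conjM : normalizerE →* MulAut M :=
  (MulAut.congr repEquiv.symm).toMonoidHom.comp conjE

theorem rep_conjM (g : normalizerE) (x : M) :
    rep (conjM g x) = (g : GL4H) * rep x * (g : GL4H)⁻¹ := by
  rw [← coe_repEquiv, ← coe_repEquiv, ← coe_conjE]
  congr 1
  exact repEquiv.apply_symm_apply _

/-- The action by conjugation of the normalizer on `V`. -/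
noncomputable def conjV : normalizerE →* Equiv.Perm V := M.bar.comp conjM

theorem conjV_apply {g : normalizerE} {x y : M}
    (h : (g : GL4H) * rep x * (g : GL4H)⁻¹ = rep y) : conjV g x.vec = y.vec := by
  have h1 : conjM g x = y := rep_injective ((rep_conjM g x).trans h)
  rw [← h1]
  exact M.bar_apply _ _

/-- Since `E128` is finite, mapping it into itself is enough. -/
theorem mem_normalizerE_of {g : GL4H} (h : ∀ x : M, ∃ y : M, g * rep x * g⁻¹ = rep y) :
    g ∈ normalizerE := by
  have : Finite E128 := Finite.of_equiv M repEquiv.toEquiv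
  refine Subgroup.mem_normalizer_fintype ?_
  rintro _ hx
  rw [SetLike.mem_coe, ← range_rep] at hx
  obtain ⟨x, rfl⟩ := hx
  obtain ⟨y, hy⟩ := h x
  rw [hy]
  exact rep_mem y

/-! ### The reflections -/

/-- Twice the matrix of the reflection of order two in a root. -/
def reflOf (c : ℤ) (r : Fin 4 → ℍ[ℤ]) : IntMat :=
  Matrix.of fun i j => (if i = j then 2 else 0) - c • (star (r i) * r j)

/-- Roots of some quaternionic reflections. -/
def root : Fin 13 → Fin 4 → ℍ[ℤ] :=
  ![![1, 0, 0, 0], ![1, 1, 1, 1], ![0, 1, -1, 0], ![0, 1, 0, -1], ![0, 1, rj, 0], ![0, 1, 0, -ri],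
    ![1, -rk, ri, rj], ![1, -rj, ri, -rk], ![1, rk, -ri, rj], ![1, rj, -ri, -rk],
    ![1, rk, ri, -rj], ![1, -rj, rk, ri], ![1, rj, rk, -ri]]

/-- Four divided by the norm of the root. -/
def rootScale : Fin 13 → ℤ := ![4, 1, 2, 2, 2, 2, 1, 1, 1, 1, 1, 1, 1]

/-- Twice the matrices of the reflections. -/
def reflMat2 (k : Fin 13) : IntMat := reflOf (rootScale k) (root k)

/-- The element of `M` with a given code. -/
def M.ofNat (n : ℕ) : M := ⟨n.testBit 6, V.ofNat n⟩

/-- The first involution in `M` defining a reflection. -/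
def reflLeft (k : Fin 13) : M := M.ofNat (![20, 24, 28, 84, 10, 5, 5, 5, 10, 69, 5, 7, 7] k)

/-- The second involution in `M` defining a reflection. -/
def reflRight (k : Fin 13) : M :=
  M.ofNat (![104, 44, 40, 108, 40, 17, 10, 14, 69, 75, 74, 9, 73] k)

theorem root_norm : ∀ k, rootScale k • (root k 0 * star (root k 0) + root k 1 * star (root k 1) +
    root k 2 * star (root k 2) + root k 3 * star (root k 3)) = 4 := by decide +kernel

theorem reflMat2_sq : ∀ k, reflMat2 k * reflMat2 k = 4 := by decide +kernel

theorem star_reflMat2 : ∀ k, (reflMat2 k)ᴴ = reflMat2 k := by decide +kernel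

/-- For commuting involutions s and f, (1+s)(1+f)/4 is the projection onto their common fixed space,
here the line of the root. The reflection is 1 minus twice this projection, an expression in `E128`
alone. -/
theorem reflMat2_eq : ∀ k,
    reflMat2 k = 2 - (1 + intRep (reflLeft k)) * (1 + intRep (reflRight k)) := by
  decide +kernel

theorem q_reflLeft : ∀ k, q (reflLeft k).vec = false := by decide +kernel
theorem q_reflRight : ∀ k, q (reflRight k).vec = false := by decide +kernel
theorem b_refl : ∀ k, b (reflLeft k).vec (reflRight k).vec = false := by decide +kernel

theorem matMap_intCast_mul (n : ℤ) (X : IntMat) : matMap (n • X) = (n : ℝ) • matMap X := by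
  rw [map_zsmul, Int.cast_smul_eq_zsmul]

/-- The matrix of a reflection. -/
noncomputable def reflReal (k : Fin 13) : Matrix (Fin 4) (Fin 4) ℍ[ℝ] :=
  (1 / 2 : ℝ) • matMap (reflMat2 k)

theorem reflReal_sq (k : Fin 13) : reflReal k * reflReal k = 1 := by
  rw [reflReal, smul_mul_smul_comm, ← map_mul, reflMat2_sq]
  have : (4 : IntMat) = (4 : ℤ) • 1 := by simp
  rw [this, matMap_intCast_mul, map_one, smul_smul]
  norm_num

/-- Some quaternionic reflections of order two. -/
noncomputable def refl (k : Fin 13) : GL4H :=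
  ⟨reflReal k, reflReal k, reflReal_sq k, reflReal_sq k⟩

theorem coe_refl (k : Fin 13) : (refl k : Matrix (Fin 4) (Fin 4) ℍ[ℝ]) = reflReal k := rfl

theorem quat_four_ne_zero : (4 : ℍ[ℝ]) ≠ 0 := by
  have h := (algebraMap ℝ ℍ[ℝ]).injective.ne (show (4 : ℝ) ≠ 0 by norm_num)
  rwa [map_ofNat, map_zero] at h

theorem quatMap_two : quatMap 2 = 2 := map_ofNat quatMap 2

theorem isReflection_refl (k : Fin 13) : IsReflection (refl k) := by
  set r : Fin 4 → ℍ[ℝ] := fun i => quatMap (root k i) with hr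
  have hn : (rootScale k : ℝ) • (∑ i, r i * star (r i)) = 4 := by
    have h := congrArg quatMap (root_norm k)
    rw [map_zsmul] at h
    simp only [map_add, map_mul, quatMap_star, map_ofNat] at h
    rw [Fin.sum_univ_four, Int.cast_smul_eq_zsmul]
    exact h
  have hc : (rootScale k : ℝ) ≠ 0 := by
    intro h
    rw [h, zero_smul] at hn
    exact quat_four_ne_zero hn.symm
  have hinv : (∑ i, r i * star (r i))⁻¹ = ((rootScale k : ℝ) / 4) • (1 : ℍ[ℝ]) := by
    have h1 : (∑ i, r i * star (r i)) = ((rootScale k : ℝ)⁻¹ * 4) • (1 : ℍ[ℝ]) := by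
      rw [← smul_smul, eq_inv_smul_iff₀ hc, hn, ← Algebra.algebraMap_eq_smul_one, map_ofNat]
    rw [h1]
    refine inv_eq_of_mul_eq_one_right ?_
    rw [smul_mul_smul_comm, mul_one]
    convert one_smul ℝ (1 : ℍ[ℝ]) using 2
    field_simp
  refine ⟨r, ?_, -1, by simp, ?_, ?_⟩
  · intro h0
    rw [h0] at hn
    simp only [Pi.zero_apply, zero_mul, Finset.sum_const_zero, smul_zero] at hn
    exact quat_four_ne_zero hn.symm
  · intro h
    have := congrArg QuaternionAlgebra.re h
    norm_num at this
  · intro x m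
    have hentry : ∀ i, reflReal k i m =
        (if i = m then 1 else 0) - ((rootScale k : ℝ) / 2) • (star (r i) * r m) := by
      intro i
      change (1 / 2 : ℝ) • quatMap ((if i = m then 2 else 0) -
        rootScale k • (star (root k i) * root k m)) = _
      rw [map_sub, map_zsmul, map_mul, quatMap_star, ← Int.cast_smul_eq_zsmul ℝ, smul_sub,
        smul_smul]
      congr 1
      · split_ifs
        · rw [quatMap_two]
          have : (2 : ℍ[ℝ]) = (2 : ℝ) • 1 := by
            rw [← Algebra.algebraMap_eq_smul_one, map_ofNat]
          rw [this, smul_smul]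
          norm_num
        · rw [map_zero, smul_zero]
      · rw [one_div, inv_mul_eq_div]
    rw [hinv, coe_refl]
    change ∑ i, x i * reflReal k i m = _
    simp only [hentry, mul_sub, Finset.sum_sub_distrib, mul_ite, mul_one, mul_zero,
      Finset.sum_ite_eq', Finset.mem_univ, if_true, mul_smul_comm, smul_mul_assoc, ← mul_assoc,
      ← Finset.sum_mul, ← Finset.smul_sum]
    congr 1
    rw [mul_neg_one, smul_neg, sub_neg_eq_add, ← add_smul, smul_mul_assoc]
    congr 1
    ring

/-! ### The reflection group -/

/-- `x` commutes or anticommutes with `s` and `f`, so moving it through the projection only changes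
signs there. The four projections with different signs are exchanged by multiplying with `s` and
`f`, and this produces the correction factor: `x` acquires `f` when it anticommutes with `s`, and
`s` when it anticommutes with `f`. -/
theorem reflection_mul_eq {R : Type*} [Ring R] {s f x : R} (hs : s * s = 1) (hf : f * f = 1)
    (hfs : f * s = s * f) (c d : Bool) (hsx : s * x = signOf R c * (x * s))
    (hfx : f * x = signOf R d * (x * f)) :
    (2 - (1 + s) * (1 + f)) * x = signOf R (c || d) *
      (x * ((if c then f else 1) * (if d then s else 1))) * (2 - (1 + s) * (1 + f)) := by
  have h1 : ∀ z, s * (s * z) = z := fun z => by rw [← mul_assoc, hs, one_mul]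
  have h3 : ∀ z, f * (s * z) = s * (f * z) := fun z => by
    rw [← mul_assoc, hfs, mul_assoc]
  have h4 : ∀ z, s * (x * z) = signOf R c * (x * (s * z)) := fun z => by
    rw [← mul_assoc, hsx, mul_assoc, mul_assoc]
  have h6 : (2 : R) = 1 + 1 := one_add_one_eq_two.symm
  cases c <;> cases d <;> rw [h6] <;>
    simp [signOf] at hsx hfx h4 ⊢ <;>
    simp [mul_add, add_mul, mul_sub, sub_mul, mul_assoc, hs, hf, hfs, hsx, hfx, h1, h3, h4] <;> abel

theorem coe_rep_mul_comm (x y : M) :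
    (rep x : Matrix (Fin 4) (Fin 4) ℍ[ℝ]) * rep y =
      signOf _ (b x.vec y.vec) * ((rep y : Matrix (Fin 4) (Fin 4) ℍ[ℝ]) * rep x) := by
  rw [← coe_rep_sgn, ← Units.val_mul, ← Units.val_mul, ← Units.val_mul, ← map_mul, ← map_mul,
    ← map_mul, ← M.mul_comm_sgn]

theorem coe_rep_mul_self {x : M} (hx : q x.vec = false) :
    (rep x : Matrix (Fin 4) (Fin 4) ℍ[ℝ]) * rep x = 1 := by
  rw [← Units.val_mul, ← map_mul, M.mul_self, hx, M.sgn_false, map_one, Units.val_one]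

theorem two_smul_reflReal (k : Fin 13) : (2 : ℝ) • reflReal k =
    2 - (1 + (rep (reflLeft k) : Matrix (Fin 4) (Fin 4) ℍ[ℝ])) * (1 + rep (reflRight k)) := by
  rw [reflReal, smul_smul, reflMat2_eq, coe_rep, coe_rep]
  simp only [map_sub, map_mul, map_add, map_one, map_ofNat]
  norm_num

/-- The conjugate of an element of `M` under a reflection. -/
def reflConj (k : Fin 13) (x : M) : M :=
  M.sgn (b (reflLeft k).vec x.vec || b (reflRight k).vec x.vec) *
    (x * ((if b (reflLeft k).vec x.vec then reflRight k else 1) *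
      (if b (reflRight k).vec x.vec then reflLeft k else 1)))

theorem reflConj_vec (k : Fin 13) (x : M) :
    (reflConj k x).vec = siegel (reflLeft k).vec (reflRight k).vec x.vec := by
  rw [reflConj, siegel, b_comm x.vec, b_comm x.vec]
  cases b (reflLeft k).vec x.vec <;> cases b (reflRight k).vec x.vec <;>
    simp [M.mul_vec, M.sgn]

theorem refl_conj (k : Fin 13) (x : M) : refl k * rep x * (refl k)⁻¹ = rep (reflConj k x) := by
  rw [mul_inv_eq_iff_eq_mul]
  ext1
  have h2 : (2 : ℝ) ≠ 0 := two_ne_zero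
  refine smul_right_injective _ h2 ?_
  change (2 : ℝ) • (reflReal k * (rep x : Matrix (Fin 4) (Fin 4) ℍ[ℝ])) =
    (2 : ℝ) • ((rep (reflConj k x) : Matrix (Fin 4) (Fin 4) ℍ[ℝ]) * reflReal k)
  rw [← smul_mul_assoc, ← mul_smul_comm, two_smul_reflReal]
  have hcomm : (rep (reflRight k) : Matrix (Fin 4) (Fin 4) ℍ[ℝ]) * rep (reflLeft k) =
      rep (reflLeft k) * (rep (reflRight k) : Matrix (Fin 4) (Fin 4) ℍ[ℝ]) := by
    rw [coe_rep_mul_comm, b_comm, b_refl]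
    simp [signOf]
  rw [reflection_mul_eq (coe_rep_mul_self (q_reflLeft k)) (coe_rep_mul_self (q_reflRight k)) hcomm
    _ _ (coe_rep_mul_comm _ x) (coe_rep_mul_comm _ x), reflConj, map_mul, Units.val_mul,
    coe_rep_sgn]
  congr 2
  cases b (reflLeft k).vec x.vec <;> cases b (reflRight k).vec x.vec <;> simp

/-- A quaternionic reflection group containing the group of Dirac matrices. -/
noncomputable def W : Subgroup GL4H := Subgroup.closure (Set.range refl)

theorem refl_mem (k : Fin 13) : refl k ∈ W := Subgroup.subset_closure ⟨k, rfl⟩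

theorem W_eq_closure : W = Subgroup.closure {g | g ∈ W ∧ IsReflection g} := by
  refine le_antisymm (Subgroup.closure_mono ?_) ((Subgroup.closure_le _).2 fun g hg => hg.1)
  rintro _ ⟨k, rfl⟩
  exact ⟨refl_mem k, isReflection_refl k⟩

theorem refl_mem_normalizerE (k : Fin 13) : refl k ∈ normalizerE :=
  mem_normalizerE_of fun x => ⟨_, refl_conj k x⟩

theorem W_le_normalizerE : W ≤ normalizerE := by
  rw [W, Subgroup.closure_le]
  rintro _ ⟨k, rfl⟩
  exact refl_mem_normalizerE k

/-- The action of the reflection group on `V`. -/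
noncomputable def actV : W →* Equiv.Perm V := conjV.comp (Subgroup.inclusion W_le_normalizerE)

theorem actV_apply {g : W} {x y : M} (h : (g : GL4H) * rep x * (g : GL4H)⁻¹ = rep y) :
    actV g x.vec = y.vec := conjV_apply (g := ⟨g, W_le_normalizerE g.2⟩) h

theorem actV_refl (k : Fin 13) (x : V) :
    actV ⟨refl k, refl_mem k⟩ x = siegel (reflLeft k).vec (reflRight k).vec x := by
  have h := actV_apply (g := ⟨refl k, refl_mem k⟩) (refl_conj k (M.lift x))
  rwa [reflConj_vec] at h

/-- Each reflection acts as a Siegel transformation, hence as a rotation. Conversely, the rotations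
are generated by products of two simple reflections, and each of these is a word in the thirteen
Siegel transformations. -/
theorem range_actV : actV.range = rotationHom.range := by
  refine le_antisymm ?_ ?_
  · have h : ∀ g : GL4H, ∀ hg : g ∈ W, actV ⟨g, hg⟩ ∈ rotationHom.range := by
      intro g hg
      unfold W at hg
      induction hg using Subgroup.closure_induction with
      | mem x hx =>
        obtain ⟨k, rfl⟩ := hx
        obtain ⟨r, hr⟩ := exists_rotation_siegel (q_reflLeft k) (q_reflRight k) (b_refl k)
        refine ⟨r, Equiv.ext fun x => ?_⟩
        rw [hr, ← actV_refl]
      | one => exact ⟨1, (map_one _).trans (map_one actV).symm⟩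
      | mul x y hx hy h1 h2 =>
        have := mul_mem h1 h2
        rwa [← map_mul] at this
      | inv x hx h1 =>
        have := inv_mem h1
        rwa [← map_inv] at this
    rintro _ ⟨g, rfl⟩
    exact h g g.2
  · refine range_rotationHom_le ?_
    have hk : ∀ k, actV ⟨refl k, refl_mem k⟩ ∈ actV.range := fun k => ⟨_, rfl⟩
    have hw : ∀ (l : List (Fin 13)) (g : Equiv.Perm V),
        (∀ x, g x = l.foldr (fun k y => siegel (reflLeft k).vec (reflRight k).vec y) x) →
        g ∈ actV.range := by
      intro l
      induction l with
      | nil =>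
        intro g hg
        have : g = 1 := Equiv.ext hg
        rw [this]; exact one_mem _
      | cons k l ih =>
        intro g hg
        have h1 := ih ((actV ⟨refl k, refl_mem k⟩)⁻¹ * g) fun x => by
          rw [Equiv.Perm.mul_apply, Equiv.Perm.inv_eq_iff_eq, actV_refl, hg, List.foldr_cons]
        have := mul_mem (hk k) h1
        rwa [mul_inv_cancel_left] at this
    intro i
    -- Entry `i` is a word for the `i`-th simple reflection times the first one, so entry 0 is
    -- empty.
    refine hw (![[], [6, 7], [0, 2, 11, 6, 1, 3], [1, 2, 3, 4, 11, 2, 4], [11, 0, 2, 11],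
      [0, 3, 6, 7]] i) _ ?_
    revert i
    have : ∀ (i : Fin 6) (x : V), transvect (simpleRoot i) (transvect (simpleRoot 0) x) =
        (![[], [6, 7], [0, 2, 11, 6, 1, 3], [1, 2, 3, 4, 11, 2, 4], [11, 0, 2, 11],
          [0, 3, 6, 7]] i : List (Fin 13)).foldr
          (fun k y => siegel (reflLeft k).vec (reflRight k).vec y) x := by
      decide +kernel
    exact this

/-! ### Words in the reflections -/

theorem coe_list_prod (l : List (Fin 13)) :
    (((l.map refl).prod : GL4H) : Matrix (Fin 4) (Fin 4) ℍ[ℝ]) =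
      (1 / 2 : ℝ) ^ l.length • matMap (l.map reflMat2).prod := by
  induction l with
  | nil => simp
  | cons k l ih =>
    rw [List.map_cons, List.prod_cons, Units.val_mul, ih, coe_refl, reflReal, smul_mul_smul_comm,
      ← map_mul, List.map_cons, List.prod_cons, List.length_cons, pow_succ']

theorem mem_W_of_word (l : List (Fin 13)) {c : ℤ} {X : IntMat} {g : GL4H} {d : ℝ}
    (hX : (l.map reflMat2).prod = c • X)
    (hg : (g : Matrix (Fin 4) (Fin 4) ℍ[ℝ]) = d • matMap X) (hd : (1 / 2 : ℝ) ^ l.length * c = d) :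
    g ∈ W := by
  have : g = (l.map refl).prod := by
    ext1
    rw [coe_list_prod, hX, matMap_intCast_mul, smul_smul, hg, hd]
  rw [this]
  refine list_prod_mem ?_
  simp only [List.mem_map]
  rintro _ ⟨k, _, rfl⟩
  exact refl_mem k

/-- Words in the reflections for the Dirac matrices. -/
def genWord : Fin 6 → List (Fin 13) :=
  ![[6, 7, 8, 9], [6, 10, 11, 12], [1, 5, 3, 5, 1, 2, 4, 2, 4, 3], [1, 2, 4, 2, 4, 1, 3, 5, 3, 5],
    [2, 4, 2, 4, 1, 3, 5, 3, 5, 1], [1, 4, 2, 4, 1, 3, 5, 3, 5, 2]]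

theorem genWord_prod : ∀ i,
    ((genWord i).map reflMat2).prod = (2 ^ (genWord i).length : ℤ) • gen i := by
  decide +kernel

theorem E128_le_W : E128 ≤ W := by
  rw [E128_eq_closure, Subgroup.closure_le]
  rintro _ ⟨i, rfl⟩
  refine mem_W_of_word (genWord i) (genWord_prod i) (d := 1) ?_ ?_
  · rw [coe_rep, intRep_lift_e, one_smul]
  · rw [one_div, Int.cast_pow, Int.cast_ofNat, ← mul_pow, inv_mul_cancel₀ two_ne_zero, one_pow]

/-! ### The kernel of the action of the reflection group -/

theorem matMap_gen (i : Fin 6) : matMap (gen i) =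
    (![!![QuatDirac.qi, 0, 0, 0; 0, QuatDirac.qi, 0, 0; 0, 0, QuatDirac.qi, 0;
        0, 0, 0, QuatDirac.qi],
      !![QuatDirac.qj, 0, 0, 0; 0, QuatDirac.qj, 0, 0; 0, 0, QuatDirac.qj, 0;
        0, 0, 0, QuatDirac.qj],
      !![0, 0, 1, 0; 0, 0, 0, -1; -1, 0, 0, 0; 0, 1, 0, 0],
      !![0, 0, 0, 1; 0, 0, 1, 0; 0, -1, 0, 0; -1, 0, 0, 0],
      !![0, 0, -1, 0; 0, 0, 0, -1; 1, 0, 0, 0; 0, 1, 0, 0],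
      !![0, 0, 0, 1; 0, 0, -1, 0; 0, 1, 0, 0; -1, 0, 0, 0]] i :
      Matrix (Fin 4) (Fin 4) ℍ[ℝ]) := by
  fin_cases i <;> simp [gen, matMap_fin, quatMap_ri, quatMap_rj]

theorem quaternion_eq_of_commute {x : ℍ[ℝ]} (hi : x * QuatDirac.qi = QuatDirac.qi * x)
    (hj : x * QuatDirac.qj = QuatDirac.qj * x) : x = (x.re : ℍ[ℝ]) := by
  have i0 : QuatDirac.qi.re = 0 := rfl
  have i1 : QuatDirac.qi.imI = 1 := rfl
  have i2 : QuatDirac.qi.imJ = 0 := rfl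
  have i3 : QuatDirac.qi.imK = 0 := rfl
  have j0 : QuatDirac.qj.re = 0 := rfl
  have j1 : QuatDirac.qj.imI = 0 := rfl
  have j2 : QuatDirac.qj.imJ = 1 := rfl
  have j3 : QuatDirac.qj.imK = 0 := rfl
  have h1 := congrArg QuaternionAlgebra.imK hi
  have h2 := congrArg QuaternionAlgebra.imJ hi
  have h3 := congrArg QuaternionAlgebra.imK hj
  simp only [Quaternion.imK_mul, Quaternion.imJ_mul, i0, i1, i2, i3, j0, j1, j2, j3] at h1 h2 h3
  ext <;> simp <;> linarith

/-- The matrices commuting with the Dirac matrices are the real scalars. -/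
theorem exists_eq_smul_one {X : Matrix (Fin 4) (Fin 4) ℍ[ℝ]}
    (hX : ∀ i, X * matMap (gen i) = matMap (gen i) * X) : ∃ c : ℝ, X = c • 1 := by
  have h : ∀ i p r, (X * matMap (gen i)) p r = (matMap (gen i) * X) p r := fun i p r => by rw [hX]
  simp only [matMap_gen, Matrix.mul_apply, Fin.sum_univ_four] at h
  -- Commuting with the scalar matrices i and j forces every entry to be real.
  have hre : ∀ p r, X p r = ((X p r).re : ℍ[ℝ]) := by
    intro p r
    refine quaternion_eq_of_commute ?_ ?_
    · have := h 0 p r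
      fin_cases p <;> fin_cases r <;> simpa using this
    · have := h 1 p r
      fin_cases p <;> fin_cases r <;> simpa using this
  have h2 := fun p r => congrArg QuaternionAlgebra.re (h 2 p r)
  have h3 := fun p r => congrArg QuaternionAlgebra.re (h 3 p r)
  have h4 := fun p r => congrArg QuaternionAlgebra.re (h 4 p r)
  have h5 := fun p r => congrArg QuaternionAlgebra.re (h 5 p r)
  clear h hX
  simp [Fin.forall_fin_succ] at h2 h3 h4 h5
  refine ⟨(X 0 0).re, ?_⟩
  -- The other four Dirac matrices are real and generate the full real matrix algebra, so only
  -- scalars remain; here the resulting linear equations are solved directly.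
  have key : ∀ p r, (X p r).re = if p = r then (X 0 0).re else 0 := by
    intro p r
    clear hre
    revert p r
    simp only [Fin.forall_fin_succ]
    simp
    grind
  ext1 p r
  rw [hre, key, Matrix.smul_apply, Matrix.one_apply]
  split_ifs
  · ext <;> simp
  · simp

theorem conjTranspose_matMap (X : IntMat) : (matMap X)ᴴ = matMap Xᴴ := by
  ext1 i j
  exact (quatMap_star (X j i)).symm

theorem conjTranspose_real_smul (c : ℝ) (X : Matrix (Fin 4) (Fin 4) ℍ[ℝ]) :
    (c • X)ᴴ = c • Xᴴ := by
  ext1 i j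
  exact Quaternion.star_smul c (X j i)

theorem conjTranspose_mul_self_of_mem {g : GL4H} (hg : g ∈ W) :
    (g : Matrix (Fin 4) (Fin 4) ℍ[ℝ])ᴴ * g = 1 := by
  unfold W at hg
  induction hg using Subgroup.closure_induction with
  | mem x hx =>
    obtain ⟨k, rfl⟩ := hx
    rw [coe_refl]
    have : (reflReal k)ᴴ = reflReal k := by
      rw [reflReal, conjTranspose_real_smul, conjTranspose_matMap, star_reflMat2]
    rw [this, reflReal_sq]
  | one => simp
  | mul x y hx hy h1 h2 =>
    rw [Units.val_mul, Matrix.conjTranspose_mul, ← Matrix.mul_assoc,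
      Matrix.mul_assoc _ _ (x : Matrix (Fin 4) (Fin 4) ℍ[ℝ]), h1, Matrix.mul_one, h2]
  | inv x hx h1 =>
    have h2 : (x : Matrix (Fin 4) (Fin 4) ℍ[ℝ])ᴴ = ((x⁻¹ : GL4H) : Matrix (Fin 4) (Fin 4) ℍ[ℝ]) :=
      Units.eq_inv_of_mul_eq_one_right h1
    rw [← h2, Matrix.conjTranspose_conjTranspose, h2, Units.mul_inv]

/-- An element acting trivially on `V` conjugates `E128` like some element of `E128`. Their quotient
centralises `E128`, so it is a real scalar, and `W` is unitary, so the scalar is ±1. -/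
theorem ker_actV : actV.ker = E128.subgroupOf W := by
  ext g
  rw [MonoidHom.mem_ker, Subgroup.mem_subgroupOf]
  constructor
  · intro h
    obtain ⟨v, hm⟩ := M.exists_conj_of_bar_eq_one h
    set m := M.lift v
    have hc : ∀ x, (g : GL4H) * rep x * (g : GL4H)⁻¹ = rep m * rep x * (rep m)⁻¹ := by
      intro x
      have h1 := rep_conjM ⟨g, W_le_normalizerE g.2⟩ x
      change _ = (g : GL4H) * rep x * (g : GL4H)⁻¹ at h1
      rw [← h1]
      change rep (conjM (Subgroup.inclusion W_le_normalizerE g) x) = _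
      rw [← map_inv, ← map_mul, ← map_mul]
      congr 1
      exact DFunLike.congr_fun hm x
    -- Division by `rep m` leaves an element of `W` that commutes with all Dirac matrices.
    set s : GL4H := (rep m)⁻¹ * g with hs
    have hcomm : ∀ x, s * rep x = rep x * s := by
      intro x
      have h1 := hc x
      rw [mul_inv_eq_iff_eq_mul] at h1
      rw [hs, mul_assoc, h1]
      simp only [mul_assoc, inv_mul_cancel_left]
    have hsW : s ∈ W := mul_mem (inv_mem (E128_le_W (rep_mem m))) g.2
    obtain ⟨c, hc⟩ := exists_eq_smul_one (X := s) fun i => by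
      rw [← intRep_lift_e, ← coe_rep, ← Units.val_mul, ← Units.val_mul, hcomm]
    have h1 := conjTranspose_mul_self_of_mem hsW
    rw [hc, conjTranspose_real_smul, smul_mul_smul_comm, Matrix.conjTranspose_one, mul_one] at h1
    have h2 := congrArg QuaternionAlgebra.re (congrFun (congrFun h1 0) 0)
    simp at h2
    have hgs : (g : GL4H) = rep m * s := by rw [hs, mul_inv_cancel_left]
    have hsE : s ∈ E128 := by
      rcases mul_self_eq_one_iff.1 h2 with h3 | h3
      · have : s = rep (M.sgn false) := by
          ext1; rw [coe_rep_sgn, hc, h3]; simp [signOf]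
        rw [this]; exact rep_mem _
      · have : s = rep (M.sgn true) := by
          ext1; rw [coe_rep_sgn, hc, h3]; simp [signOf]
        rw [this]; exact rep_mem _
    rw [hgs]
    exact mul_mem (rep_mem m) hsE
  · intro h
    rw [← range_rep] at h
    obtain ⟨m, hm⟩ := h
    refine Equiv.ext fun x => ?_
    rw [← M.lift_vec x]
    have h1 := actV_apply (g := g) (x := M.lift x) (y := m * M.lift x * m⁻¹) (by
      rw [← hm, map_mul, map_mul, map_inv])
    rw [h1, M.conj_eq, M.mul_vec]
    exact zero_add _

/-- The homomorphism from the reflection group to the rotations. -/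
noncomputable def rotationMap : W →* QuatDirac.weylE6Rotations :=
  (MulEquiv.toMonoidHom (MonoidHom.ofInjective rotationHom_injective).symm).comp
    ((MulEquiv.subgroupCongr range_actV).toMonoidHom.comp actV.rangeRestrict)

theorem rotationMap_surjective : Function.Surjective rotationMap := by
  exact (MonoidHom.ofInjective rotationHom_injective).symm.surjective.comp
    ((MulEquiv.subgroupCongr range_actV).surjective.comp actV.rangeRestrict_surjective)

theorem ker_rotationMap : rotationMap.ker = E128.subgroupOf W := by
  rw [← ker_actV]
  ext x
  rw [MonoidHom.mem_ker, MonoidHom.mem_ker]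
  change (MonoidHom.ofInjective rotationHom_injective).symm
    (MulEquiv.subgroupCongr range_actV (actV.rangeRestrict x)) = 1 ↔ _
  rw [map_eq_one_iff _ (MulEquiv.injective _), map_eq_one_iff _ (MulEquiv.injective _),
    Subtype.ext_iff]
  rfl

/-- The kernel of the action is finite and the image is a group of permutations of the finite set
`V`. -/
theorem finite_W : Finite W := by
  have h1 : Finite E128 := Finite.of_equiv M repEquiv.toEquiv
  have h2 : Finite (E128.subgroupOf W) :=
    Finite.of_equiv _ (Subgroup.subgroupOfEquivOfLe E128_le_W).symm.toEquiv
  rw [← ker_actV] at h2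
  have h3 : Finite (W ⧸ actV.ker) :=
    Finite.of_equiv _ (QuotientGroup.quotientKerEquivRange actV).symm.toEquiv
  exact Finite.of_equiv _ (Subgroup.groupEquivQuotientProdSubgroup (s := actV.ker)).symm

theorem isReflectionGroup_W : IsReflectionGroup W := ⟨finite_W, W_eq_closure⟩

end DiracModel

/-! ### Products of subgroups -/

namespace Subgroup

variable {Γ : Type*} [Group Γ]

theorem exists_fin_pow_of_mem_zpowers {g x : Γ} {n : ℕ} [NeZero n] (hg : g ^ n = 1)
    (hx : x ∈ zpowers g) : ∃ k : Fin n, x = g ^ (k : ℕ) := by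
  have ho : 0 < orderOf g := orderOf_pos_iff.2 (isOfFinOrder_iff_pow_eq_one.2
    ⟨n, Nat.pos_of_ne_zero (NeZero.ne n), hg⟩)
  have hf : IsOfFinOrder g := orderOf_pos_iff.1 ho
  obtain ⟨m, rfl⟩ := hf.mem_powers_iff_mem_zpowers.2 hx
  refine ⟨⟨m % n, Nat.mod_lt _ (Nat.pos_of_ne_zero (NeZero.ne n))⟩, ?_⟩
  exact (pow_eq_pow_mod m hg)

/-- Finiteness of `N` turns the inclusion of a conjugate in `N` into equality, so it suffices to
test generators on generators. -/
theorem le_normalizer_of_generators {N H : Subgroup Γ} [Finite N] {S T : Set Γ}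
    (hN : N = closure T) (hH : H = closure S) (h : ∀ s ∈ S, ∀ t ∈ T, s * t * s⁻¹ ∈ N) :
    H ≤ normalizer (N : Set Γ) := by
  rw [hH, closure_le]
  intro s hs
  refine mem_normalizer_fintype ?_
  have hle : N ≤ N.comap (MulAut.conj s).toMonoidHom := by
    conv_lhs => rw [hN]
    rw [closure_le]
    intro t ht
    exact h s hs t ht
  exact fun n hn => hle hn

theorem exists_mul_of_mem_sup {N H : Subgroup Γ} (hle : H ≤ normalizer (N : Set Γ)) {g : Γ}
    (hg : g ∈ N ⊔ H) : ∃ n ∈ N, ∃ h ∈ H, n * h = g := by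
  rw [← SetLike.mem_coe, coe_mul_of_right_le_normalizer_left N H hle] at hg
  exact Set.mem_mul.1 hg

theorem card_sup_of_inf_eq_bot {N H : Subgroup Γ} (hle : H ≤ normalizer (N : Set Γ))
    (hb : N ⊓ H = ⊥) : Nat.card (N ⊔ H : Subgroup Γ) = Nat.card N * Nat.card H := by
  rw [← Nat.card_prod]
  symm
  refine Nat.card_congr (Equiv.ofBijective
    (fun p : N × H => (⟨p.1 * p.2, mul_mem_sup p.1.2 p.2.2⟩ : (N ⊔ H : Subgroup Γ))) ⟨?_, ?_⟩)
  · intro p p' h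
    exact mul_injective_of_disjoint (disjoint_iff.2 hb) (congrArg Subtype.val h)
  · rintro ⟨g, hg⟩
    obtain ⟨n, hn, k, hk, rfl⟩ := exists_mul_of_mem_sup hle hg
    exact ⟨(⟨n, hn⟩, ⟨k, hk⟩), rfl⟩

theorem card_sup_le {N H : Subgroup Γ} [Finite N] [Finite H]
    (hle : H ≤ normalizer (N : Set Γ)) :
    Finite (N ⊔ H : Subgroup Γ) ∧
      Nat.card (N ⊔ H : Subgroup Γ) ≤ Nat.card N * Nat.card H := by
  rw [← Nat.card_prod]
  have hs : Function.Surjective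
      (fun p : N × H => (⟨p.1 * p.2, mul_mem_sup p.1.2 p.2.2⟩ : (N ⊔ H : Subgroup Γ))) := by
    rintro ⟨g, hg⟩
    obtain ⟨n, hn, k, hk, rfl⟩ := exists_mul_of_mem_sup hle hg
    exact ⟨(⟨n, hn⟩, ⟨k, hk⟩), rfl⟩
  exact ⟨Finite.of_surjective _ hs, Nat.card_le_card_of_surjective _ hs⟩

theorem isSemidirect_of_le_normalizer {N H : Subgroup Γ} (hle : H ≤ normalizer (N : Set Γ))
    (hb : N ⊓ H = ⊥) : IsSemidirect N H (N ⊔ H) :=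
  ⟨fun _ hh _ hx => (mem_normalizer_iff.1 (hle hh) _).1 hx, hb, rfl⟩

end Subgroup

namespace DiracModel

/-! ### A presentation of the group of order 648 -/

/-- Relations between generators `a`, `b`, `x`, `y`, `c` and the central element `z`, as pairs
of words. -/
def relations : List (List (Fin 6) × List (Fin 6)) :=
  [([0, 1], [5, 1, 0]), ([5, 0], [0, 5]), ([5, 1], [1, 5]), ([5, 2], [2, 5]), ([5, 3], [3, 5]),
    ([5, 4], [4, 5]), ([5, 5, 5], []), ([0, 0, 0], []), ([1, 1, 1], []), ([4, 4, 4], []),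
    ([2, 2, 2, 2], []), ([3, 3], [2, 2]), ([3, 2], [2, 2, 2, 3]), ([2, 0], [1, 2]),
    ([2, 1], [0, 0, 2]), ([3, 0], [5, 5, 0, 0, 1, 3]), ([3, 1], [5, 0, 1, 3]), ([4, 0], [0, 4]),
    ([4, 1], [5, 5, 0, 0, 1, 4]), ([4, 2], [3, 4]), ([4, 3], [2, 2, 2, 3, 4])]

/-- A family of elements of a monoid satisfies the relations. -/
def IsRel {Γ : Type*} [Monoid Γ] (g : Fin 6 → Γ) : Prop :=
  ∀ r ∈ relations, (r.1.map g).prod = (r.2.map g).prod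

/-- The value of a normal form. -/
def normalForm {Γ : Type*} [Monoid Γ] (g : Fin 6 → Γ) (k i j : Fin 3) (l m : Fin 4) (n : Fin 3) :
    Γ :=
  (g 5 ^ (k : ℕ) * g 0 ^ (i : ℕ) * g 1 ^ (j : ℕ)) *
    ((g 2 ^ (l : ℕ) * g 3 ^ (m : ℕ)) * g 4 ^ (n : ℕ))

theorem map_normalForm {Γ Δ : Type*} [Monoid Γ] [Monoid Δ] (f : Γ →* Δ) (g : Fin 6 → Γ)
    (k i j : Fin 3) (l m : Fin 4) (n : Fin 3) :
    f (normalForm g k i j l m n) = normalForm (fun i => f (g i)) k i j l m n := by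
  simp only [normalForm, map_mul, map_pow]

namespace IsRel

theorem map {Γ Δ : Type*} [Monoid Γ] [Monoid Δ] {g : Fin 6 → Γ} (h : IsRel g) (f : Γ →* Δ) :
    IsRel fun i => f (g i) := by
  intro r hr
  have := congrArg f (h r hr)
  rwa [map_list_prod, map_list_prod, List.map_map, List.map_map] at this

theorem prod {Γ Δ : Type*} [Monoid Γ] [Monoid Δ] {g : Fin 6 → Γ} {g' : Fin 6 → Δ} (h : IsRel g)
    (h' : IsRel g') : IsRel fun i => (g i, g' i) := by
  intro r hr
  refine Prod.ext ?_ ?_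
  · have := h r hr
    change MonoidHom.fst Γ Δ _ = MonoidHom.fst Γ Δ _
    rw [map_list_prod, map_list_prod, List.map_map, List.map_map]
    exact this
  · have := h' r hr
    change MonoidHom.snd Γ Δ _ = MonoidHom.snd Γ Δ _
    rw [map_list_prod, map_list_prod, List.map_map, List.map_map]
    exact this

variable {Γ : Type*} [Group Γ] {g : Fin 6 → Γ}

/-- The subgroup generated by `a` and `b`. -/
def N (g : Fin 6 → Γ) : Subgroup Γ := Subgroup.closure {g 0, g 1}

/-- The subgroup generated by `x` and `y`. -/
def Q (g : Fin 6 → Γ) : Subgroup Γ := Subgroup.closure {g 2, g 3}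

/-- The subgroup generated by `c`. -/
def Z (g : Fin 6 → Γ) : Subgroup Γ := Subgroup.closure {g 4}

theorem mul_ab (h : IsRel g) : g 0 * g 1 = g 5 * (g 1 * g 0) := by
  simpa using h ([0, 1], [5, 1, 0]) (by simp [relations])

theorem commute_z (h : IsRel g) (i : Fin 6) : Commute (g 5) (g i) := by
  rw [commute_iff_eq]
  fin_cases i
  · simpa using h ([5, 0], [0, 5]) (by simp [relations])
  · simpa using h ([5, 1], [1, 5]) (by simp [relations])
  · simpa using h ([5, 2], [2, 5]) (by simp [relations])
  · simpa using h ([5, 3], [3, 5]) (by simp [relations])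
  · simpa using h ([5, 4], [4, 5]) (by simp [relations])
  · rfl

theorem z_pow (h : IsRel g) : g 5 ^ 3 = 1 := by
  simpa [pow_succ, mul_assoc] using h ([5, 5, 5], []) (by simp [relations])

theorem a_pow (h : IsRel g) : g 0 ^ 3 = 1 := by
  simpa [pow_succ, mul_assoc] using h ([0, 0, 0], []) (by simp [relations])

theorem b_pow (h : IsRel g) : g 1 ^ 3 = 1 := by
  simpa [pow_succ, mul_assoc] using h ([1, 1, 1], []) (by simp [relations])

theorem c_pow (h : IsRel g) : g 4 ^ 3 = 1 := by
  simpa [pow_succ, mul_assoc] using h ([4, 4, 4], []) (by simp [relations])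

theorem x_pow (h : IsRel g) : g 2 ^ 4 = 1 := by
  simpa [pow_succ, mul_assoc] using h ([2, 2, 2, 2], []) (by simp [relations])

theorem y_sq (h : IsRel g) : g 3 ^ 2 = g 2 ^ 2 := by
  simpa [pow_succ, mul_assoc] using h ([3, 3], [2, 2]) (by simp [relations])

theorem y_pow (h : IsRel g) : g 3 ^ 4 = 1 := by
  rw [show 4 = 2 * 2 from rfl, pow_mul, h.y_sq, ← pow_mul, h.x_pow]

theorem mul_yx (h : IsRel g) : g 3 * g 2 * (g 3)⁻¹ = (g 2)⁻¹ := by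
  have h1 : g 3 * g 2 = g 2 ^ 3 * g 3 := by
    simpa [pow_succ, mul_assoc] using h ([3, 2], [2, 2, 2, 3]) (by simp [relations])
  rw [mul_inv_eq_iff_eq_mul, h1]
  congr 1
  exact eq_inv_of_mul_eq_one_left (by rw [← pow_succ, h.x_pow])

theorem conj_a (h : IsRel g) : ∃ w : Fin 3 → List (Fin 6), (∀ s, ∀ t ∈ w s, t = 0 ∨ t = 1 ∨ t = 5) ∧
    g 2 * g 0 * (g 2)⁻¹ = ((w 0).map g).prod ∧ g 3 * g 0 * (g 3)⁻¹ = ((w 1).map g).prod ∧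
    g 4 * g 0 * (g 4)⁻¹ = ((w 2).map g).prod := by
  refine ⟨![[1], [5, 5, 0, 0, 1], [0]], by decide, ?_, ?_, ?_⟩ <;> rw [mul_inv_eq_iff_eq_mul]
  · simpa [mul_assoc] using h ([2, 0], [1, 2]) (by simp [relations])
  · simpa [mul_assoc] using h ([3, 0], [5, 5, 0, 0, 1, 3]) (by simp [relations])
  · simpa [mul_assoc] using h ([4, 0], [0, 4]) (by simp [relations])

theorem conj_b (h : IsRel g) : ∃ w : Fin 3 → List (Fin 6), (∀ s, ∀ t ∈ w s, t = 0 ∨ t = 1 ∨ t = 5) ∧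
    g 2 * g 1 * (g 2)⁻¹ = ((w 0).map g).prod ∧ g 3 * g 1 * (g 3)⁻¹ = ((w 1).map g).prod ∧
    g 4 * g 1 * (g 4)⁻¹ = ((w 2).map g).prod := by
  refine ⟨![[0, 0], [5, 0, 1], [5, 5, 0, 0, 1]], by decide, ?_, ?_, ?_⟩ <;>
    rw [mul_inv_eq_iff_eq_mul]
  · simpa [mul_assoc] using h ([2, 1], [0, 0, 2]) (by simp [relations])
  · simpa [mul_assoc] using h ([3, 1], [5, 0, 1, 3]) (by simp [relations])
  · simpa [mul_assoc] using h ([4, 1], [5, 5, 0, 0, 1, 4]) (by simp [relations])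

theorem z_eq (h : IsRel g) : g 5 = g 0 * g 1 * (g 0)⁻¹ * (g 1)⁻¹ := by
  rw [h.mul_ab]
  group

theorem z_mem (h : IsRel g) : g 5 ∈ N g := by
  have h0 : g 0 ∈ N g := Subgroup.subset_closure (by simp)
  have h1 : g 1 ∈ N g := Subgroup.subset_closure (by simp)
  rw [h.z_eq]
  exact mul_mem (mul_mem (mul_mem h0 h1) (inv_mem h0)) (inv_mem h1)

theorem word_mem_N (h : IsRel g) {l : List (Fin 6)} (hl : ∀ t ∈ l, t = 0 ∨ t = 1 ∨ t = 5) :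
    (l.map g).prod ∈ N g := by
  refine list_prod_mem ?_
  simp only [List.mem_map]
  rintro _ ⟨t, ht, rfl⟩
  rcases hl t ht with rfl | rfl | rfl
  · exact Subgroup.subset_closure (by simp)
  · exact Subgroup.subset_closure (by simp)
  · exact h.z_mem

theorem b_mul_a_pow (h : IsRel g) (i : ℕ) : g 1 * g 0 ^ i = g 5 ^ (2 * i) * g 0 ^ i * g 1 := by
  induction i with
  | zero => simp
  | succ i ih =>
    have h1 : g 1 * g 0 = g 5 ^ 2 * (g 0 * g 1) := by
      rw [h.mul_ab, ← mul_assoc, ← pow_succ, h.z_pow, one_mul]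
    have h2 : Commute (g 0 ^ i) (g 5 ^ 2) := ((h.commute_z 0).pow_pow 2 i).symm
    rw [pow_succ, ← mul_assoc, ih, mul_assoc _ (g 1), h1, mul_add_one, pow_add]
    simp only [mul_assoc]
    rw [← mul_assoc (g 0 ^ i) (g 5 ^ 2), h2.eq]
    simp only [mul_assoc]

theorem y_mul_x_pow (h : IsRel g) (i : ℕ) : g 3 * g 2 ^ i = g 2 ^ (3 * i) * g 3 := by
  induction i with
  | zero => simp
  | succ i ih =>
    have h1 : g 3 * g 2 = g 2 ^ 3 * g 3 := by
      simpa [pow_succ, mul_assoc] using h ([3, 2], [2, 2, 2, 3]) (by simp [relations])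
    rw [pow_succ, ← mul_assoc, ih, mul_assoc, h1, ← mul_assoc, ← pow_add, mul_add_one]

/-- Since the generators have finite order, inverses are powers, and closure of `T` under left
multiplication by generators is enough. This is the tool for the normal forms. -/
theorem mem_of_left {S : Set Γ} {T : Set Γ} (h1 : 1 ∈ T) (hS : ∀ s ∈ S, ∃ n, s ^ (n + 1) = 1)
    (hm : ∀ s ∈ S, ∀ t ∈ T, s * t ∈ T) {x : Γ} (hx : x ∈ Subgroup.closure S) : x ∈ T := by
  have hp : ∀ s ∈ S, ∀ n : ℕ, ∀ t ∈ T, s ^ n * t ∈ T := by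
    intro s hs n t ht
    induction n with
    | zero => simpa using ht
    | succ n ih => rw [pow_succ', mul_assoc]; exact hm s hs _ ih
  induction hx using Subgroup.closure_induction_left with
  | one => exact h1
  | mul_left s hs y hy ih => exact hm s hs y ih
  | inv_mul_cancel s hs y hy ih =>
    obtain ⟨n, hn⟩ := hS s hs
    rw [show s⁻¹ = s ^ n from inv_eq_of_mul_eq_one_left (by rw [← pow_succ, hn])]
    exact hp s hs n y ih

theorem exists_of_mem_N (h : IsRel g) {n : Γ} (hn : n ∈ N g) :
    ∃ k i j : Fin 3, n = g 5 ^ (k : ℕ) * g 0 ^ (i : ℕ) * g 1 ^ (j : ℕ) := by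
  have h1 : n ∈ {n | ∃ k i j : ℕ, n = g 5 ^ k * g 0 ^ i * g 1 ^ j} := by
    refine mem_of_left (S := {g 0, g 1}) (T := {n | ∃ k i j : ℕ, n = g 5 ^ k * g 0 ^ i * g 1 ^ j})
      ⟨0, 0, 0, by simp⟩ ?_ ?_ hn
    · rintro s (rfl | rfl)
      · exact ⟨2, h.a_pow⟩
      · exact ⟨2, h.b_pow⟩
    · rintro s (rfl | rfl) _ ⟨k, i, j, rfl⟩
      · refine ⟨k, i + 1, j, ?_⟩
        have h2 : Commute (g 0) (g 5 ^ k) := ((h.commute_z 0).pow_left k).symm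
        rw [← mul_assoc, ← mul_assoc, h2.eq, pow_succ', mul_assoc (g 5 ^ k)]
      · refine ⟨k + 2 * i, i, j + 1, ?_⟩
        have h2 : Commute (g 1) (g 5 ^ k) := ((h.commute_z 1).pow_left k).symm
        rw [← mul_assoc, ← mul_assoc, h2.eq, mul_assoc (g 5 ^ k), h.b_mul_a_pow, pow_succ', pow_add]
        simp only [mul_assoc]
  obtain ⟨k, i, j, rfl⟩ := h1
  have hl : ∀ n, n % 3 < 3 := fun n => Nat.mod_lt _ (by norm_num)
  refine ⟨⟨k % 3, hl k⟩, ⟨i % 3, hl i⟩, ⟨j % 3, hl j⟩, ?_⟩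
  rw [← pow_eq_pow_mod k h.z_pow, ← pow_eq_pow_mod i h.a_pow, ← pow_eq_pow_mod j h.b_pow]

theorem exists_of_mem_Q (h : IsRel g) {n : Γ} (hn : n ∈ Q g) :
    ∃ l m : Fin 4, n = g 2 ^ (l : ℕ) * g 3 ^ (m : ℕ) := by
  have h1 : n ∈ {n | ∃ l m : ℕ, n = g 2 ^ l * g 3 ^ m} := by
    refine mem_of_left (S := {g 2, g 3}) (T := {n | ∃ l m : ℕ, n = g 2 ^ l * g 3 ^ m})
      ⟨0, 0, by simp⟩ ?_ ?_ hn
    · rintro s (rfl | rfl)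
      · exact ⟨3, h.x_pow⟩
      · exact ⟨3, h.y_pow⟩
    · rintro s (rfl | rfl) _ ⟨l, m, rfl⟩
      · exact ⟨l + 1, m, by rw [pow_succ', mul_assoc]⟩
      · exact ⟨3 * l, m + 1, by rw [← mul_assoc, h.y_mul_x_pow, pow_succ', mul_assoc]⟩
  obtain ⟨l, m, rfl⟩ := h1
  have hl : ∀ n, n % 4 < 4 := fun n => Nat.mod_lt _ (by norm_num)
  refine ⟨⟨l % 4, hl l⟩, ⟨m % 4, hl m⟩, ?_⟩
  rw [← pow_eq_pow_mod l h.x_pow, ← pow_eq_pow_mod m h.y_pow]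

theorem exists_of_mem_Z (h : IsRel g) {n : Γ} (hn : n ∈ Z g) : ∃ k : Fin 3, n = g 4 ^ (k : ℕ) := by
  unfold Z at hn
  rw [← Subgroup.zpowers_eq_closure] at hn
  exact Subgroup.exists_fin_pow_of_mem_zpowers h.c_pow hn

theorem finite_N (h : IsRel g) : Finite (N g) := by
  refine Set.Finite.subset (Set.finite_range fun p : Fin 3 × Fin 3 × Fin 3 =>
    g 5 ^ (p.1 : ℕ) * g 0 ^ (p.2.1 : ℕ) * g 1 ^ (p.2.2 : ℕ)) ?_
  intro n hn
  obtain ⟨k, i, j, rfl⟩ := h.exists_of_mem_N hn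
  exact ⟨(k, i, j), rfl⟩

theorem finite_Q (h : IsRel g) : Finite (Q g) := by
  refine Set.Finite.subset (Set.finite_range fun p : Fin 4 × Fin 4 =>
    g 2 ^ (p.1 : ℕ) * g 3 ^ (p.2 : ℕ)) ?_
  intro n hn
  obtain ⟨l, m, rfl⟩ := h.exists_of_mem_Q hn
  exact ⟨(l, m), rfl⟩

theorem a_mul_b_pow (h : IsRel g) (j : ℕ) : g 0 * g 1 ^ j = g 5 ^ j * (g 1 ^ j * g 0) := by
  induction j with
  | zero => simp
  | succ j ih =>
    have h2 : Commute (g 1 ^ j) (g 5) := ((h.commute_z 1).pow_right j).symm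
    rw [pow_succ, ← mul_assoc, ih, mul_assoc, mul_assoc _ (g 0), h.mul_ab, ← mul_assoc _ (g 5),
      h2.eq, pow_succ]
    simp only [mul_assoc]

/-- The exponents of a normal form can be recovered: moving `a` past it produces `z ^ j`, moving `b`
past it produces `z ^ (2 * i)`, and then `k` remains. As `z` has order 3, all 27 forms are distinct.
-/
theorem card_N (h : IsRel g) (hab : g 0 * g 1 ≠ g 1 * g 0) : Nat.card (N g) = 27 := by
  have hz : g 5 ≠ 1 := fun hz => hab (by rw [h.mul_ab, hz, one_mul])
  have ho : orderOf (g 5) = 3 := orderOf_eq_prime h.z_pow hz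
  have hmod : ∀ {i j : ℕ}, g 5 ^ i = g 5 ^ j → i % 3 = j % 3 := by
    intro i j hij
    rwa [pow_inj_mod, ho] at hij
  have hmem : ∀ p : Fin 3 × Fin 3 × Fin 3,
      g 5 ^ (p.1 : ℕ) * g 0 ^ (p.2.1 : ℕ) * g 1 ^ (p.2.2 : ℕ) ∈ N g := fun p =>
    mul_mem (mul_mem (pow_mem h.z_mem _) (pow_mem (Subgroup.subset_closure (by simp)) _))
      (pow_mem (Subgroup.subset_closure (by simp)) _)
  have ha : ∀ k i j : ℕ, g 0 * (g 5 ^ k * g 0 ^ i * g 1 ^ j) =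
      g 5 ^ j * ((g 5 ^ k * g 0 ^ i * g 1 ^ j) * g 0) := by
    intro k i j
    have h1 : Commute (g 0) (g 5 ^ k * g 0 ^ i) :=
      (((h.commute_z 0).pow_left k).symm).mul_right ((Commute.refl _).pow_right i)
    have h2 : Commute (g 5 ^ k * g 0 ^ i) (g 5 ^ j) :=
      ((Commute.refl _).pow_pow k j).mul_left (((h.commute_z 0).pow_pow j i).symm)
    rw [← mul_assoc, h1.eq, mul_assoc, h.a_mul_b_pow, ← mul_assoc, h2.eq]
    simp only [mul_assoc]
  have hb : ∀ k i j : ℕ, g 1 * (g 5 ^ k * g 0 ^ i * g 1 ^ j) =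
      g 5 ^ (2 * i) * ((g 5 ^ k * g 0 ^ i * g 1 ^ j) * g 1) := by
    intro k i j
    have h1 : Commute (g 1) (g 5 ^ k) := ((h.commute_z 1).pow_left k).symm
    have h2 : Commute (g 5 ^ k) (g 5 ^ (2 * i)) := (Commute.refl _).pow_pow _ _
    rw [← mul_assoc, ← mul_assoc, h1.eq, mul_assoc (g 5 ^ k), h.b_mul_a_pow]
    simp only [mul_assoc, ← pow_succ']
    rw [← mul_assoc, h2.eq]
    simp only [mul_assoc, ← pow_succ]
  have hbij : Function.Bijective fun p : Fin 3 × Fin 3 × Fin 3 => (⟨_, hmem p⟩ : N g) := by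
    constructor
    · rintro ⟨k, i, j⟩ ⟨k', i', j'⟩ he
      have he : g 5 ^ (k : ℕ) * g 0 ^ (i : ℕ) * g 1 ^ (j : ℕ) =
        g 5 ^ (k' : ℕ) * g 0 ^ (i' : ℕ) * g 1 ^ (j' : ℕ) := congrArg Subtype.val he
      have h1 := ha k i j
      rw [he, ha, mul_left_inj] at h1
      have h2 := hb k i j
      rw [he, hb, mul_left_inj] at h2
      have h1 := hmod h1
      have h2 := hmod h2
      have hj : j = j' := by omega
      have hi : i = i' := by omega
      rw [hi, hj, mul_left_inj, mul_left_inj] at he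
      have h3 := hmod he
      have hk : k = k' := by omega
      rw [hi, hj, hk]
    · rintro ⟨n, hn⟩
      obtain ⟨k, i, j, rfl⟩ := h.exists_of_mem_N hn
      exact ⟨(k, i, j), rfl⟩
  rw [← Nat.card_congr (Equiv.ofBijective _ hbij)]
  simp

theorem isQ8_Q (h : IsRel g) (hxy : g 2 * g 3 ≠ g 3 * g 2) : QuatDirac.IsQ8 (Q g) :=
  QuaternionGroup.isQ8_closure h.x_pow h.y_sq h.mul_yx hxy

theorem card_Z (h : IsRel g) (hc : g 4 ≠ 1) : Nat.card (Z g) = 3 := by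
  rw [Z, ← Subgroup.zpowers_eq_closure, Nat.card_zpowers, orderOf_eq_prime h.c_pow hc]

theorem finite_Z (h : IsRel g) : Finite (Z g) := by
  rw [Z, ← Subgroup.zpowers_eq_closure]
  have : IsOfFinOrder (g 4) := isOfFinOrder_iff_pow_eq_one.2 ⟨3, by norm_num, h.c_pow⟩
  exact (finite_zpowers.2 this).to_subtype

theorem sup_eq_closure : Q g ⊔ Z g = Subgroup.closure {g 2, g 3, g 4} := by
  rw [Q, Z, ← Subgroup.closure_union]
  congr 1
  ext s
  simp only [Set.mem_union, Set.mem_insert_iff, Set.mem_singleton_iff]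
  tauto

theorem QZ_le_normalizer (h : IsRel g) : Q g ⊔ Z g ≤ Subgroup.normalizer (N g : Set Γ) := by
  have := h.finite_N
  refine Subgroup.le_normalizer_of_generators rfl sup_eq_closure ?_
  obtain ⟨w, hw, a0, a1, a2⟩ := h.conj_a
  obtain ⟨w', hw', b0, b1, b2⟩ := h.conj_b
  rintro s (rfl | rfl | rfl) t (rfl | rfl)
  · rw [a0]; exact h.word_mem_N (hw _)
  · rw [b0]; exact h.word_mem_N (hw' _)
  · rw [a1]; exact h.word_mem_N (hw _)
  · rw [b1]; exact h.word_mem_N (hw' _)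
  · rw [a2]; exact h.word_mem_N (hw _)
  · rw [b2]; exact h.word_mem_N (hw' _)

theorem Z_le_normalizer (h : IsRel g) : Z g ≤ Subgroup.normalizer (Q g : Set Γ) := by
  have := h.finite_Q
  refine Subgroup.le_normalizer_of_generators rfl rfl ?_
  have hx : g 2 ∈ Q g := Subgroup.subset_closure (by simp)
  have hy : g 3 ∈ Q g := Subgroup.subset_closure (by simp)
  rintro s rfl t (rfl | rfl)
  · have : g 4 * g 2 * (g 4)⁻¹ = g 3 := by
      rw [mul_inv_eq_iff_eq_mul]
      simpa [mul_assoc] using h ([4, 2], [3, 4]) (by simp [relations])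
    rwa [this]
  · have : g 4 * g 3 * (g 4)⁻¹ = g 2 * g 2 * g 2 * g 3 := by
      rw [mul_inv_eq_iff_eq_mul]
      simpa [mul_assoc] using h ([4, 3], [2, 2, 2, 3, 4]) (by simp [relations])
    rw [this]
    exact mul_mem (mul_mem (mul_mem hx hx) hx) hy

theorem inf_QZ (h : IsRel g) (hxy : g 2 * g 3 ≠ g 3 * g 2) (hc : g 4 ≠ 1) : Q g ⊓ Z g = ⊥ := by
  have := h.finite_Q
  have := h.finite_Z
  refine disjoint_iff.1 (Subgroup.disjoint_of_coprime_natCard ?_)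
  rw [DiracModel.IsQ8.card (h.isQ8_Q hxy), h.card_Z hc]
  norm_num

/-- The subgroup generated by all generators. -/
def total (g : Fin 6 → Γ) : Subgroup Γ := N g ⊔ (Q g ⊔ Z g)

theorem total_eq_closure : total g = Subgroup.closure {g 0, g 1, g 2, g 3, g 4} := by
  rw [total, sup_eq_closure, N, ← Subgroup.closure_union]
  congr 1
  ext s
  simp only [Set.mem_union, Set.mem_insert_iff, Set.mem_singleton_iff]
  tauto

theorem card_total (h : IsRel g) (hab : g 0 * g 1 ≠ g 1 * g 0) (hxy : g 2 * g 3 ≠ g 3 * g 2)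
    (hc : g 4 ≠ 1) (hN : N g ⊓ (Q g ⊔ Z g) = ⊥) : Nat.card (total g) = 648 := by
  rw [total, Subgroup.card_sup_of_inf_eq_bot h.QZ_le_normalizer hN,
    Subgroup.card_sup_of_inf_eq_bot h.Z_le_normalizer (h.inf_QZ hxy hc), h.card_N hab, h.card_Z hc,
    DiracModel.IsQ8.card (h.isQ8_Q hxy)]

/-- The upper bound needs no trivial intersection, so it applies to the subgroup of a product used
in `exists_hom`. -/
theorem card_total_le (h : IsRel g) (hab : g 0 * g 1 ≠ g 1 * g 0) (hxy : g 2 * g 3 ≠ g 3 * g 2)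
    (hc : g 4 ≠ 1) : Finite (total g) ∧ Nat.card (total g) ≤ 648 := by
  have := h.finite_N
  have := h.finite_Q
  have := h.finite_Z
  obtain ⟨hf, h1⟩ := Subgroup.card_sup_le h.Z_le_normalizer
  obtain ⟨hf', h2⟩ := Subgroup.card_sup_le h.QZ_le_normalizer
  refine ⟨hf', h2.trans ?_⟩
  rw [h.card_N hab]
  rw [DiracModel.IsQ8.card (h.isQ8_Q hxy), h.card_Z hc] at h1
  omega

theorem exists_normalForm (h : IsRel g) {s : Γ} (hs : s ∈ total g) :
    ∃ k i j l m n, s = normalForm g k i j l m n := by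
  obtain ⟨u, hu, v, hv, rfl⟩ := Subgroup.exists_mul_of_mem_sup h.QZ_le_normalizer hs
  obtain ⟨p, hp, r, hr, rfl⟩ := Subgroup.exists_mul_of_mem_sup h.Z_le_normalizer hv
  obtain ⟨k, i, j, rfl⟩ := h.exists_of_mem_N hu
  obtain ⟨l, m, rfl⟩ := h.exists_of_mem_Q hp
  obtain ⟨n, rfl⟩ := h.exists_of_mem_Z hr
  exact ⟨k, i, j, l, m, n, rfl⟩

end IsRel
/-! ### Consequences of the relations -/

namespace IsRel

/-- All generators have order dividing 3 or 4. The common exponent turns matrices satisfying the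
relations into units. -/
theorem pow_twelve {Γ : Type*} [Monoid Γ] {g : Fin 6 → Γ} (h : IsRel g) (i : Fin 6) :
    g i ^ 12 = 1 := by
  have h3 : ∀ x : Γ, x * (x * x) = 1 → x ^ 12 = 1 := fun x hx => by
    rw [show 12 = 3 * 4 from rfl, pow_mul, show x ^ 3 = x * (x * x) by simp [pow_succ, mul_assoc],
      hx, one_pow]
  have h4 : ∀ x : Γ, x * (x * (x * x)) = 1 → x ^ 12 = 1 := fun x hx => by
    rw [show 12 = 4 * 3 from rfl, pow_mul,
      show x ^ 4 = x * (x * (x * x)) by simp [pow_succ, mul_assoc], hx, one_pow]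
  have hx : g 2 * (g 2 * (g 2 * g 2)) = 1 := by
    simpa using h ([2, 2, 2, 2], []) (by simp [relations])
  fin_cases i
  · exact h3 _ (by simpa using h ([0, 0, 0], []) (by simp [relations]))
  · exact h3 _ (by simpa using h ([1, 1, 1], []) (by simp [relations]))
  · exact h4 _ hx
  · have hy : g 3 * g 3 = g 2 * g 2 := by simpa using h ([3, 3], [2, 2]) (by simp [relations])
    exact h4 (g 3) (by rw [← mul_assoc, hy, mul_assoc, hx])
  · exact h3 _ (by simpa using h ([4, 4, 4], []) (by simp [relations]))
  · exact h3 _ (by simpa using h ([5, 5, 5], []) (by simp [relations]))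

/-- The units given by elements satisfying the relations. -/
def unit {Γ : Type*} [Monoid Γ] {g : Fin 6 → Γ} (h : IsRel g) (i : Fin 6) : Γˣ :=
  Units.ofPowEqOne (g i) 12 (h.pow_twelve i) (by norm_num)

theorem isRel_unit {Γ : Type*} [Monoid Γ] {g : Fin 6 → Γ} (h : IsRel g) : IsRel h.unit := by
  intro r hr
  ext1
  have := h r hr
  change Units.coeHom Γ _ = Units.coeHom Γ _
  rw [map_list_prod, map_list_prod, List.map_map, List.map_map]
  exact this

variable {Γ : Type*} [Group Γ] {g : Fin 6 → Γ}

theorem b_eq (h : IsRel g) : g 1 = g 2 * g 0 * (g 2)⁻¹ := by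
  rw [eq_mul_inv_iff_mul_eq]
  simpa using (h ([2, 0], [1, 2]) (by simp [relations])).symm

theorem y_eq (h : IsRel g) : g 3 = g 4 * g 2 * (g 4)⁻¹ := by
  rw [eq_mul_inv_iff_mul_eq]
  simpa using (h ([4, 2], [3, 4]) (by simp [relations])).symm

theorem total_eq_closure_three (h : IsRel g) :
    total g = Subgroup.closure {g 0, g 2, (g 4)⁻¹} := by
  rw [total_eq_closure]
  refine le_antisymm ?_ ?_
  · rw [Subgroup.closure_le]
    have h0 : g 0 ∈ Subgroup.closure {g 0, g 2, (g 4)⁻¹} := Subgroup.subset_closure (by simp)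
    have h2 : g 2 ∈ Subgroup.closure {g 0, g 2, (g 4)⁻¹} := Subgroup.subset_closure (by simp)
    have h4 : g 4 ∈ Subgroup.closure {g 0, g 2, (g 4)⁻¹} :=
      inv_mem_iff.1 (Subgroup.subset_closure (by simp))
    rintro s (rfl | rfl | rfl | rfl | rfl)
    · exact h0
    · rw [h.b_eq]; exact mul_mem (mul_mem h2 h0) (inv_mem h2)
    · exact h2
    · rw [h.y_eq]; exact mul_mem (mul_mem h4 h2) (inv_mem h4)
    · exact h4
  · rw [Subgroup.closure_le]
    rintro s (rfl | rfl | rfl)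
    · exact Subgroup.subset_closure (by simp)
    · exact Subgroup.subset_closure (by simp)
    · exact inv_mem (Subgroup.subset_closure (by simp))

/-- A character that is nontrivial on `c` separates the normal subgroup from its complement. -/
theorem inf_N (h : IsRel g) {A : Type*} [CommGroup A] (f : Γ →* A) (hf : f (g 4) ≠ 1)
    (hab : g 0 * g 1 ≠ g 1 * g 0) (hxy : g 2 * g 3 ≠ g 3 * g 2) : N g ⊓ (Q g ⊔ Z g) = ⊥ := by
  -- In an abelian image conjugate elements agree; then `x b = a² x` forces `a` to 1 and `c y = x³ y
  -- c` forces `x` to 1. The character therefore kills both `N` and `Q` and detects only `c`.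
  have hba : f (g 1) = f (g 0) := by
    rw [h.b_eq, map_mul, map_mul, map_inv, mul_right_comm, mul_inv_cancel, one_mul]
  have hyx : f (g 3) = f (g 2) := by
    rw [h.y_eq, map_mul, map_mul, map_inv, mul_right_comm, mul_inv_cancel, one_mul]
  have ha : f (g 0) = 1 := by
    have h1 := congrArg f (h ([2, 1], [0, 0, 2]) (by simp [relations]))
    simp only [List.map_cons, List.map_nil, List.prod_cons, List.prod_nil, map_mul, mul_one,
      hba] at h1
    rw [mul_comm (f (g 2))] at h1
    exact mul_eq_right.1 (mul_left_cancel h1).symm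
  have hx : f (g 2) = 1 := by
    have h1 := congrArg f (h ([4, 3], [2, 2, 2, 3, 4]) (by simp [relations]))
    simp only [List.map_cons, List.map_nil, List.prod_cons, List.prod_nil, map_mul, mul_one,
      hyx] at h1
    have h2 := congrArg f h.x_pow
    rw [map_pow, map_one] at h2
    have h3 : f (g 2) * (f (g 2) * (f (g 2) * (f (g 2) * f (g 4)))) =
        f (g 2) ^ 4 * f (g 4) := by simp [pow_succ, mul_assoc]
    rw [h3, h2, one_mul] at h1
    exact mul_eq_left.1 h1
  have hN : N g ≤ f.ker := by
    rw [N, Subgroup.closure_le]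
    rintro s (rfl | rfl)
    · exact ha
    · exact hba.trans ha
  have hQ : Q g ≤ f.ker := by
    rw [Q, Subgroup.closure_le]
    rintro s (rfl | rfl)
    · exact hx
    · exact hyx.trans hx
  have := h.finite_N
  have := h.finite_Q
  have hNQ : N g ⊓ Q g = ⊥ := by
    refine disjoint_iff.1 (Subgroup.disjoint_of_coprime_natCard ?_)
    rw [DiracModel.IsQ8.card (h.isQ8_Q hxy), h.card_N hab]
    norm_num
  rw [eq_bot_iff]
  rintro u ⟨hu, hu'⟩
  obtain ⟨p, hp, r, hr, rfl⟩ := Subgroup.exists_mul_of_mem_sup h.Z_le_normalizer hu'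
  obtain ⟨n, rfl⟩ := h.exists_of_mem_Z hr
  have h1 : f (p * g 4 ^ (n : ℕ)) = 1 := hN hu
  rw [map_mul, show f p = 1 from hQ hp, one_mul, map_pow] at h1
  have ho : orderOf (f (g 4)) = 3 :=
    orderOf_eq_prime (by rw [← map_pow, h.c_pow, map_one]) hf
  have h2 := orderOf_dvd_of_pow_eq_one h1
  rw [ho] at h2
  have h3 : (n : ℕ) = 0 := by omega
  rw [h3, pow_zero, mul_one] at hu ⊢
  exact hNQ ▸ ⟨hu, hp⟩

theorem mem_total (h : IsRel g) (i : Fin 6) : g i ∈ total g := by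
  rcases eq_or_ne i 5 with rfl | hi
  · exact Subgroup.mem_sup_left h.z_mem
  · rw [total_eq_closure]
    refine Subgroup.subset_closure ?_
    fin_cases i <;> simp at hi ⊢

theorem map_total {Δ : Type*} [Group Δ] (f : Γ →* Δ) :
    (total g).map f = total fun i => f (g i) := by
  rw [total_eq_closure, total_eq_closure, MonoidHom.map_closure]
  simp [Set.image_insert_eq]

/-- The homomorphism on the group of order 648 given by the relations. -/
theorem exists_hom {Δ : Type*} [Group Δ] {g' : Fin 6 → Δ} (h : IsRel g) (h' : IsRel g')
    (hab : g 0 * g 1 ≠ g 1 * g 0) (hxy : g 2 * g 3 ≠ g 3 * g 2) (hc : g 4 ≠ 1)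
    (hcard : Nat.card (total g) = 648) :
    ∃ f : total g →* Δ, ∀ i, f ⟨g i, h.mem_total i⟩ = g' i := by
  -- The pairs `(g i, g' i)` satisfy the relations, so they generate a group of order at most 648.
  -- It projects onto `total g`, of order exactly 648, so it is the graph of a homomorphism.
  have hp := h.prod h'
  obtain ⟨hfin, hle⟩ := hp.card_total_le (fun he => hab (congrArg Prod.fst he))
    (fun he => hxy (congrArg Prod.fst he)) (fun he => hc (congrArg Prod.fst he))
  have hmap : (total fun i => (g i, g' i)).map (MonoidHom.fst Γ Δ) = total g :=
    map_total _
  let p : (total fun i => (g i, g' i)) →* total g :=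
    ((MonoidHom.fst Γ Δ).comp (Subgroup.subtype _)).codRestrict _ fun u =>
      hmap ▸ Subgroup.mem_map_of_mem _ u.2
  have hsurj : Function.Surjective p := by
    rintro ⟨u, hu⟩
    rw [← hmap] at hu
    obtain ⟨w, hw, rfl⟩ := hu
    exact ⟨⟨w, hw⟩, rfl⟩
  have hbij : Function.Bijective p :=
    (Nat.bijective_iff_surjective_and_card p).2 ⟨hsurj,
      le_antisymm (hle.trans hcard.ge) (Nat.card_le_card_of_surjective p hsurj)⟩
  let E := MulEquiv.ofBijective p hbij
  refine ⟨((MonoidHom.snd Γ Δ).comp (Subgroup.subtype _)).comp E.symm.toMonoidHom, fun i => ?_⟩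
  have : E.symm ⟨g i, h.mem_total i⟩ = ⟨(g i, g' i), hp.mem_total i⟩ := by
    rw [MulEquiv.symm_apply_eq]
    rfl
  change ((E.symm ⟨g i, h.mem_total i⟩ : _) : Γ × Δ).2 = _
  rw [this]

end IsRel

/-! ### Scaled matrices -/

section scaled

variable {R S : Type*} [Ring R] [Ring S] (f : R →+* S) (s : S)

/-- A power of `s` times the image of a ring element. -/
def scaled (n : ℕ) (x : R) : S := s ^ n * f x

variable {f s}

theorem scaled_mul (hs : ∀ x, Commute s x) (n m : ℕ) (x y : R) :
    scaled f s n x * scaled f s m y = scaled f s (n + m) (x * y) := by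
  rw [scaled, scaled, scaled, map_mul, pow_add, mul_assoc, ← mul_assoc (f x),
    ← ((hs (f x)).pow_left m).eq]
  simp only [mul_assoc]

/-- Clearing denominators: an equation between matrices with denominators powers of `τ` follows from
a decidable equation over the integral ring. -/
theorem scaled_eq (hs : ∀ x, Commute s x) {τ : R} (hτ : s * f τ = 1) {n m : ℕ} {x y : R}
    (h : τ ^ m * x = τ ^ n * y) : scaled f s n x = scaled f s m y := by
  have h1 : ∀ k, s ^ k * f τ ^ k = 1 := fun k => by rw [← (hs (f τ)).mul_pow, hτ, one_pow]
  calc s ^ n * f x = s ^ n * (s ^ m * f τ ^ m) * f x := by rw [h1, mul_one]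
    _ = s ^ n * s ^ m * f (τ ^ m * x) := by rw [map_mul, map_pow]; simp only [mul_assoc]
    _ = s ^ m * (s ^ n * f τ ^ n) * f y := by
      rw [h, map_mul, map_pow, ← pow_add, add_comm, pow_add]; simp only [mul_assoc]
    _ = s ^ m * f y := by rw [h1, mul_one]

theorem scaled_prod (hs : ∀ x, Commute s x) (d : Fin 6 → ℕ) (X : Fin 6 → R) (l : List (Fin 6)) :
    (l.map fun i => scaled f s (d i) (X i)).prod =
      scaled f s (l.map d).sum (l.map X).prod := by
  induction l with
  | nil => simp [scaled]
  | cons i l ih => simp only [List.map_cons, List.prod_cons, List.sum_cons, ih, scaled_mul hs]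

theorem isRel_scaled (hs : ∀ x, Commute s x) {τ : R} (hτ : s * f τ = 1) {d : Fin 6 → ℕ}
    {X : Fin 6 → R} (h : ∀ r ∈ relations, τ ^ (r.2.map d).sum * (r.1.map X).prod =
      τ ^ (r.1.map d).sum * (r.2.map X).prod) : IsRel fun i => scaled f s (d i) (X i) := by
  intro r hr
  rw [scaled_prod hs, scaled_prod hs]
  exact scaled_eq hs hτ (h r hr)

end scaled

/-! ### The matrices over the Eisenstein integers -/

/-- The Eisenstein integers. -/
abbrev Eis : Type := QuadraticAlgebra ℤ (-1) (-1)

/-- The primitive cube root of unity. -/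
def ev : Eis := ⟨0, 1⟩
/-- The other primitive cube root of unity. -/
def ew : Eis := ⟨-1, -1⟩
/-- The square root of `-3`. -/
def et : Eis := ⟨1, 2⟩

/-- Integral multiples of the generators of the complex reflection group. -/
def eisGen : Fin 6 → Matrix (Fin 3) (Fin 3) Eis :=
  ![!![1, 0, 0; 0, ev, 0; 0, 0, ew], !![0, 1, 0; 0, 0, 1; 1, 0, 0],
    !![1, 1, 1; 1, ev, ew; 1, ew, ev], !![1, ev, ev; ew, ev, ew; ew, ew, ev],
    !![ev, 0, 0; 0, 1, 0; 0, 0, 1], !![ew, 0, 0; 0, ew, 0; 0, 0, ew]]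

/-- The denominators of the generators. -/
def eisDeg : Fin 6 → ℕ := ![0, 0, 1, 1, 0, 0]

theorem eis_relations : ∀ r ∈ relations,
    (!![et, 0, 0; 0, et, 0; 0, 0, et] : Matrix (Fin 3) (Fin 3) Eis) ^ (r.2.map eisDeg).sum *
      (r.1.map eisGen).prod =
    (!![et, 0, 0; 0, et, 0; 0, 0, et] : Matrix (Fin 3) (Fin 3) Eis) ^ (r.1.map eisDeg).sum *
      (r.2.map eisGen).prod := by
  decide +kernel

/-- Integral multiples of the generators of the quaternionic matrix group. -/
def quatGen : Fin 6 → IntMat :=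
  ![!![-1, 1, 1, 1; -1, 1, -1, -1; -1, -1, 1, -1; -1, -1, -1, 1],
    !![-1, -ri, -rj, -rk; -ri, 1, rk, -rj; -rj, -rk, 1, ri; -rk, rj, -ri, 1],
    !![1, 0, 0, 0; 0, ri, 0, 0; 0, 0, rj, 0; 0, 0, 0, rk],
    !![1, 0, 0, 0; 0, rk, 0, 0; 0, 0, ri, 0; 0, 0, 0, rj],
    !![1, 0, 0, 0; 0, 0, 0, 1; 0, 1, 0, 0; 0, 0, 1, 0],
    !![⟨-1, -1, -1, -1⟩, 0, 0, 0; 0, 0, 0, ⟨-1, -1, -1, -1⟩; 0, ⟨-1, -1, -1, -1⟩, 0, 0;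
      0, 0, ⟨-1, -1, -1, -1⟩, 0]]

/-- The denominators of the generators. -/
def quatDeg : Fin 6 → ℕ := ![1, 1, 0, 0, 0, 1]

theorem quat_relations : ∀ r ∈ relations,
    (2 : IntMat) ^ (r.2.map quatDeg).sum * (r.1.map quatGen).prod =
    (2 : IntMat) ^ (r.1.map quatDeg).sum * (r.2.map quatGen).prod := by
  decide +kernel

/-! ### The complex reflection group -/

theorem v_pow : QuatDirac.v ^ 3 = 1 :=
  (Complex.isPrimitiveRoot_exp 3 (by norm_num)).pow_eq_one

theorem v_ne_one : QuatDirac.v ≠ 1 :=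
  (Complex.isPrimitiveRoot_exp 3 (by norm_num)).ne_one (by norm_num)

theorem v_sq : QuatDirac.v * QuatDirac.v = (-1 : ℤ) • 1 + (-1 : ℤ) • QuatDirac.v := by
  have h : (QuatDirac.v - 1) * (QuatDirac.v * QuatDirac.v + QuatDirac.v + 1) = 0 := by
    linear_combination v_pow
  have h1 := (mul_eq_zero.1 h).resolve_left (sub_ne_zero.2 v_ne_one)
  simp only [zsmul_eq_mul]
  push_cast
  linear_combination h1

/-- The embedding of the Eisenstein integers in the complex numbers. -/
noncomputable def eisMap : Eis →+* ℂ :=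
  (QuadraticAlgebra.lift ⟨QuatDirac.v, v_sq⟩ : Eis →ₐ[ℤ] ℂ).toRingHom

theorem eisMap_mk (a b : ℤ) : eisMap ⟨a, b⟩ = a + b * QuatDirac.v := by
  change a • (1 : ℂ) + b • QuatDirac.v = _
  simp

theorem eisMap_ev : eisMap ev = QuatDirac.v := by simp [ev, eisMap_mk]

theorem eisMap_ew : eisMap ew = QuatDirac.w := by
  have := v_sq
  simp only [zsmul_eq_mul] at this
  push_cast at this
  rw [ew, eisMap_mk, QuatDirac.w]
  push_cast
  linear_combination -this

theorem eisMap_et : eisMap et = QuatDirac.t := by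
  rw [QuatDirac.t, ← eisMap_ev, ← eisMap_ew, ← map_sub]
  rfl

theorem t_sq : QuatDirac.t * QuatDirac.t = -3 := by
  rw [← eisMap_et, ← map_mul, show et * et = -3 by decide, map_neg, map_ofNat]

/-- The embedding of matrices over the Eisenstein integers in the complex matrices. -/
noncomputable def eisMatMap : Matrix (Fin 3) (Fin 3) Eis →+* Matrix (Fin 3) (Fin 3) ℂ :=
  eisMap.mapMatrix

theorem eisMatMap_fin (A : Fin 3 → Fin 3 → Eis) : eisMatMap (Matrix.of A) =
    !![eisMap (A 0 0), eisMap (A 0 1), eisMap (A 0 2);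
       eisMap (A 1 0), eisMap (A 1 1), eisMap (A 1 2);
       eisMap (A 2 0), eisMap (A 2 1), eisMap (A 2 2)] := by
  ext1 i j
  change eisMap _ = _
  fin_cases i <;> fin_cases j <;> rfl

/-- The scalar inverse to `t`. -/
noncomputable def tInv : Matrix (Fin 3) (Fin 3) ℂ := (-QuatDirac.t / 3) • 1

theorem commute_tInv (x : Matrix (Fin 3) (Fin 3) ℂ) : Commute tInv x := by
  rw [commute_iff_eq, tInv, smul_mul_assoc, mul_smul_comm, one_mul, mul_one]

/-- The generators of the complex reflection group as matrices. -/
noncomputable def complexGen (i : Fin 6) : Matrix (Fin 3) (Fin 3) ℂ :=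
  scaled eisMatMap tInv (eisDeg i) (eisGen i)

theorem isRel_complexGen : IsRel complexGen := by
  refine isRel_scaled commute_tInv (τ := !![et, 0, 0; 0, et, 0; 0, 0, et]) ?_ eis_relations
  -- Because `t² = -3`, the scalar `-t/3` is the inverse of `t`, so `t` is the only denominator.
  have h : -QuatDirac.t / 3 * QuatDirac.t = 1 := by linear_combination (-1 / 3) * t_sq
  rw [tInv, smul_mul_assoc, one_mul, eisMatMap_fin]
  ext i j
  fin_cases i <;> fin_cases j <;> simp [eisMap_et, h]

/-- The generators of the complex reflection group. -/
noncomputable def g3 : Fin 6 → (Matrix (Fin 3) (Fin 3) ℂ)ˣ := isRel_complexGen.unit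

theorem isRel_g3 : IsRel g3 := isRel_complexGen.isRel_unit

theorem coe_g3 (i : Fin 6) : (g3 i : Matrix (Fin 3) (Fin 3) ℂ) =
    (![!![1, 0, 0; 0, QuatDirac.v, 0; 0, 0, QuatDirac.w], !![0, 1, 0; 0, 0, 1; 1, 0, 0],
      (-QuatDirac.t / 3) • !![1, 1, 1; 1, QuatDirac.v, QuatDirac.w; 1, QuatDirac.w, QuatDirac.v],
      (-QuatDirac.t / 3) • !![1, QuatDirac.v, QuatDirac.v;
        QuatDirac.w, QuatDirac.v, QuatDirac.w; QuatDirac.w, QuatDirac.w, QuatDirac.v],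
      !![QuatDirac.v, 0, 0; 0, 1, 0; 0, 0, 1],
      !![QuatDirac.w, 0, 0; 0, QuatDirac.w, 0; 0, 0, QuatDirac.w]] i :
      Matrix (Fin 3) (Fin 3) ℂ) := by
  change tInv ^ eisDeg i * eisMatMap (eisGen i) = _
  fin_cases i <;> simp [eisDeg, eisGen, tInv, eisMatMap_fin, eisMap_ev, eisMap_ew]

theorem G27_eq : G27 = IsRel.N g3 := by
  unfold G27 QuatDirac.matrixGroup IsRel.N
  congr 1
  ext u
  simp only [Set.mem_ofPred_eq, Set.mem_insert_iff, Set.mem_singleton_iff, Units.ext_iff, coe_g3]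
  rfl

theorem pauliQ8_eq : pauliQ8 = IsRel.Q g3 := by
  unfold pauliQ8 QuatDirac.matrixGroup IsRel.Q
  congr 1
  ext u
  simp only [Set.mem_ofPred_eq, Set.mem_insert_iff, Set.mem_singleton_iff, Units.ext_iff, coe_g3]
  rfl

theorem reflZ3_eq : reflZ3 = IsRel.Z g3 := by
  unfold reflZ3 QuatDirac.matrixGroup IsRel.Z
  congr 1
  ext u
  simp only [Set.mem_ofPred_eq, Set.mem_singleton_iff, Units.ext_iff, coe_g3]
  rfl

theorem G648_eq : G648 = IsRel.total g3 := by
  rw [G648, G27_eq, pauliQ8_eq, reflZ3_eq, IsRel.total, sup_assoc]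

theorem g3_ab : g3 0 * g3 1 ≠ g3 1 * g3 0 := by
  intro h
  have h1 := congrArg (fun u : (Matrix (Fin 3) (Fin 3) ℂ)ˣ => (u : Matrix (Fin 3) (Fin 3) ℂ) 0 1) h
  simp [coe_g3] at h1
  exact v_ne_one h1.symm

theorem det_g3 : Matrix.GeneralLinearGroup.det (g3 4) ≠ 1 := by
  intro h
  have h1 := congrArg Units.val h
  rw [Matrix.GeneralLinearGroup.val_det_apply, coe_g3] at h1
  simp [Matrix.det_fin_three] at h1
  exact v_ne_one h1

theorem g3_c : g3 4 ≠ 1 := by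
  intro h
  exact det_g3 (by rw [h, map_one])

theorem g3_xy : g3 2 * g3 3 ≠ g3 3 * g3 2 := by
  intro h
  have h2 : g3 3 * g3 2 * (g3 3)⁻¹ = g3 2 := by rw [← h, mul_inv_cancel_right]
  rw [isRel_g3.mul_yx] at h2
  have h3 : g3 2 * g3 2 = 1 := by nth_rewrite 1 [← h2]; exact inv_mul_cancel _
  -- If `x` and `y` commuted, then `x² = 1`. But the middle diagonal entry of `x²` is a multiple of
  -- `1 + v² + v⁴`, which is divisible by `1 + v + v²` and so vanishes.
  have h4 := congrArg (fun u : (Matrix (Fin 3) (Fin 3) ℂ)ˣ => (u : Matrix (Fin 3) (Fin 3) ℂ) 1 1) h3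
  simp [coe_g3, Matrix.mul_apply, Fin.sum_univ_three, QuatDirac.w] at h4
  have h5 := v_sq
  simp only [zsmul_eq_mul] at h5
  push_cast at h5
  have h6 : (1 : ℂ) = 0 := by
    linear_combination (QuatDirac.t ^ 2 / 9) * (QuatDirac.v ^ 2 - QuatDirac.v + 1) * h5 - h4
  exact one_ne_zero h6

/-! ### The quaternionic matrix group -/

/-- The scalar matrix one half. -/
noncomputable def half : Matrix (Fin 4) (Fin 4) ℍ[ℝ] := (1 / 2 : ℝ) • 1

theorem commute_half (x : Matrix (Fin 4) (Fin 4) ℍ[ℝ]) : Commute half x := by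
  rw [commute_iff_eq, half, smul_mul_assoc, mul_smul_comm, one_mul, mul_one]

theorem half_mul_two : half * matMap 2 = 1 := by
  have h : (2 : Matrix (Fin 4) (Fin 4) ℍ[ℝ]) = (2 : ℝ) • 1 := by
    rw [← Algebra.algebraMap_eq_smul_one, map_ofNat]
  rw [half, map_ofNat, h, smul_mul_smul_comm, one_mul]
  norm_num

theorem scaled_half (n : ℕ) (x : IntMat) :
    scaled matMap half n x = (1 / 2 : ℝ) ^ n • matMap x := by
  rw [scaled, half, smul_pow, one_pow, smul_mul_assoc, one_mul]

/-- The generators of the quaternionic matrix group as matrices. -/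
noncomputable def quatMatGen (i : Fin 6) : Matrix (Fin 4) (Fin 4) ℍ[ℝ] :=
  scaled matMap half (quatDeg i) (quatGen i)

theorem isRel_quatMatGen : IsRel quatMatGen :=
  isRel_scaled commute_half half_mul_two quat_relations

/-- The generators of the quaternionic matrix group. -/
noncomputable def g4 : Fin 6 → GL4H := isRel_quatMatGen.unit

theorem isRel_g4 : IsRel g4 := isRel_quatMatGen.isRel_unit

theorem coe_g4 (i : Fin 6) : (g4 i : Matrix (Fin 4) (Fin 4) ℍ[ℝ]) =
    (1 / 2 : ℝ) ^ quatDeg i • matMap (quatGen i) := scaled_half _ _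

theorem coe_g4_zero : (g4 0 : Matrix (Fin 4) (Fin 4) ℍ[ℝ]) = gellMannMat := by
  rw [coe_g4, gellMannMat]
  simp [quatDeg, quatGen, matMap_fin]

theorem coe_g4_two : (g4 2 : Matrix (Fin 4) (Fin 4) ℍ[ℝ]) = pauliMat := by
  rw [coe_g4, pauliMat]
  simp [quatDeg, quatGen, matMap_fin, quatMap_ri, quatMap_rj, quatMap_rk]

/-- The inverse of the permutation matrix, not the matrix itself, corresponds to `diag(v,1,1)` in
the common relations. -/
theorem coe_g4_four_inv : (((g4 4)⁻¹ : GL4H) : Matrix (Fin 4) (Fin 4) ℍ[ℝ]) = permMat := by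
  symm
  refine Units.eq_inv_of_mul_eq_one_right ?_
  rw [coe_g4, permMat]
  simp [quatDeg, quatGen, matMap_fin]
  ext1 i j
  fin_cases i <;> fin_cases j <;> rfl

theorem K648_eq : K648 = IsRel.total g4 := by
  rw [isRel_g4.total_eq_closure_three]
  unfold K648 QuatDirac.matrixGroup
  congr 1
  ext u
  simp only [Set.mem_ofPred_eq, Set.mem_insert_iff, Set.mem_singleton_iff, Units.ext_iff,
    coe_g4_zero, coe_g4_two, coe_g4_four_inv]

theorem word_eq_g4 (l : List (Fin 13)) (i : Fin 6)
    (h : (2 ^ quatDeg i : ℤ) • (l.map reflMat2).prod = (2 ^ l.length : ℤ) • quatGen i) :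
    (l.map refl).prod = g4 i := by
  ext1
  rw [coe_list_prod, coe_g4]
  have h1 := congrArg matMap h
  rw [matMap_intCast_mul, matMap_intCast_mul] at h1
  have h2 := congrArg (fun X => ((1 / 2 : ℝ) ^ l.length * (1 / 2 : ℝ) ^ quatDeg i) • X) h1
  simp only [smul_smul] at h2
  push_cast at h2
  have h3 : ∀ m : ℕ, (1 / 2 : ℝ) ^ m * 2 ^ m = 1 := fun m => by rw [← mul_pow]; norm_num
  rwa [mul_assoc, h3, mul_one, mul_right_comm, h3, one_mul] at h2

/-- Words in the reflections for the generators `a`, `x`, `c`. -/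
def g4Word : Fin 6 → List (Fin 13) := ![[0, 1], [], [5, 4, 2, 3], [], [3, 2], []]

theorem word_zero : ((g4Word 0).map refl).prod = g4 0 := word_eq_g4 _ _ (by decide +kernel)
theorem word_two : ((g4Word 2).map refl).prod = g4 2 := word_eq_g4 _ _ (by decide +kernel)
theorem word_four : ((g4Word 4).map refl).prod = g4 4 := word_eq_g4 _ _ (by decide +kernel)

theorem word_mem_W (l : List (Fin 13)) : (l.map refl).prod ∈ W := by
  refine list_prod_mem ?_
  simp only [List.mem_map]
  rintro _ ⟨k, _, rfl⟩
  exact refl_mem k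

theorem actV_word (l : List (Fin 13)) (x : V) : actV ⟨(l.map refl).prod, word_mem_W l⟩ x =
    l.foldr (fun k y => siegel (reflLeft k).vec (reflRight k).vec y) x := by
  induction l generalizing x with
  | nil => exact congrFun (congrArg _ (map_one actV)) x
  | cons k l ih =>
    have h : (⟨((k :: l).map refl).prod, word_mem_W _⟩ : W) =
        ⟨refl k, refl_mem k⟩ * ⟨(l.map refl).prod, word_mem_W l⟩ := rfl
    rw [h, map_mul, Equiv.Perm.mul_apply, actV_refl, ih, List.foldr_cons]

theorem total_g4_le : IsRel.total g4 ≤ W := by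
  rw [isRel_g4.total_eq_closure_three, Subgroup.closure_le]
  rintro s (rfl | rfl | rfl)
  · exact word_zero ▸ word_mem_W _
  · exact word_two ▸ word_mem_W _
  · exact inv_mem (word_four ▸ word_mem_W _)

theorem g4_mem_W (i : Fin 6) : g4 i ∈ W := total_g4_le (isRel_g4.mem_total i)

/-- The permutations of `V` induced by the generators. -/
noncomputable def gV (i : Fin 6) : Equiv.Perm V := actV ⟨g4 i, g4_mem_W i⟩

theorem isRel_gV : IsRel gV := by
  have h : IsRel fun i => (⟨g4 i, g4_mem_W i⟩ : W) := by
    intro r hr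
    refine Subtype.ext ?_
    have := isRel_g4 r hr
    change W.subtype _ = W.subtype _
    rw [map_list_prod, map_list_prod, List.map_map, List.map_map]
    exact this
  exact h.map actV

/-- The images of the basis of `V` under the generators. -/
def gImage : Fin 6 → Fin 6 → ℕ :=
  ![![1, 2, 12, 4, 32, 48], ![48, 16, 2, 3, 4, 8], ![61, 22, 46, 55, 58, 31],
    ![21, 42, 45, 54, 57, 30], ![1, 2, 8, 12, 32, 48], ![2, 3, 8, 12, 32, 48]]

/-- The action of the generators on `V`, by linear extension. -/
def gFun (i : Fin 6) (x : V) : V :=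
  (if x.bit 0 then V.ofNat (gImage i 0) else 0) + ((if x.bit 1 then V.ofNat (gImage i 1) else 0) +
    ((if x.bit 2 then V.ofNat (gImage i 2) else 0) + ((if x.bit 3 then V.ofNat (gImage i 3) else 0) +
    ((if x.bit 4 then V.ofNat (gImage i 4) else 0) +
      (if x.bit 5 then V.ofNat (gImage i 5) else 0)))))

theorem gV_word {i : Fin 6} (l : List (Fin 13)) (h : (l.map refl).prod = g4 i) (x : V) :
    gV i x = l.foldr (fun k y => siegel (reflLeft k).vec (reflRight k).vec y) x := by
  rw [← actV_word, gV]
  congr 3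
  exact h.symm

theorem gFun_word : ∀ x : V,
    (g4Word 0).foldr (fun k y => siegel (reflLeft k).vec (reflRight k).vec y) x = gFun 0 x ∧
    (g4Word 2).foldr (fun k y => siegel (reflLeft k).vec (reflRight k).vec y) x = gFun 2 x ∧
    (g4Word 4).foldr (fun k y => siegel (reflLeft k).vec (reflRight k).vec y) x = gFun 4 x := by
  decide +kernel

theorem gFun_relations : ∀ x : V, gFun 1 (gFun 2 x) = gFun 2 (gFun 0 x) ∧
    gFun 3 (gFun 4 x) = gFun 4 (gFun 2 x) ∧
    gFun 5 (gFun 1 (gFun 0 x)) = gFun 0 (gFun 1 x) := by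
  decide +kernel

theorem gV_apply (i : Fin 6) (x : V) : gV i x = gFun i x := by
  have h0 : ∀ x, gV 0 x = gFun 0 x := fun x => (gV_word _ word_zero x).trans (gFun_word x).1
  have h2 : ∀ x, gV 2 x = gFun 2 x := fun x => (gV_word _ word_two x).trans (gFun_word x).2.1
  have h4 : ∀ x, gV 4 x = gFun 4 x := fun x => (gV_word _ word_four x).trans (gFun_word x).2.2
  -- Words in the reflections are evaluated only for `a`, `x`, `c`. The relations determine the
  -- actions of `b`, `y`, `z`.
  have h1 : ∀ x, gV 1 x = gFun 1 x := by
    intro x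
    obtain ⟨y, rfl⟩ := (gV 2).surjective x
    have h := isRel_gV ([2, 0], [1, 2]) (by simp [relations])
    simp only [List.map_cons, List.map_nil, List.prod_cons, List.prod_nil, mul_one] at h
    rw [← Equiv.Perm.mul_apply, ← h, Equiv.Perm.mul_apply, h2, h0, h2, (gFun_relations y).1]
  have h3 : ∀ x, gV 3 x = gFun 3 x := by
    intro x
    obtain ⟨y, rfl⟩ := (gV 4).surjective x
    have h := isRel_gV ([4, 2], [3, 4]) (by simp [relations])
    simp only [List.map_cons, List.map_nil, List.prod_cons, List.prod_nil, mul_one] at h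
    rw [← Equiv.Perm.mul_apply, ← h, Equiv.Perm.mul_apply, h2, h4, h4, (gFun_relations y).2.1]
  have h5 : ∀ x, gV 5 x = gFun 5 x := by
    intro x
    obtain ⟨y, rfl⟩ := (gV 1 * gV 0).surjective x
    have h := isRel_gV.mul_ab
    rw [← Equiv.Perm.mul_apply, ← h, Equiv.Perm.mul_apply, h0, h1, Equiv.Perm.mul_apply, h1, h0,
      (gFun_relations y).2.2]
  fin_cases i
  · exact h0 x
  · exact h1 x
  · exact h2 x
  · exact h3 x
  · exact h4 x
  · exact h5 x

/-- The action of a normal form on `V`. -/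
def gNormal (k i j : Fin 3) (l m : Fin 4) (n : Fin 3) (x : V) : V :=
  (gFun 5)^[k] ((gFun 0)^[i] ((gFun 1)^[j] ((gFun 2)^[l] ((gFun 3)^[m] ((gFun 4)^[n] x)))))

-- An exhaustive check of all normal forms on the basis of `V`. The exception `l = m = 2` is
-- harmless because `x² y² = x⁴ = 1`.
set_option synthInstance.maxSize 1000 in
set_option synthInstance.maxHeartbeats 200000 in
theorem gNormal_eq : ∀ (k i j : Fin 3) (l m : Fin 4) (n : Fin 3),
    (∀ s : Fin 6, gNormal k i j l m n (e s) = e s) →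
    k = 0 ∧ i = 0 ∧ j = 0 ∧ (l = 0 ∧ m = 0 ∨ l = 2 ∧ m = 2) ∧ n = 0 := by
  decide +kernel

theorem gV_pow_apply (i : Fin 6) (n : ℕ) (x : V) : (gV i ^ n) x = (gFun i)^[n] x := by
  rw [← Equiv.Perm.iterate_eq_pow]
  exact congrFun (congrArg (·^[n]) (funext (gV_apply i))) x

/-- The normal forms acting trivially on `V` are trivial. -/
theorem normalForm_eq_one {Γ : Type*} [Group Γ] {g : Fin 6 → Γ} (h : IsRel g)
    {k i j : Fin 3} {l m : Fin 4} {n : Fin 3} (hV : normalForm gV k i j l m n = 1) :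
    normalForm g k i j l m n = 1 := by
  have h1 := gNormal_eq k i j l m n fun s => by
    have h2 := congrArg (fun p : Equiv.Perm V => p (e s)) hV
    simp only [normalForm, mul_assoc, Equiv.Perm.mul_apply, gV_pow_apply] at h2
    exact h2
  obtain ⟨rfl, rfl, rfl, ⟨rfl, rfl⟩ | ⟨rfl, rfl⟩, rfl⟩ := h1
  · simp [normalForm]
  · have h2 : g 2 ^ 2 * g 3 ^ 2 = 1 := by rw [h.y_sq, ← pow_add, h.x_pow]
    simpa [normalForm] using h2

/-- Every element has a normal form, and normal forms trivial on `V` are already trivial as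
consequences of the relations. -/
theorem injective_of_gV {Γ : Type*} [Group Γ] {g : Fin 6 → Γ} (h : IsRel g)
    (f : IsRel.total g →* Equiv.Perm V) (hf : ∀ i, f ⟨g i, h.mem_total i⟩ = gV i) :
    Function.Injective f := by
  have h' : IsRel fun i => (⟨g i, h.mem_total i⟩ : IsRel.total g) := by
    intro r hr
    refine Subtype.ext ?_
    have := h r hr
    change (IsRel.total g).subtype _ = (IsRel.total g).subtype _
    rw [map_list_prod, map_list_prod, List.map_map, List.map_map]
    exact this
  rw [injective_iff_map_eq_one]
  rintro ⟨u, hu⟩ h1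
  obtain ⟨k, i, j, l, m, n, rfl⟩ := h.exists_normalForm hu
  have h2 : (⟨normalForm g k i j l m n, hu⟩ : IsRel.total g) =
      normalForm (fun i => (⟨g i, h.mem_total i⟩ : IsRel.total g)) k i j l m n :=
    Subtype.ext (map_normalForm (IsRel.total g).subtype
      (fun i => (⟨g i, h.mem_total i⟩ : IsRel.total g)) k i j l m n).symm
  rw [h2] at h1 ⊢
  rw [map_normalForm] at h1
  simp only [hf] at h1
  exact normalForm_eq_one h' h1

/-! ### Transport along isomorphisms -/

section transport

variable {Γ Δ : Type*} [Group Γ] [Group Δ]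

theorem IsExtraspecial.congr (θ : Γ ≃* Δ) {p : ℕ} (h : IsExtraspecial p Γ) :
    IsExtraspecial p Δ := by
  obtain ⟨h1, h2, h3, h4⟩ := h
  have hc : (Subgroup.center Γ).map θ.toMonoidHom = Subgroup.center Δ := by
    ext x
    constructor
    · rintro ⟨y, hy, rfl⟩
      rw [Subgroup.mem_center_iff]
      intro z
      obtain ⟨z, rfl⟩ := θ.surjective z
      change θ z * θ y = θ y * θ z
      rw [← map_mul, ← map_mul, Subgroup.mem_center_iff.1 hy]
    · intro hx
      refine ⟨θ.symm x, Subgroup.mem_center_iff.2 fun z => ?_, θ.apply_symm_apply x⟩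
      apply θ.injective
      rw [map_mul, map_mul, θ.apply_symm_apply]
      exact Subgroup.mem_center_iff.1 hx _
  refine ⟨h1.of_equiv θ, ?_, ?_, fun g => ?_⟩
  · rw [← hc, ← h2]
    exact Nat.card_congr (θ.subgroupMap _).symm.toEquiv
  · rw [← hc, ← h3, commutator_def, commutator_def, Subgroup.map_commutator]
    congr 1 <;> exact (Subgroup.map_top_of_surjective _ θ.surjective).symm
  · rw [← hc]
    exact ⟨θ.symm g ^ p, h4 _, by simp⟩

/-- Isomorphic groups have isomorphic outer automorphism groups. -/
def outerCongr (θ : Γ ≃* Δ) : Outer Γ ≃* Outer Δ :=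
  QuotientGroup.congr _ _ (MulAut.congr θ) (by
    ext f
    constructor
    · rintro ⟨_, ⟨x, rfl⟩, rfl⟩
      refine ⟨θ x, ?_⟩
      ext y
      simp [MulAut.congr]
    · rintro ⟨x, rfl⟩
      refine ⟨MulAut.conj (θ.symm x), ⟨_, rfl⟩, ?_⟩
      ext y
      simp [MulAut.congr])

theorem ncard_isQ8_congr (θ : Γ ≃* Δ) :
    {H : Subgroup Δ | IsQ8 H}.ncard = {H : Subgroup Γ | IsQ8 H}.ncard := by
  rw [← Set.ncard_image_of_injective _ (map_injective θ)]
  congr 1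
  ext H
  constructor
  · intro h
    exact ⟨_, IsQ8.map θ.symm h, map_map_symm θ H⟩
  · rintro ⟨H, h, rfl⟩
    exact IsQ8.map θ h

theorem image_map_symm (θ : Γ ≃* Δ) (F : Set (Subgroup Δ)) :
    (fun H => H.map θ.toMonoidHom) '' ((fun H => H.map θ.symm.toMonoidHom) '' F) = F := by
  rw [Set.image_image]
  simp only [map_map_symm, Set.image_id']

theorem ncard_isQ8Factorisation_congr (θ : Γ ≃* Δ) :
    {F : Set (Subgroup Δ) | IsQ8Factorisation F}.ncard =
    {F : Set (Subgroup Γ) | IsQ8Factorisation F}.ncard := by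
  rw [← Set.ncard_image_of_injective _ (Set.image_injective.2 (map_injective θ))]
  congr 1
  ext F
  constructor
  · intro h
    exact ⟨_, IsQ8Factorisation.map θ.symm h, image_map_symm θ F⟩
  · rintro ⟨F, h, rfl⟩
    exact IsQ8Factorisation.map θ h

theorem map_congr (θ : Γ ≃* Δ) (f : MulAut Γ) (H : Subgroup Δ) :
    H.map (MulAut.congr θ f).toMonoidHom =
      ((H.map θ.symm.toMonoidHom).map f.toMonoidHom).map θ.toMonoidHom := by
  rw [Subgroup.map_map, Subgroup.map_map]
  rfl

end transport

theorem exists_map_eq_E128 {H K : Subgroup E128} (hH : IsQ8 H) (hK : IsQ8 K) :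
    ∃ f : MulAut E128, H.map f.toMonoidHom = K := by
  obtain ⟨f, hf⟩ := M.exists_map_eq (IsQ8.map repEquiv.symm hH) (IsQ8.map repEquiv.symm hK)
  refine ⟨MulAut.congr repEquiv f, ?_⟩
  rw [map_congr, hf, map_map_symm]

theorem exists_image_eq_E128 {F F' : Set (Subgroup E128)} (hF : IsQ8Factorisation F)
    (hF' : IsQ8Factorisation F') :
    ∃ f : MulAut E128, (fun H => H.map f.toMonoidHom) '' F = F' := by
  obtain ⟨f, hf⟩ := M.exists_image_eq (IsQ8Factorisation.map repEquiv.symm hF)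
    (IsQ8Factorisation.map repEquiv.symm hF')
  refine ⟨MulAut.congr repEquiv f, ?_⟩
  simp only [map_congr]
  rw [← image_map_symm repEquiv F', ← hf, Set.image_image, Set.image_image]

/-! ### The action of the group of order 648 -/

namespace IsRel

variable {Γ Δ : Type*} [Group Γ] [Group Δ] {g : Fin 6 → Γ} {g' : Fin 6 → Δ}

theorem exists_normalForm_hom (h : IsRel g) {f : total g →* Δ}
    (hf : ∀ i, f ⟨g i, h.mem_total i⟩ = g' i) (u : total g) :
    ∃ k i j l m n, u = normalForm (fun i => (⟨g i, h.mem_total i⟩ : total g)) k i j l m n ∧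
      f u = normalForm g' k i j l m n := by
  obtain ⟨u, hu⟩ := u
  obtain ⟨k, i, j, l, m, n, rfl⟩ := h.exists_normalForm hu
  have h2 : (⟨normalForm g k i j l m n, hu⟩ : total g) =
      normalForm (fun i => (⟨g i, h.mem_total i⟩ : total g)) k i j l m n :=
    Subtype.ext (map_normalForm (total g).subtype
      (fun i => (⟨g i, h.mem_total i⟩ : total g)) k i j l m n).symm
  refine ⟨k, i, j, l, m, n, h2, ?_⟩
  rw [h2, map_normalForm]
  simp only [hf]

theorem normalForm_mem {H : Subgroup Γ} (hH : ∀ i, g i ∈ H) (k i j : Fin 3)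
    (l m : Fin 4) (n : Fin 3) : normalForm g k i j l m n ∈ H :=
  mul_mem (mul_mem (mul_mem (pow_mem (hH _) _) (pow_mem (hH _) _)) (pow_mem (hH _) _))
    (mul_mem (mul_mem (pow_mem (hH _) _) (pow_mem (hH _) _)) (pow_mem (hH _) _))

theorem range_eq (h : IsRel g) (h' : IsRel g') {f : total g →* Δ}
    (hf : ∀ i, f ⟨g i, h.mem_total i⟩ = g' i) : f.range = total g' := by
  refine le_antisymm ?_ ?_
  · rintro _ ⟨u, rfl⟩
    obtain ⟨k, i, j, l, m, n, _, hu⟩ := h.exists_normalForm_hom hf u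
    rw [hu]
    exact normalForm_mem h'.mem_total _ _ _ _ _ _
  · intro u hu
    obtain ⟨k, i, j, l, m, n, rfl⟩ := h'.exists_normalForm hu
    have hm : ∀ i, g' i ∈ f.range := fun i => ⟨_, hf i⟩
    exact normalForm_mem hm _ _ _ _ _ _

theorem z_mem_center (h : IsRel g) :
    (⟨g 5, h.mem_total 5⟩ : total g) ∈ Subgroup.center (total g) := by
  rw [Subgroup.mem_center_iff]
  rintro ⟨u, hu⟩
  refine Subtype.ext ?_
  have h1 : total g ≤ Subgroup.centralizer {g 5} := by
    rw [total_eq_closure, Subgroup.closure_le]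
    rintro s (rfl | rfl | rfl | rfl | rfl) <;>
      exact Subgroup.mem_centralizer_singleton_iff.2 (h.commute_z _).symm.eq
  exact Subgroup.mem_centralizer_singleton_iff.1 (h1 hu)

end IsRel

theorem card_total_g3 : Nat.card (IsRel.total g3) = 648 :=
  isRel_g3.card_total g3_ab g3_xy g3_c (isRel_g3.inf_N _ det_g3 g3_ab g3_xy)

theorem g3_z_ne_one : g3 5 ≠ 1 := fun h => g3_ab (by rw [isRel_g3.mul_ab, h, one_mul])

theorem exists_iota : ∃ f : IsRel.total g3 →* GL4H, ∀ i, f ⟨g3 i, isRel_g3.mem_total i⟩ = g4 i :=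
  isRel_g3.exists_hom isRel_g4 g3_ab g3_xy g3_c card_total_g3

/-- The embedding of the complex reflection group in the quaternionic matrices. -/
noncomputable def iota : IsRel.total g3 →* GL4H := exists_iota.choose

theorem iota_apply (i : Fin 6) : iota ⟨g3 i, isRel_g3.mem_total i⟩ = g4 i :=
  exists_iota.choose_spec i

theorem range_iota : iota.range = IsRel.total g4 := isRel_g3.range_eq isRel_g4 iota_apply

theorem iota_mem_W (u : IsRel.total g3) : iota u ∈ W :=
  total_g4_le (range_iota ▸ ⟨u, rfl⟩)

/-- The embedding of the complex reflection group in the quaternionic reflection group. -/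
noncomputable def iotaW : IsRel.total g3 →* W := iota.codRestrict W iota_mem_W

theorem actV_iotaW_injective : Function.Injective (actV.comp iotaW) := by
  refine injective_of_gV isRel_g3 _ fun i => ?_
  rw [MonoidHom.comp_apply, gV]
  congr 1
  exact Subtype.ext (iota_apply i)

theorem iota_injective : Function.Injective iota := by
  have h : Function.Injective iotaW := Function.Injective.of_comp (f := actV)
    (by rw [← MonoidHom.coe_comp]; exact actV_iotaW_injective)
  intro u u' he
  exact h (Subtype.ext he)

/-- The action of the complex reflection group on the group of Dirac matrices. -/
noncomputable def phi : IsRel.total g3 →* MulAut E128 :=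
  conjE.comp ((Subgroup.inclusion W_le_normalizerE).comp iotaW)

theorem coe_phi (u : IsRel.total g3) (x : E128) :
    (phi u x : GL4H) = iota u * (x : GL4H) * (iota u)⁻¹ := rfl

theorem phi_injective : Function.Injective phi := by
  have h : (M.bar.comp (MulAut.congr repEquiv.symm).toMonoidHom).comp phi = actV.comp iotaW := rfl
  have h1 := actV_iotaW_injective
  rw [← h, MonoidHom.coe_comp] at h1
  exact Function.Injective.of_comp h1

theorem phi_unique (ψ : IsRel.total g3 →* MulAut E128) (hψ : Function.Injective ψ) :
    ∃ (α : MulAut (IsRel.total g3)) (β : MulAut E128), ∀ u, ψ u = β * phi (α u) * β⁻¹ := by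
  have h : ∀ f : IsRel.total g3 →* MulAut E128, Function.Injective f →
      Function.Injective ((MulAut.congr repEquiv.symm).toMonoidHom.comp f) := fun f hf =>
    (MulAut.congr repEquiv.symm).injective.comp hf
  obtain ⟨α, β, hαβ⟩ := M.unique_action card_total_g3
    (x := ⟨g3 0, isRel_g3.mem_total 0⟩) (y := ⟨g3 1, isRel_g3.mem_total 1⟩)
    (z := ⟨g3 5, isRel_g3.mem_total 5⟩) (Subtype.ext isRel_g3.a_pow) (Subtype.ext isRel_g3.z_pow)
    (fun he => g3_z_ne_one (congrArg Subtype.val he)) (Subtype.ext isRel_g3.mul_ab)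
    isRel_g3.z_mem_center (h _ phi_injective) (h _ hψ)
  refine ⟨α, (MulAut.congr repEquiv.symm).symm β, fun u => ?_⟩
  apply (MulAut.congr repEquiv.symm).injective
  rw [map_mul, map_mul, map_inv, MulEquiv.apply_symm_apply]
  exact hαβ u

/-! ### The semidirect product of `E128` and `K648` -/

theorem card_E128 : Nat.card E128 = 128 := by
  rw [← M.card]
  exact Nat.card_congr repEquiv.symm.toEquiv

theorem K648_le_W : K648 ≤ W := K648_eq ▸ total_g4_le

/-- `E128` acts trivially on `V`, whereas K, the image of `iota`, acts faithfully there. -/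
theorem E128_inf_K648 : E128 ⊓ K648 = ⊥ := by
  rw [eq_bot_iff]
  rintro u ⟨hu, hu'⟩
  rw [SetLike.mem_coe, K648_eq, ← range_iota] at hu'
  obtain ⟨s, rfl⟩ := hu'
  have h1 : iotaW s ∈ actV.ker := by rw [ker_actV]; exact hu
  have h2 : s = 1 := actV_iotaW_injective ((MonoidHom.mem_ker.1 h1).trans (map_one _).symm)
  rw [h2, map_one]
  exact one_mem _

theorem card_K648 : Nat.card K648 = 648 := by
  rw [K648_eq, ← range_iota, ← card_total_g3]
  exact Nat.card_congr (MonoidHom.ofInjective iota_injective).symm.toEquiv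

theorem K648_le_normalizer : K648 ≤ Subgroup.normalizer (E128 : Set GL4H) :=
  K648_le_W.trans W_le_normalizerE

end DiracModel

/-! ### The main theorem -/

open DiracModel

theorem mainTheorem6 :
    -- the abstract structure of the acting group, of order 648
    (QuatDirac.IsSemidirect QuatDirac.G27 (QuatDirac.pauliQ8 ⊔ QuatDirac.reflZ3) QuatDirac.G648 ∧
      QuatDirac.IsSemidirect QuatDirac.pauliQ8 QuatDirac.reflZ3
        (QuatDirac.pauliQ8 ⊔ QuatDirac.reflZ3) ∧
      Nat.card QuatDirac.G27 = 27 ∧ QuatDirac.IsQ8 QuatDirac.pauliQ8 ∧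
      Nat.card QuatDirac.reflZ3 = 3 ∧ Nat.card QuatDirac.G648 = 648) ∧
    -- the group of quaternionic Dirac matrices
    (Nat.card QuatDirac.E128 = 128 ∧ QuatDirac.IsExtraspecial 2 QuatDirac.E128) ∧
    -- existence, realisation in a quaternionic reflection group, and uniqueness of the action
    (∃ (W : Subgroup QuatDirac.GL4H) (ι : QuatDirac.G648 →* QuatDirac.GL4H)
        (φ : QuatDirac.G648 →* MulAut QuatDirac.E128),
      QuatDirac.IsReflectionGroup W ∧ QuatDirac.E128 ≤ W ∧
      -- the reflection group is an extension of the Dirac group by the rotations in W(E₆)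
      (∃ f : W →* QuatDirac.weylE6Rotations,
        Function.Surjective f ∧ f.ker = QuatDirac.E128.subgroupOf W) ∧
      Function.Injective ι ∧ ι.range = QuatDirac.K648 ∧ QuatDirac.K648 ≤ W ∧
      (∃ g : QuatDirac.G648, (g : (Matrix (Fin 3) (Fin 3) ℂ)ˣ) ∈ QuatDirac.G27 ∧
        (ι g : Matrix (Fin 4) (Fin 4) (Quaternion ℝ)) = QuatDirac.gellMannMat) ∧
      (∃ g : QuatDirac.G648, (g : (Matrix (Fin 3) (Fin 3) ℂ)ˣ) ∈ QuatDirac.pauliQ8 ∧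
        (ι g : Matrix (Fin 4) (Fin 4) (Quaternion ℝ)) = QuatDirac.pauliMat) ∧
      (∃ g : QuatDirac.G648, (g : (Matrix (Fin 3) (Fin 3) ℂ)ˣ) ∈ QuatDirac.reflZ3 ∧
        (ι g : Matrix (Fin 4) (Fin 4) (Quaternion ℝ)) = QuatDirac.permMat) ∧
      (∀ (g : QuatDirac.G648) (e : QuatDirac.E128),
        ((φ g e : QuatDirac.E128) : QuatDirac.GL4H) = ι g * (e : QuatDirac.GL4H) * (ι g)⁻¹) ∧
      Function.Injective φ ∧
      (∀ ψ : QuatDirac.G648 →* MulAut QuatDirac.E128, Function.Injective ψ →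
        ∃ (α : MulAut QuatDirac.G648) (β : MulAut QuatDirac.E128),
          ∀ g : QuatDirac.G648, ψ g = β * φ (α g) * β⁻¹)) ∧
    -- the combined group of order 82944
    (QuatDirac.IsSemidirect QuatDirac.E128 QuatDirac.K648 (QuatDirac.E128 ⊔ QuatDirac.K648) ∧
      Nat.card (QuatDirac.E128 ⊔ QuatDirac.K648 : Subgroup QuatDirac.GL4H) = 82944) ∧
    -- the outer automorphism group
    Nonempty (QuatDirac.Outer QuatDirac.E128 ≃* QuatDirac.weylE6) ∧
    -- the subgroups `Q₈`
    ({H : Subgroup QuatDirac.E128 | QuatDirac.IsQ8 H}.ncard = 120 ∧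
      ∀ H K : Subgroup QuatDirac.E128, QuatDirac.IsQ8 H → QuatDirac.IsQ8 K →
        ∃ β : MulAut QuatDirac.E128, H.map β.toMonoidHom = K) ∧
    -- the factorisations as a central product of three copies of `Q₈`
    ({F : Set (Subgroup QuatDirac.E128) | QuatDirac.IsQ8Factorisation F}.ncard = 40 ∧
      ∀ F F' : Set (Subgroup QuatDirac.E128), QuatDirac.IsQ8Factorisation F →
        QuatDirac.IsQ8Factorisation F' →
        ∃ β : MulAut QuatDirac.E128, (fun H => H.map β.toMonoidHom) '' F = F') := by
  open DiracModel in
  rw [G648_eq, G27_eq, pauliQ8_eq, reflZ3_eq]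
  have hN := isRel_g3.inf_N _ det_g3 g3_ab g3_xy
  refine ⟨⟨Subgroup.isSemidirect_of_le_normalizer isRel_g3.QZ_le_normalizer hN,
    Subgroup.isSemidirect_of_le_normalizer isRel_g3.Z_le_normalizer
      (isRel_g3.inf_QZ g3_xy g3_c), isRel_g3.card_N g3_ab, isRel_g3.isQ8_Q g3_xy,
    isRel_g3.card_Z g3_c, card_total_g3⟩,
    ⟨card_E128, IsExtraspecial.congr repEquiv M.isExtraspecial⟩,
    ⟨W, iota, phi, isReflectionGroup_W, E128_le_W,
      ⟨rotationMap, rotationMap_surjective, ker_rotationMap⟩, iota_injective,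
      range_iota.trans K648_eq.symm, K648_le_W, ?_, ?_, ?_, coe_phi, phi_injective, phi_unique⟩,
    ⟨Subgroup.isSemidirect_of_le_normalizer K648_le_normalizer E128_inf_K648, ?_⟩,
    ⟨(outerCongr repEquiv).symm.trans outerEquiv⟩,
    ⟨(ncard_isQ8_congr repEquiv).trans M.ncard_isQ8, fun _ _ => exists_map_eq_E128⟩,
    ⟨(ncard_isQ8Factorisation_congr repEquiv).trans M.ncard_isQ8Factorisation,
      fun _ _ => exists_image_eq_E128⟩⟩
  · exact ⟨⟨g3 0, isRel_g3.mem_total 0⟩, Subgroup.subset_closure (by simp),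
      by rw [iota_apply, coe_g4_zero]⟩
  · exact ⟨⟨g3 2, isRel_g3.mem_total 2⟩, Subgroup.subset_closure (by simp),
      by rw [iota_apply, coe_g4_two]⟩
  -- The preimage of the permutation matrix is the inverse of `diag(v,1,1)`.
  · exact ⟨⟨g3 4, isRel_g3.mem_total 4⟩⁻¹, inv_mem (Subgroup.subset_closure (by simp)),
      by rw [map_inv, iota_apply, coe_g4_four_inv]⟩
  · rw [Subgroup.card_sup_of_inf_eq_bot K648_le_normalizer E128_inf_K648, card_E128, card_K648]
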